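/- Let $B$ be a scheme over $\mathbb{C}$ and let $\tau$ be a finite tree with vertices $V_\tau$, edges $E_\tau$ and tails $T_\tau$ (labelled by a finite set); the flags at a vertex are the tails and half-edges bounding it. A *prestable spin curve of genus zero over $B$ of constant tree type $\tau$* is a flat, proper, finitely presented morphism $c\colon C\to B$ whose geometric fibers are curves with at most nodal singularities, together with * closed subschemes $C_v\subset C$ ($v\in V_\tau$) covering $C$, each a family of projective lines over $B$ (Zariski locally on $B$ isomorphic to $\mathbb{P}^1$); * for every flag $f$ at $v$ a section $p_f\colon B\to C_v$, sections of distinct flags at the same vertex being disjoint, such that the two sections belonging to the half-edges of an edge $e$ agree in $C$ (giving the nodal section $p_e\colon B\to C$), and such that distinct components $C_v$, $C_w$ meet only in nodes $p_e$ with $e$ joining $v$ and $w$; the tails give the marked points $p_t\colon B\to C$; * line bundles $S_v$ on $C_v$ with isomorphisms $S_v\cong\mathcal{H}om(S_v,T_{C_v/B})$, that is $S_v\otimes S_v\cong T_{C_v/B}$. The spinor bundle is $S_C=\bigoplus_v i_{v*}S_v$, where $i_v\colon C_v\to C$ is the inclusion. The curve is *stable* if every vertex of $\tau$ has at least three flags.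 Its SUSY normal bundle is $$N_C=\operatorname{coker}\Bigl(c_*S_C\to\bigoplus_{t\in T_\tau}p_t^*S_C\oplus\bigoplus_{e\in E_\tau}p_e^*S_C\Bigr),\qquad s\mapsto\bigl((p_t^*s)_t,(p_e^*s)_e\bigr).$$ Let $X$ be a smooth separated scheme over $\mathbb{C}$. A *stable spin map* $\phi\colon C\to X$ over $B$ of constant tree type is a morphism over $\mathbb{C}$ from such a (not necessarily stable) curve such that for every $v$ either $\phi$ is constant on all geometric fibers of $C_v\to B$ (we say that $v$ has class zero) or on none of them, and such that every vertex of class zero has at least three flags. With $S_C^\vee\otimes\phi^*T_X:=\bigoplus_v i_{v*}(S_v^\vee\otimes\phi|_{C_v}^*T_X)$, and $\langle s,d\phi\rangle$ the contraction of $s$ with $d\phi$, a section of $\bigoplus_v i_{v*}(S_v^\vee\otimes S_v^\vee\otimes\phi|_{C_v}^*T_X)$, its SUSY normal bundle is $$N_{(C,\phi)}=\operatorname{coker}\Bigl(c_*S_C\to\bigoplus_{t\in T_\tau}p_t^*S_C\oplus\bigoplus_{e\in E_\tau}p_e^*S_C\oplus c_*(S_C^\vee\otimes\phi^*T_X)\Bigr),\qquad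 s\mapsto\bigl((p_t^*s)_t,(p_e^*s)_e,-\langle s,d\phi\rangle\bigr).$$ **Proposition.** (1) Let $C$ be a stable spin curve over $B$ of constant tree type $\tau$, let $t_0\in T_\tau$, and let $st\colon C\to\tilde C$ be the map to the stable spin curve $\tilde C$ over $B$ obtained by removing the marked point $p_{t_0}$ and stabilizing (the component with $t_0$ is contracted if it has exactly three flags; $st$ is an isomorphism on the other components, compatibly with the spinor bundles). Then there is a short exact sequence $$0\to p_{t_0}^*S_C\to N_C\to N_{\tilde C}\to 0$$ of $\mathcal{O}_B$-modules, whose first map is induced by the inclusion of the summand $p_{t_0}^*S_C$. (2) Let $\phi\colon C\to X$ be a stable spin map over $B$ of constant tree type, let $t_0\in T_\tau$, and let $\tilde\phi\colon\tilde C\to X$ be the stable spin map with $\tilde\phi\circ st=\phi$ obtained by removing $p_{t_0}$ and stabilizing (the component with $t_0$ is contracted if it has class zero and exactly three flags). Then there is a short exact sequence $$0\to p_{t_0}^*S_C\to N_{(C,\phi)}\to N_{(\tilde C,\tilde\phi)}\to 0$$ of $\mathcal{O}_B$-modules, whose first map is induced by the inclusion of the summand $p_{t_0}^*S_C$. -/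

import Mathlib

open CategoryTheory AlgebraicGeometry Opposite TopologicalSpace
open CategoryTheory.Limits

noncomputable section
namespace SusyNormal

/-- The data of a sheaf of `𝒪_C`-modules given by explicit sections and restriction maps. -/
structure ModuleData (C : Scheme.{0}) where
  Sec : C.Opens → Type
  [group : ∀ U, AddCommGroup (Sec U)]
  [module : ∀ U, Module Γ(C, U) (Sec U)]
  res : ∀ {U V : C.Opens}, V ≤ U → Sec U →+ Sec V
  res_id : ∀ (U : C.Opens) (a : Sec U), res le_rfl a = a
  res_comp : ∀ {U V W : C.Opens} (h : V ≤ U) (k : W ≤ V) (a : Sec U),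
    res k (res h a) = res (k.trans h) a
  res_smul : ∀ {U V : C.Opens} (h : V ≤ U) (r : Γ(C, U)) (a : Sec U),
    res h (r • a) = C.presheaf.map (homOfLE h).op r • res h a
  glue : ∀ (ι : Type) (U : ι → C.Opens) (s : ∀ i, Sec (U i)),
    (∀ i j, res (inf_le_left : U i ⊓ U j ≤ U i) (s i) = res inf_le_right (s j)) →
      ∃! t : Sec (iSup U), ∀ i, res (le_iSup U i) t = s i

namespace ModuleData

attribute [instance] ModuleData.group ModuleData.module

variable {C : Scheme.{0}} (D : ModuleData C)

/-- The underlying presheaf of abelian groups. -/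
def presheaf : TopCat.Presheaf Ab C where
  obj U := .of (D.Sec U.unop)
  map f := AddCommGrpCat.ofHom (D.res f.unop.le)
  map_id U := by ext a; exact D.res_id _ a
  map_comp f g := by ext a; exact (D.res_comp _ _ a).symm

instance (U : C.Opensᵒᵖ) : Module (C.ringCatSheaf.obj.obj U) (D.presheaf.obj U) :=
  inferInstanceAs (Module Γ(C, U.unop) (D.Sec U.unop))

/-- The resulting object of Mathlib's category of sheaves of modules. -/
def toModules : C.Modules where
  val := PresheafOfModules.ofPresheaf (R := C.ringCatSheaf.obj) D.presheaf
    (fun _ _ f r a ↦ D.res_smul f.unop.le r a)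
  isSheaf := (TopCat.Presheaf.isSheaf_iff_isSheafUniqueGluing D.presheaf).2
    (fun ι U s hs ↦ D.glue ι U s hs)


/-- A morphism of sheaves of modules from compatible linear maps on sections. -/
def hom {M N : C.Modules} (f : ∀ U : C.Opens, Γ(M, U) →ₗ[Γ(C, U)] Γ(N, U))
    (hf : ∀ {U V : C.Opens} (h : V ≤ U) (m : Γ(M, U)),
      f V (M.presheaf.map (homOfLE h).op m) = N.presheaf.map (homOfLE h).op (f U m)) : M ⟶ N where
  val := PresheafOfModules.homMk
    { app U := AddCommGrpCat.ofHom (f U.unop).toAddMonoidHom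
      naturality _ _ g := by ext m; exact hf g.unop.le m }
    (fun U r m ↦ (f U.unop).map_smul r m)


end ModuleData

section Gluing

lemma map_map_apply (C : Scheme.{0}) {U V W : C.Opens} (h : V ≤ U) (k : W ≤ V) (a : Γ(C, U)) :
    C.presheaf.map (homOfLE k).op (C.presheaf.map (homOfLE h).op a) =
      C.presheaf.map (homOfLE (k.trans h)).op a := by
  rw [← CommRingCat.comp_apply, ← Functor.map_comp]; rfl

lemma map_rfl_apply (C : Scheme.{0}) {U : C.Opens} (a : Γ(C, U)) :
    C.presheaf.map (homOfLE le_rfl).op a = a := by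
  rw [show (homOfLE (le_refl U)).op = 𝟙 _ from rfl, CategoryTheory.Functor.map_id]; rfl

lemma exists_glue {C : Scheme.{0}} {ι : Type} (U : ι → C.Opens) (W : C.Opens) (hW : W ≤ iSup U)
    (x : ∀ i, Γ(C, W ⊓ U i))
    (hx : ∀ i j, C.presheaf.map (homOfLE (inf_le_left : (W ⊓ U i) ⊓ (W ⊓ U j) ≤ _)).op (x i) =
      C.presheaf.map (homOfLE inf_le_right).op (x j)) :
    ∃ y : Γ(C, W), ∀ i, C.presheaf.map (homOfLE inf_le_left).op y = x i :=
  (TopCat.Sheaf.existsUnique_gluing' C.sheaf (fun i ↦ W ⊓ U i) W (fun _ ↦ homOfLE inf_le_left)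
    (by rw [← inf_iSup_eq]; exact le_inf le_rfl hW) x hx).exists

lemma eq_of_cover {C : Scheme.{0}} {ι : Type} (U : ι → C.Opens) {W : C.Opens} (hW : W ≤ iSup U)
    (x y : Γ(C, W)) (h : ∀ i, C.presheaf.map (homOfLE (inf_le_left : W ⊓ U i ≤ W)).op x =
      C.presheaf.map (homOfLE inf_le_left).op y) : x = y :=
  TopCat.Sheaf.eq_of_locally_eq' C.sheaf (fun i ↦ W ⊓ U i) W (fun _ ↦ homOfLE inf_le_left)
    (by rw [← inf_iSup_eq]; exact le_inf le_rfl hW) x y h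

lemma mod_map_map_apply {C : Scheme.{0}} (M : C.Modules) {U V W : C.Opens} (h : V ≤ U)
    (k : W ≤ V) (a : Γ(M, U)) :
    M.presheaf.map (homOfLE k).op (M.presheaf.map (homOfLE h).op a) =
      M.presheaf.map (homOfLE (k.trans h)).op a := by
  rw [← AddCommGrpCat.comp_apply, ← Functor.map_comp]; rfl

lemma mod_exists_glue {C : Scheme.{0}} (M : C.Modules) {ι : Type} (U : ι → C.Opens) (W : C.Opens)
    (hW : W ≤ iSup U) (x : ∀ i, Γ(M, W ⊓ U i))
    (hx : ∀ i j, M.presheaf.map (homOfLE (inf_le_left : (W ⊓ U i) ⊓ (W ⊓ U j) ≤ _)).op (x i) =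
      M.presheaf.map (homOfLE inf_le_right).op (x j)) :
    ∃ y : Γ(M, W), ∀ i, M.presheaf.map (homOfLE inf_le_left).op y = x i :=
  (TopCat.Sheaf.existsUnique_gluing' ⟨M.presheaf, M.isSheaf⟩ (fun i ↦ W ⊓ U i) W
    (fun _ ↦ homOfLE inf_le_left) (by rw [← inf_iSup_eq]; exact le_inf le_rfl hW) x hx).exists

lemma mod_eq_of_cover {C : Scheme.{0}} (M : C.Modules) {ι : Type} (U : ι → C.Opens) {W : C.Opens}
    (hW : W ≤ iSup U) (x y : Γ(M, W))
    (h : ∀ i, M.presheaf.map (homOfLE (inf_le_left : W ⊓ U i ≤ W)).op x =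
      M.presheaf.map (homOfLE inf_le_left).op y) : x = y :=
  TopCat.Sheaf.eq_of_locally_eq' ⟨M.presheaf, M.isSheaf⟩ (fun i ↦ W ⊓ U i) W
    (fun _ ↦ homOfLE inf_le_left) (by rw [← inf_iSup_eq]; exact le_inf le_rfl hW) x y h

end Gluing

section Der

variable {C X Y : Scheme.{0}}

/-- For `f : C ⟶ X` and `g : X ⟶ Y`, a derivation over the open set `U` of the sheaf of rings
`f⁻¹ 𝒪_X` into `𝒪_C` that vanishes on functions coming from `Y`. It is given by compatible maps
`Γ(X, V) → Γ(C, W)` for all `W ⊆ U` with `f(W) ⊆ V`. -/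
@[ext]
structure DerivationAlong (f : C ⟶ X) (g : X ⟶ Y) (U : C.Opens) where
  toFun : ∀ (V : X.Opens) (W : C.Opens), W ≤ U → W ≤ f ⁻¹ᵁ V → Γ(X, V) → Γ(C, W)
  map_add : ∀ V W hU hV a b, toFun V W hU hV (a + b) = toFun V W hU hV a + toFun V W hU hV b
  leibniz : ∀ V W hU hV a b, toFun V W hU hV (a * b) =
    f.appLE V W hV a * toFun V W hU hV b + f.appLE V W hV b * toFun V W hU hV a
  map_base : ∀ (O : Y.Opens) V W hU hV (hO : V ≤ g ⁻¹ᵁ O) (y : Γ(Y, O)),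
    toFun V W hU hV (g.appLE O V hO y) = 0
  map_res : ∀ {V V' : X.Opens} {W W' : C.Opens} (hV : V' ≤ V) (hW : W' ≤ W) (hU : W ≤ U)
    (hf : W ≤ f ⁻¹ᵁ V) (hf' : W' ≤ f ⁻¹ᵁ V') (a : Γ(X, V)),
    toFun V' W' (hW.trans hU) hf' (X.presheaf.map (homOfLE hV).op a) =
      C.presheaf.map (homOfLE hW).op (toFun V W hU hf a)

namespace DerivationAlong

variable {f : C ⟶ X} {g : X ⟶ Y} {U : C.Opens}

instance : Zero (DerivationAlong f g U) where
  zero :=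
    { toFun _ _ _ _ _ := 0
      map_add := by simp
      leibniz := by simp
      map_base := by simp
      map_res := by simp }

instance : Add (DerivationAlong f g U) where
  add D E :=
    { toFun V W hU hV a := D.toFun V W hU hV a + E.toFun V W hU hV a
      map_add := by intros; simp only [D.map_add, E.map_add]; ring
      leibniz := by intros; simp only [D.leibniz, E.leibniz]; ring
      map_base := by intros; simp only [D.map_base, E.map_base, add_zero]
      map_res := by intros; simp only [_root_.map_add]; rw [D.map_res, E.map_res] }

instance : Neg (DerivationAlong f g U) where
  neg D :=
    { toFun V W hU hV a := -D.toFun V W hU hV a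
      map_add := by intros; simp only [D.map_add]; ring
      leibniz := by intros; simp only [D.leibniz]; ring
      map_base := by intros; simp only [D.map_base, neg_zero]
      map_res := by intros; simp only [_root_.map_neg]; rw [D.map_res] }

instance : AddCommGroup (DerivationAlong f g U) where
  add_assoc D E F := by ext; exact add_assoc _ _ _
  zero_add D := by ext; exact zero_add _
  add_zero D := by ext; exact add_zero _
  add_comm D E := by ext; exact add_comm _ _
  neg_add_cancel D := by ext; exact neg_add_cancel _
  nsmul := nsmulRec
  zsmul := zsmulRec

instance : SMul Γ(C, U) (DerivationAlong f g U) where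
  smul r D :=
    { toFun V W hU hV a := C.presheaf.map (homOfLE hU).op r * D.toFun V W hU hV a
      map_add := by intros; simp only [D.map_add]; ring
      leibniz := by intros; simp only [D.leibniz]; ring
      map_base := by intros; simp only [D.map_base, mul_zero]
      map_res := by
        intro V V' W W' hV hW hU hf hf' a
        rw [D.map_res hV hW hU hf hf', _root_.map_mul]
        congr 1
        rw [← CommRingCat.comp_apply, ← Functor.map_comp]
        rfl }

instance : Module Γ(C, U) (DerivationAlong f g U) where
  one_smul D := by
    ext V W hU hV a
    exact (congrArg (· * _) (map_one (C.presheaf.map (homOfLE hU).op).hom)).trans (one_mul _)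
  mul_smul r s D := by
    ext V W hU hV a
    exact (congrArg (· * _) (map_mul (C.presheaf.map (homOfLE hU).op).hom r s)).trans
      (mul_assoc _ _ _)
  smul_zero r := by ext; exact mul_zero _
  smul_add r D E := by ext; exact mul_add _ _ _
  add_smul r s D := by
    ext V W hU hV a
    exact (congrArg (· * _) (_root_.map_add (C.presheaf.map (homOfLE hU).op).hom r s)).trans
      (add_mul _ _ _)
  zero_smul D := by
    ext V W hU hV a
    exact (congrArg (· * _) (map_zero (C.presheaf.map (homOfLE hU).op).hom)).trans (zero_mul _)

/-- Restriction to a smaller open set. -/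
def res {U U' : C.Opens} (h : U' ≤ U) : DerivationAlong f g U →+ DerivationAlong f g U' where
  toFun D :=
    { toFun V W hU hV a := D.toFun V W (hU.trans h) hV a
      map_add _ _ _ _ _ _ := D.map_add _ _ _ _ _ _
      leibniz _ _ _ _ _ _ := D.leibniz _ _ _ _ _ _
      map_base _ _ _ _ _ _ _ := D.map_base _ _ _ _ _ _ _
      map_res hV hW hU hf hf' a := D.map_res hV hW (hU.trans h) hf hf' a }
  map_zero' := rfl
  map_add' _ _ := rfl


lemma map_toFun (D : DerivationAlong f g U) {V : X.Opens} {W W' : C.Opens} (hW : W' ≤ W)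
    (hU : W ≤ U) (hV : W ≤ f ⁻¹ᵁ V) (a : Γ(X, V)) :
    C.presheaf.map (homOfLE hW).op (D.toFun V W hU hV a) =
      D.toFun V W' (hW.trans hU) (hW.trans hV) a := by
  rw [← D.map_res le_rfl hW hU hV (hW.trans hV) a, map_rfl_apply]

lemma glue (f : C ⟶ X) (g : X ⟶ Y) (ι : Type) (U : ι → C.Opens)
    (s : ∀ i, DerivationAlong f g (U i))
    (hs : ∀ i j, res (inf_le_left : U i ⊓ U j ≤ U i) (s i) = res inf_le_right (s j)) :
    ∃! t : DerivationAlong f g (iSup U), ∀ i, res (le_iSup U i) t = s i := by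
  have comp : ∀ i j V W (hi : W ≤ U i) (hj : W ≤ U j) (hV : W ≤ f ⁻¹ᵁ V) (a : Γ(X, V)),
      (s i).toFun V W hi hV a = (s j).toFun V W hj hV a := fun i j V W hi hj hV a ↦
    congrArg (fun D : DerivationAlong f g (U i ⊓ U j) ↦ D.toFun V W (le_inf hi hj) hV a) (hs i j)
  have ex : ∀ (V : X.Opens) (W : C.Opens) (_ : W ≤ iSup U) (hV : W ≤ f ⁻¹ᵁ V) (a : Γ(X, V)),
      ∃ y : Γ(C, W), ∀ i, C.presheaf.map (homOfLE inf_le_left).op y =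
        (s i).toFun V (W ⊓ U i) inf_le_right (inf_le_left.trans hV) a := by
    intro V W hW hV a
    refine exists_glue U W hW _ fun i j ↦ ?_
    rw [map_toFun, map_toFun]
    exact comp _ _ _ _ _ _ _ _
  choose y hy using ex
  refine ⟨{ toFun := y, map_add := ?_, leibniz := ?_, map_base := ?_, map_res := ?_ }, ?_, ?_⟩
  · intro V W hU hV a b
    refine eq_of_cover U hU _ _ fun i ↦ ?_
    simp only [_root_.map_add, hy, (s i).map_add]
  · intro V W hU hV a b
    refine eq_of_cover U hU _ _ fun i ↦ ?_
    simp only [_root_.map_add, _root_.map_mul, hy, (s i).leibniz, ← CommRingCat.comp_apply,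
      Scheme.Hom.appLE_map]
  · intro O V W hU hV hO b
    refine eq_of_cover U hU _ _ fun i ↦ ?_
    simp only [map_zero, hy, (s i).map_base]
  · intro V V' W W' hV hW hU hf hf' a
    refine eq_of_cover U (hW.trans hU) _ _ fun i ↦ ?_
    have h1 : W' ⊓ U i ≤ W ⊓ U i := inf_le_inf_right _ hW
    rw [hy, (s i).map_res hV h1 inf_le_right (inf_le_left.trans hf), ← hy V W hU hf a i,
      map_map_apply, map_map_apply]
  · intro i
    ext V W hU hV a
    refine eq_of_cover U (hU.trans (le_iSup U i)) _ _ fun j ↦ ?_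
    refine (hy V W (hU.trans (le_iSup U i)) hV a j).trans ?_
    rw [map_toFun]
    exact comp _ _ _ _ _ _ _ _
  · intro t ht
    ext V W hU hV a
    refine eq_of_cover U hU _ _ fun j ↦ ?_
    refine Eq.trans ?_ (hy V W hU hV a j).symm
    rw [map_toFun, ← ht j]
    rfl

end DerivationAlong

/-- The `𝒪_C`-module `Der_Y(f⁻¹ 𝒪_X, 𝒪_C) = Hom(f^* Ω_{X/Y}, 𝒪_C)`. If `X` is smooth over `Y`
this is the pulled back relative tangent bundle `f^* T_{X/Y}`; for `f = 𝟙 C` it is the relative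
tangent sheaf `T_{C/Y}`. -/
def derivationSheaf (f : C ⟶ X) (g : X ⟶ Y) : C.Modules :=
  ModuleData.toModules
    { Sec := DerivationAlong f g
      res := DerivationAlong.res
      res_id _ _ := rfl
      res_comp _ _ _ := rfl
      res_smul h r D := by
        ext V W hU hV a
        exact congrArg (· * D.toFun V W (hU.trans h) hV a) (map_map_apply C h hU r).symm
      glue := DerivationAlong.glue f g }

end Der

section SheafHom

variable {C : Scheme.{0}}

/-- Homomorphisms `S|_U ⟶ M|_U` of sheaves of modules over the open set `U`. -/
@[ext]
structure LocalHom (S M : C.Modules) (U : C.Opens) where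
  toFun : ∀ W : C.Opens, W ≤ U → Γ(S, W) → Γ(M, W)
  map_add : ∀ W hU a b, toFun W hU (a + b) = toFun W hU a + toFun W hU b
  map_smul : ∀ W hU (r : Γ(C, W)) a, toFun W hU (r • a) = r • toFun W hU a
  map_res : ∀ {W W' : C.Opens} (hW : W' ≤ W) (hU : W ≤ U) (a : Γ(S, W)),
    toFun W' (hW.trans hU) (S.presheaf.map (homOfLE hW).op a) =
      M.presheaf.map (homOfLE hW).op (toFun W hU a)

namespace LocalHom

variable {S M N : C.Modules} {U : C.Opens}

instance : Zero (LocalHom S M U) where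
  zero :=
    { toFun _ _ _ := 0
      map_add := by simp
      map_smul := by simp
      map_res := by simp }

instance : Add (LocalHom S M U) where
  add D E :=
    { toFun W hU a := D.toFun W hU a + E.toFun W hU a
      map_add := by intros; simp only [D.map_add, E.map_add]; abel
      map_smul := by intros; simp only [D.map_smul, E.map_smul, smul_add]
      map_res := by intros; simp only [_root_.map_add]; rw [D.map_res, E.map_res] }

instance : Neg (LocalHom S M U) where
  neg D :=
    { toFun W hU a := -D.toFun W hU a
      map_add := by intros; simp only [D.map_add]; abel
      map_smul := by intros; simp only [D.map_smul, smul_neg]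
      map_res := by intros; simp only [_root_.map_neg]; rw [D.map_res] }

instance : AddCommGroup (LocalHom S M U) where
  add_assoc D E F := by ext; exact add_assoc _ _ _
  zero_add D := by ext; exact zero_add _
  add_zero D := by ext; exact add_zero _
  add_comm D E := by ext; exact add_comm _ _
  neg_add_cancel D := by ext; exact neg_add_cancel _
  nsmul := nsmulRec
  zsmul := zsmulRec

instance : SMul Γ(C, U) (LocalHom S M U) where
  smul r D :=
    { toFun W hU a := C.presheaf.map (homOfLE hU).op r • D.toFun W hU a
      map_add := by intros; simp only [D.map_add, smul_add]
      map_smul := by intros; simp only [D.map_smul, smul_smul, mul_comm]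
      map_res := by
        intro W W' hW hU a
        rw [D.map_res hW hU, Scheme.Modules.map_smul, map_map_apply] }

instance : Module Γ(C, U) (LocalHom S M U) where
  one_smul D := by
    ext W hU a
    exact (congrArg (· • D.toFun W hU a) (map_one (C.presheaf.map (homOfLE hU).op).hom)).trans
      (one_smul _ _)
  mul_smul r s D := by
    ext W hU a
    exact (congrArg (· • D.toFun W hU a)
      (map_mul (C.presheaf.map (homOfLE hU).op).hom r s)).trans (mul_smul _ _ _)
  smul_zero r := by ext; exact smul_zero _
  smul_add r D E := by ext; exact smul_add _ _ _
  add_smul r s D := by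
    ext W hU a
    exact (congrArg (· • D.toFun W hU a)
      (_root_.map_add (C.presheaf.map (homOfLE hU).op).hom r s)).trans (add_smul _ _ _)
  zero_smul D := by
    ext W hU a
    exact (congrArg (· • D.toFun W hU a)
      (map_zero (C.presheaf.map (homOfLE hU).op).hom)).trans (zero_smul _ _)

/-- Restriction to a smaller open set. -/
def res {U U' : C.Opens} (h : U' ≤ U) : LocalHom S M U →+ LocalHom S M U' where
  toFun D :=
    { toFun W hU a := D.toFun W (hU.trans h) a
      map_add _ _ _ _ := D.map_add _ _ _ _
      map_smul _ _ _ _ := D.map_smul _ _ _ _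
      map_res hW hU a := D.map_res hW (hU.trans h) a }
  map_zero' := rfl
  map_add' _ _ := rfl

lemma glue (S M : C.Modules) (ι : Type) (U : ι → C.Opens) (s : ∀ i, LocalHom S M (U i))
    (hs : ∀ i j, res (inf_le_left : U i ⊓ U j ≤ U i) (s i) = res inf_le_right (s j)) :
    ∃! t : LocalHom S M (iSup U), ∀ i, res (le_iSup U i) t = s i := by
  have comp : ∀ i j W (hi : W ≤ U i) (hj : W ≤ U j) (a : Γ(S, W)),
      (s i).toFun W hi a = (s j).toFun W hj a := fun i j W hi hj a ↦
    congrArg (fun D : LocalHom S M (U i ⊓ U j) ↦ D.toFun W (le_inf hi hj) a) (hs i j)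
  have ex : ∀ (W : C.Opens) (_ : W ≤ iSup U) (a : Γ(S, W)),
      ∃ y : Γ(M, W), ∀ i, M.presheaf.map (homOfLE inf_le_left).op y =
        (s i).toFun (W ⊓ U i) inf_le_right (S.presheaf.map (homOfLE inf_le_left).op a) := by
    intro W hW a
    refine mod_exists_glue M U W hW _ fun i j ↦ ?_
    rw [← (s i).map_res, ← (s j).map_res, mod_map_map_apply, mod_map_map_apply]
    exact comp _ _ _ _ _ _
  choose y hy using ex
  refine ⟨{ toFun := y, map_add := ?_, map_smul := ?_, map_res := ?_ }, ?_, ?_⟩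
  · intro W hU a b
    refine mod_eq_of_cover M U hU _ _ fun i ↦ ?_
    simp only [_root_.map_add, hy, (s i).map_add]
  · intro W hU r a
    refine mod_eq_of_cover M U hU _ _ fun i ↦ ?_
    rw [hy, Scheme.Modules.map_smul, Scheme.Modules.map_smul, (s i).map_smul, hy]
  · intro W W' hW hU a
    refine mod_eq_of_cover M U (hW.trans hU) _ _ fun i ↦ ?_
    have h1 : W' ⊓ U i ≤ W ⊓ U i := inf_le_inf_right _ hW
    rw [hy, mod_map_map_apply, mod_map_map_apply, ← mod_map_map_apply M inf_le_left h1, hy W hU a i,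
      ← (s i).map_res h1, mod_map_map_apply]
  · intro i
    ext W hU a
    refine mod_eq_of_cover M U (hU.trans (le_iSup U i)) _ _ fun j ↦ ?_
    refine (hy W (hU.trans (le_iSup U i)) a j).trans ?_
    rw [← (s i).map_res]
    exact comp _ _ _ _ _ _
  · intro t ht
    ext W hU a
    refine mod_eq_of_cover M U hU _ _ fun j ↦ ?_
    refine Eq.trans ?_ (hy W hU a j).symm
    rw [← t.map_res, ← ht j]
    rfl

end LocalHom

/-- The internal hom sheaf `Hom(S, M)`. -/
def sheafHom (S M : C.Modules) : C.Modules :=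
  ModuleData.toModules
    { Sec := LocalHom S M
      res := LocalHom.res
      res_id _ _ := rfl
      res_comp _ _ _ := rfl
      res_smul h r D := by
        ext W hU a
        exact congrArg (· • D.toFun W (hU.trans h) a) (map_map_apply C h hU r).symm
      glue := LocalHom.glue S M }

/-- Functoriality of `Hom(S, -)`. -/
def sheafHomMap (S : C.Modules) {M N : C.Modules} (α : M ⟶ N) : sheafHom S M ⟶ sheafHom S N :=
  ModuleData.hom
    (fun U ↦
      { toFun := fun (D : LocalHom S M U) ↦
          { toFun W hU a := α.app W (D.toFun W hU a)
            map_add W hU a b := by rw [D.map_add, _root_.map_add]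
            map_smul W hU r a := by rw [D.map_smul, Scheme.Modules.Hom.app_smul]
            map_res hW hU a := by
              rw [D.map_res]
              exact CategoryTheory.congr_fun (α.mapPresheaf.naturality (homOfLE hW).op) _ : LocalHom S N U }
        map_add' D E := LocalHom.ext (by funext W hU a; exact _root_.map_add (α.app W).hom _ _)
        map_smul' r D := LocalHom.ext (by funext W hU a; exact Scheme.Modules.Hom.app_smul α _ _) })
    (fun _ _ ↦ rfl)

end SheafHom

section Differential
variable {C X Y B : Scheme.{0}}

lemma le_id_preimage (W : C.Opens) : W ≤ 𝟙 C ⁻¹ᵁ W := le_rfl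

/-- The differential `dφ : T_{C/B} ⟶ φ^* T_{X/Y}` of a morphism `φ : C ⟶ X` lying over `b : B ⟶ Y`;
it sends a derivation `D` to `h ↦ D (φ^# h)`. -/
def differential (c : C ⟶ B) (b : B ⟶ Y) (φ : C ⟶ X) (x : X ⟶ Y) (w : φ ≫ x = c ≫ b) :
    derivationSheaf (𝟙 C) c ⟶ derivationSheaf φ x :=
  ModuleData.hom
    (fun U ↦
      { toFun := fun (D : DerivationAlong (𝟙 C) c U) ↦
          { toFun V W hU hV a := D.toFun W W hU (le_id_preimage W) (φ.appLE V W hV a)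
            map_add V W hU hV a b := by rw [_root_.map_add, D.map_add]
            leibniz V W hU hV a b := by
              have (a : Γ(C, W)) : (𝟙 C : C ⟶ C).appLE W W (le_id_preimage W) a = a := by
                exact map_rfl_apply C a
              rw [_root_.map_mul, D.leibniz, this, this]
            map_base O V W hU hV hO y := by
              have hW : W ≤ c ⁻¹ᵁ (b ⁻¹ᵁ O) := by
                rw [← Scheme.Hom.comp_preimage, ← w, Scheme.Hom.comp_preimage]
                exact hV.trans fun p hp ↦ hO hp
              have : φ.appLE V W hV (x.appLE O V hO y) = c.appLE (b ⁻¹ᵁ O) W hW (b.app O y) := by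
                simp only [← CommRingCat.comp_apply, Scheme.Hom.appLE_comp_appLE, w]
                rw [Scheme.Hom.comp_appLE]
              rw [this]
              exact D.map_base _ _ _ _ _ _ _
            map_res hV hW hU hf hf' a := by
              rw [← D.map_res hW hW hU (le_id_preimage _) (le_id_preimage _)]
              simp only [← CommRingCat.comp_apply, Scheme.Hom.appLE_map, Scheme.Hom.map_appLE] :
            DerivationAlong φ x U }
        map_add' D E := rfl
        map_smul' r D := rfl })
    (fun _ _ ↦ rfl)

end Differential

section Curves

instance (C : Scheme.{0}) : HasFiniteBiproducts C.Modules := Abelian.hasFiniteBiproducts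

/-- The structure sheaf as a module over itself. -/
def structureModule (C : Scheme.{0}) : C.Modules := SheafOfModules.unit C.ringCatSheaf

/-- Locally free of rank one. -/
def IsInvertible {C : Scheme.{0}} (S : C.Modules) : Prop :=
  ∀ p : C, ∃ U : C.Opens, p ∈ U ∧ Nonempty (S.restrict U.ι ≅ structureModule U)

/-- The projective line `Proj R[x₀, x₁]`. -/
def projectiveLine (R : CommRingCat.{0}) : Scheme.{0} :=
  letI : GradedRing (MvPolynomial.homogeneousSubmodule (Fin 2) R) := MvPolynomial.gradedAlgebra
  Proj (MvPolynomial.homogeneousSubmodule (Fin 2) R)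

/-- The structure morphism `ℙ¹_R ⟶ Spec R`. -/
def projectiveLineToSpec (R : CommRingCat.{0}) : projectiveLine R ⟶ Spec R :=
  letI : GradedRing (MvPolynomial.homogeneousSubmodule (Fin 2) R) := MvPolynomial.gradedAlgebra
  Proj.toSpecZero (MvPolynomial.homogeneousSubmodule (Fin 2) R) ≫
    Spec.map (CommRingCat.ofHom (algebraMap R (MvPolynomial.homogeneousSubmodule (Fin 2) R 0)))

/-- `P` is, Zariski locally on `B`, a projective line over `B`. A smooth proper family whose
geometric fibers are projective lines has this property as soon as it carries a line bundle of
degree one on the fibers, in particular as soon as it carries a spinor bundle. -/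
def IsProjectiveLineBundle {P B : Scheme.{0}} (c : P ⟶ B) : Prop :=
  ∀ b : B, ∃ (R : CommRingCat.{0}) (j : Spec R ⟶ B) (t : projectiveLine R ⟶ P),
    IsOpenImmersion j ∧ b ∈ Set.range j ∧ IsPullback t (projectiveLineToSpec R) c j

/-- The completed local ring is `K⟦x⟧`: a smooth point of a curve. -/
def IsSmoothCurvePoint (K R : Type) [Field K] [CommRing R] [IsLocalRing R] : Prop :=
  Nonempty (AdicCompletion (IsLocalRing.maximalIdeal R) R ≃+* PowerSeries K)

/-- The completed local ring is `K⟦x, y⟧ / (x y)`: a node. -/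
def IsNode (K R : Type) [Field K] [CommRing R] [IsLocalRing R] : Prop :=
  Nonempty (AdicCompletion (IsLocalRing.maximalIdeal R) R ≃+*
    MvPowerSeries (Fin 2) K ⧸ Ideal.span {(MvPowerSeries.X 0 * MvPowerSeries.X 1 :
      MvPowerSeries (Fin 2) K)})

/-- Prestable curves over `B`: flat, proper, finitely presented, and every closed point of every
geometric fiber is a smooth point of a curve or a node. -/
structure IsPrestable {C B : Scheme.{0}} (c : C ⟶ B) : Prop where
  flat : Flat c
  proper : IsProper c
  finitePresentation : LocallyOfFinitePresentation c
  fiber : ∀ (K : Type) [Field K] [IsAlgClosed K] (b : Spec (.of K) ⟶ B) (p : ↥(pullback c b)),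
    IsClosed {p} →
      IsSmoothCurvePoint K ((pullback c b).presheaf.stalk p) ∨
        IsNode K ((pullback c b).presheaf.stalk p)

/-- A finite tree with vertices `V`, edges `E` (each with two ends, indexed by `Bool`) and tails
labelled by `J`. -/
structure MarkedTree (J : Type) where
  V : Type
  E : Type
  [finiteV : Finite V]
  [finiteE : Finite E]
  tail : J → V
  ends : E → Bool → V
  connected : ∀ v w, Relation.EqvGen (fun a b ↦ ∃ e, ends e false = a ∧ ends e true = b) v w
  card_vertices : Nat.card V = Nat.card E + 1

namespace MarkedTree

attribute [instance] MarkedTree.finiteV MarkedTree.finiteE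

variable {J : Type} (τ : MarkedTree J)

/-- Flags: tails and half-edges. -/
abbrev Flag : Type := J ⊕ τ.E × Bool

/-- The vertex that a flag bounds. -/
def vertex : τ.Flag → τ.V
  | .inl j => τ.tail j
  | .inr (e, s) => τ.ends e s

/-- The number of flags bounding a vertex. -/
def valence (v : τ.V) : ℕ := Nat.card {f : τ.Flag // τ.vertex f = v}

/-- Every vertex has at least three flags. -/
def IsStable : Prop := ∀ v, 3 ≤ τ.valence v

end MarkedTree

/-- A prestable spin curve of genus zero over `B` of constant tree type `τ`: a prestable curve
`c : C ⟶ B` together with its components `C_v`, the sections at the flags, and spinor bundles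
`S_v` on the components, which are invertible with `S_v ≅ Hom(S_v, T_{C_v/B})`. The components are
families of projective lines, they meet exactly in the nodes `p_e`, and the marked points and
nodes on each component are pairwise distinct. -/
structure SpinCurve (B : Scheme.{0}) {J : Type} (τ : MarkedTree J) where
  C : Scheme.{0}
  c : C ⟶ B
  prestable : IsPrestable c
  comp : τ.V → Scheme.{0}
  i : ∀ v, comp v ⟶ C
  closedImmersion : ∀ v, IsClosedImmersion (i v)
  bundle : ∀ v, IsProjectiveLineBundle (i v ≫ c)
  cover : ∀ p : C, ∃ v, p ∈ Set.range (i v)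
  flag : ∀ f : τ.Flag, B ⟶ comp (τ.vertex f)
  flag_section : ∀ f, flag f ≫ i (τ.vertex f) ≫ c = 𝟙 B
  flag_disjoint : ∀ f f₁, f ≠ f₁ → τ.vertex f = τ.vertex f₁ → ∀ b : B,
    (flag f ≫ i (τ.vertex f)) b ≠ (flag f₁ ≫ i (τ.vertex f₁)) b
  flag_glue : ∀ e, flag (.inr (e, false)) ≫ i (τ.vertex (.inr (e, false))) =
    flag (.inr (e, true)) ≫ i (τ.vertex (.inr (e, true)))
  inter : ∀ v w, v ≠ w → ∀ p ∈ Set.range (i v) ∩ Set.range (i w),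
    ∃ (e : τ.E) (s : Bool) (b : B), τ.ends e s = v ∧ τ.ends e (!s) = w ∧
      (flag (.inr (e, s)) ≫ i (τ.vertex (.inr (e, s)))) b = p
  S : ∀ v, (comp v).Modules
  invertible : ∀ v, IsInvertible (S v)
  spin : ∀ v, S v ≅ sheafHom (S v) (derivationSheaf (𝟙 (comp v)) (i v ≫ c))

/-- For a section `p` of `c : C ⟶ B`, the restriction map `c_* M ⟶ p^* M`, `s ↦ p^* s`. -/
def restrictToSection {C B : Scheme.{0}} (c : C ⟶ B) (p : B ⟶ C) (hp : p ≫ c = 𝟙 B)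
    (M : C.Modules) :
    (Scheme.Modules.pushforward c).obj M ⟶ (Scheme.Modules.pullback p).obj M :=
  (Scheme.Modules.pushforward c).map
      ((Scheme.Modules.pullbackPushforwardAdjunction p).unit.app M) ≫
    (Scheme.Modules.pushforwardComp p c).hom.app _ ≫
    (Scheme.Modules.pushforwardCongr hp).hom.app _ ≫
    (Scheme.Modules.pushforwardId B).hom.app _

namespace SpinCurve

variable {B : Scheme.{0}} {J : Type} {τ : MarkedTree J} (F : SpinCurve B τ)

/-- The spinor bundle `S_C`, the pushforward of the spinor bundle of the normalization. -/
def spinorBundle : F.C.Modules :=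
  ⨁ fun v ↦ (Scheme.Modules.pushforward (F.i v)).obj (F.S v)

/-- The marked points `p_t` and the nodes `p_e`, as sections of `C ⟶ B`. -/
def point : J ⊕ τ.E → (B ⟶ F.C)
  | .inl j => F.flag (.inl j) ≫ F.i _
  | .inr e => F.flag (.inr (e, false)) ≫ F.i _

lemma point_section (x : J ⊕ τ.E) : F.point x ≫ F.c = 𝟙 B := by
  cases x <;> simp only [point, Category.assoc, F.flag_section]

/-- The sheaf `p_x^* S_C` on `B`. -/
def fiberAt (x : J ⊕ τ.E) : B.Modules :=
  (Scheme.Modules.pullback (F.point x)).obj F.spinorBundle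

/-- For local sections `s`, `u` of `S_v`, the derivative of the function `h` along the vector
field `s ⊗ u`. -/
def spinDerivative (v : τ.V) {W : (F.comp v).Opens} (s u : Γ(F.S v, W))
    (h : Γ(F.comp v, W)) : Γ(F.comp v, W) :=
  let D : LocalHom (F.S v) (derivationSheaf (𝟙 (F.comp v)) (F.i v ≫ F.c)) W :=
    (F.spin v).hom.app W s
  let E : DerivationAlong (𝟙 (F.comp v)) (F.i v ≫ F.c) W := D.toFun W le_rfl u
  E.toFun W W le_rfl (le_id_preimage W) h

variable [Finite J]

/-- The map `c_* S_C ⟶ ⨁_t p_t^* S_C ⊕ ⨁_e p_e^* S_C`. -/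
def restriction : (Scheme.Modules.pushforward F.c).obj F.spinorBundle ⟶ ⨁ F.fiberAt :=
  biproduct.lift fun x ↦ restrictToSection F.c (F.point x) (F.point_section x) F.spinorBundle

/-- The SUSY normal bundle `N_C`. -/
def susyNormal : B.Modules := cokernel F.restriction

/-- The natural map `p_t^* S_C ⟶ N_C`. -/
def tailMap (t : J) : F.fiberAt (.inl t) ⟶ F.susyNormal :=
  biproduct.ι F.fiberAt (.inl t) ≫ cokernel.π F.restriction

end SpinCurve

/-- On the geometric fiber of `c : P ⟶ B` at `b` the map `φ` is constant. -/
def IsConstantAt {P B X : Scheme.{0}} (c : P ⟶ B) (φ : P ⟶ X) {K : Type} [Field K]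
    (b : Spec (.of K) ⟶ B) : Prop :=
  ∃ q : Spec (.of K) ⟶ X, pullback.fst c b ≫ φ = pullback.snd c b ≫ q

/-- A stable spin map of genus zero over `B` of constant tree type with target `X`. Of the classes
`β(v)` of the images of the components only the vanishing or non-vanishing is recorded:
`β(v) = 0` if and only if the component `v` is mapped to a point. -/
structure StableSpinMap {B X : Scheme.{0}} (b : B ⟶ Spec (.of ℂ)) (x : X ⟶ Spec (.of ℂ))
    {J : Type} (τ : MarkedTree J) extends SpinCurve B τ where
  φ : C ⟶ X
  φ_over : φ ≫ x = c ≫ b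
  constantType : ∀ v,
    (∀ (K : Type) [Field K] [IsAlgClosed K] (y : Spec (.of K) ⟶ B),
      IsConstantAt (i v ≫ c) (i v ≫ φ) y) ∨
    (∀ (K : Type) [Field K] [IsAlgClosed K] (y : Spec (.of K) ⟶ B),
      ¬ IsConstantAt (i v ≫ c) (i v ≫ φ) y)
  stable : ∀ v (K : Type) [Field K] [IsAlgClosed K] (y : Spec (.of K) ⟶ B),
    IsConstantAt (i v ≫ c) (i v ≫ φ) y → 3 ≤ τ.valence v

namespace StableSpinMap

variable {B X : Scheme.{0}} {b : B ⟶ Spec (.of ℂ)} {x : X ⟶ Spec (.of ℂ)}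
  {J : Type} {τ : MarkedTree J} (F : StableSpinMap b x τ)

/-- The component `v` is mapped to a point, that is `β(v) = 0`. -/
def IsConstantOn (v : τ.V) : Prop :=
  ∀ (K : Type) [Field K] [IsAlgClosed K] (y : Spec (.of K) ⟶ B),
    IsConstantAt (F.i v ≫ F.c) (F.i v ≫ F.φ) y

/-- The sheaf `φ_v^* T_X` on the component `v`. -/
def tangentOn (v : τ.V) : (F.comp v).Modules := derivationSheaf (F.i v ≫ F.φ) x

/-- The sheaf `S_C^∨ ⊗ φ^* T_X = ⨁_v S_v^∨ ⊗ φ_v^* T_X` on `C`. -/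
def dualSpinorTangent : F.C.Modules :=
  ⨁ fun v ↦ (Scheme.Modules.pushforward (F.i v)).obj (sheafHom (F.S v) (F.tangentOn v))

/-- The differential `T_{C_v/B} ⟶ φ_v^* T_X`. -/
def differentialOn (v : τ.V) :
    derivationSheaf (𝟙 (F.comp v)) (F.i v ≫ F.c) ⟶ F.tangentOn v :=
  differential (F.i v ≫ F.c) b (F.i v ≫ F.φ) x (by rw [Category.assoc, F.φ_over, Category.assoc])

/-- The contraction `s ↦ ⟨s, dφ⟩`, from `S_C` to `S_C^∨ ⊗ φ^* T_X`: on the component `v`, the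
section `⟨s, dφ⟩` of `Hom(S_v, φ_v^* T_X)` sends `u` to `dφ(s ⊗ u)`. -/
def contraction : F.spinorBundle ⟶ F.dualSpinorTangent :=
  biproduct.map fun v ↦ (Scheme.Modules.pushforward (F.i v)).map
    ((F.spin v).hom ≫ sheafHomMap (F.S v) (F.differentialOn v))

variable [Finite J]

/-- The map from `c_* S_C` to `⨁_t p_t^* S_C ⊕ ⨁_e p_e^* S_C ⊕ c_* (S_C^∨ ⊗ φ^* T_X)` that sends
`s` to its values at the marked points and nodes and to `-⟨s, dφ⟩`. -/
def mapRestriction : (Scheme.Modules.pushforward F.c).obj F.spinorBundle ⟶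
    (⨁ F.fiberAt) ⊞ (Scheme.Modules.pushforward F.c).obj F.dualSpinorTangent :=
  biprod.lift F.restriction (-(Scheme.Modules.pushforward F.c).map F.contraction)

/-- The SUSY normal bundle `N_(C, φ)`. -/
def mapSusyNormal : B.Modules := cokernel F.mapRestriction

/-- The natural map `p_t^* S_C ⟶ N_(C, φ)`. -/
def mapTailMap (t : J) : F.fiberAt (.inl t) ⟶ F.mapSusyNormal :=
  biproduct.ι F.fiberAt (.inl t) ≫ biprod.inl ≫ cokernel.π F.mapRestriction

end StableSpinMap

/-- `τ₁` is the tree obtained from `τ` by removing the tail `t₀` and contracting the vertices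
satisfying `contr` (which is at most the vertex bounded by `t₀`, if it has three flags). The flags
of `τ₁` are the flags of `τ` other than `t₀` at the remaining vertices; if the contracted vertex
bounds a tail `j` and a half-edge, then the opposite half-edge becomes the tail `j`; if it bounds
two half-edges, then their opposites are joined to an edge. -/
structure TreeStabilization {J : Type} (τ : MarkedTree J) (t₀ : J) (contr : τ.V → Prop)
    (τ₁ : MarkedTree {j : J // j ≠ t₀}) where
  vert : τ₁.V ≃ {v : τ.V // ¬ contr v}
  flagMap : τ₁.Flag ≃ {f : τ.Flag // f ≠ .inl t₀ ∧ ¬ contr (τ.vertex f)}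
  vertex_flagMap : ∀ f, τ.vertex (flagMap f).1 = (vert (τ₁.vertex f)).1
  tail_flagMap : ∀ j, ¬ contr (τ.tail j.1) → (flagMap (.inl j)).1 = .inl j.1
  edge_flagMap : ∀ e, (∀ s, ¬ contr (τ.ends e s)) →
    ∃ e₁ r, (flagMap (.inr (e₁, r))).1 = .inr (e, false) ∧
      (flagMap (.inr (e₁, !r))).1 = .inr (e, true)
  tail_contracted : ∀ j e s, contr (τ.tail j.1) → τ.ends e s = τ.tail j.1 →
    (flagMap (.inl j)).1 = .inr (e, !s)
  edge_contracted : ∀ e s e₂ s₂, contr (τ.ends e s) → τ.ends e₂ s₂ = τ.ends e s →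
    (e, s) ≠ (e₂, s₂) →
    ∃ e₁ r, (flagMap (.inr (e₁, r))).1 = .inr (e, !s) ∧
      (flagMap (.inr (e₁, !r))).1 = .inr (e₂, !s₂)

/-- `F₁`, with the map `st : C ⟶ C₁`, arises from the spin curve `F` by removing the marked point
`t₀` and contracting the components satisfying `contr`: `st` is an isomorphism on every other
component, also of the spinor bundles, it is constant on the fibers of the contracted components,
and it respects marked points and nodes. -/
structure Stabilization {B : Scheme.{0}} {J : Type} {τ : MarkedTree J} (F : SpinCurve B τ)
    (t₀ : J) (contr : τ.V → Prop) {τ₁ : MarkedTree {j : J // j ≠ t₀}} (F₁ : SpinCurve B τ₁)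
    extends TreeStabilization τ t₀ contr τ₁ where
  st : F.C ⟶ F₁.C
  st_over : st ≫ F₁.c = F.c
  compIso : ∀ w, F.comp (vert w).1 ≅ F₁.comp w
  compIso_st : ∀ w, F.i (vert w).1 ≫ st = (compIso w).hom ≫ F₁.i w
  contracted_st : ∀ v, contr v → ∃ q : B ⟶ F₁.C, F.i v ≫ st = (F.i v ≫ F.c) ≫ q
  tail_st : ∀ j : {j : J // j ≠ t₀}, F.point (.inl j.1) ≫ st = F₁.point (.inl j)
  flag_st : ∀ f, (F.flag (flagMap f).1 ≫ F.i _) ≫ st = F₁.flag f ≫ F₁.i _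
  spinIso : ∀ w, F₁.S w ≅
    (Scheme.Modules.pushforward (compIso w).hom).obj (F.S (vert w).1)
  spinIso_spin : ∀ w (W : (F₁.comp w).Opens) (s u : Γ(F₁.S w, W)) (h : Γ(F₁.comp w, W)),
    (compIso w).hom.app W (F₁.spinDerivative w s u h) =
      F.spinDerivative (vert w).1 (W := (compIso w).hom ⁻¹ᵁ W)
        ((spinIso w).hom.app W s) ((spinIso w).hom.app W u) ((compIso w).hom.app W h)

end Curves

end SusyNormal

end

/-!
# Removing a marked point from a curve or map with spin structure

Both normal bundles are cokernels of a map `r` from `c_* S_C`, the direct sum over the vertices `v`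
of the sections of `S_v`. Its target is also a direct sum of pieces, each of which only sees one
component: the fiber of `S_v` at each flag at `v` (a node contributes the two fibers at its
half-edges, `SpinCurve.fiberDecomposition`) and, for a map, the sections of `S_v^∨ ⊗ φ^* T_X`
(`StableSpinMap.pieceDecomposition`). Stabilization removes the piece at `t₀` and, if the component
of `t₀` is contracted, all pieces at that component. `exists_shortExact_cokernel` reduces the
theorem to two assertions about the component `C_v` of `t₀`.

* *Injectivity of `p_{t₀}^* S_C ⟶ N`.* A section of `S_v` whose components other than the one at
  `t₀` vanish is zero. If `C_v` has two further flags, this holds because a spinor bundle has degree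
  one on the fibers, so that its sections are determined by their values at two disjoint sections
  (`eq_zero_of_comp_restrictToSection`). For a map the only other case is that of a map which is
  constant on no geometric fiber of `C_v`; then the contraction with `dφ` is injective
  (`eq_zero_of_comp_contract`). Indeed, write a section in the kernel as `α + β z` in a coordinate
  `z`. For a function `n / G` that comes from `X`, the product of `α + β z` and the Wronskian of `G`
  and `n` is zero up to a power of the denominator. If `α` or `β` is not zero in the local ring at a
  point of `B`, then by McCoy's theorem the Wronskian vanishes in the fiber over that point, and in
  characteristic zero `n / G` is constant there.
* *The pieces at a contracted component do not contribute modulo `p_{t₀}^* S_C`.* The component has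
  exactly two flags besides `t₀`, and the values of sections of `S_v` at these can be prescribed
  arbitrarily (`eq_zero_of_restrictToSection_comp`). For a map of class zero `φ^* T_X` comes from the
  base, and `S_v^∨` has degree `-1`, so that `S_v^∨ ⊗ φ^* T_X` has no sections
  (`isZero_pushforward_sheafHom`).

That `S_v` has degree one has to be deduced, over an arbitrary base, from `S_v ⊗ S_v ≅ T`
(`exists_spinChart`). On the two standard charts the sections of `S_v` form lattices over the
polynomial rings in `T` and `T⁻¹`, which are self-dual for the pairing with values in vector fields;
a residue argument shows that the first cohomology of `S_v` vanishes after a twist by minus two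
points (`exists_eq_add`). Hence a local section that does not vanish at `z = 0` can be corrected to a
global section which vanishes at `z = ∞`; its square is a constant multiple of `∂/∂z`, and the
constant is a unit near the given point of the base.

When `B` is empty, assumptions on points and geometric fibers say nothing, but then all modules
vanish.
-/

noncomputable section

namespace SusyNormal

/-! ### Restriction maps, local generators -/

/-- Restriction of functions to a smaller open set. -/
def ores (C : Scheme.{0}) {U V : C.Opens} (h : V ≤ U) : Γ(C, U) →+* Γ(C, V) :=
  (C.presheaf.map (homOfLE h).op).hom

/-- Restriction of sections of a sheaf of modules to a smaller open set. -/
def mres {C : Scheme.{0}} (M : C.Modules) {U V : C.Opens} (h : V ≤ U) : Γ(M, U) →+ Γ(M, V) :=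
  (M.presheaf.map (homOfLE h).op).hom

section

variable {C : Scheme.{0}} {M N : C.Modules} {U V W : C.Opens}

@[simp] lemma ores_ores (h : V ≤ U) (k : W ≤ V) (a : Γ(C, U)) :
    ores C k (ores C h a) = ores C (k.trans h) a := map_map_apply C h k a

@[simp] lemma ores_self (h : U ≤ U) (a : Γ(C, U)) : ores C h a = a := map_rfl_apply C a

@[simp] lemma mres_mres (h : V ≤ U) (k : W ≤ V) (a : Γ(M, U)) :
    mres M k (mres M h a) = mres M (k.trans h) a := mod_map_map_apply M h k a

@[simp] lemma mres_self (h : U ≤ U) (a : Γ(M, U)) : mres M h a = a := by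
  have : (homOfLE h).op = 𝟙 (op U) := rfl
  simp only [mres, this, CategoryTheory.Functor.map_id]
  rfl

lemma mres_smul (h : V ≤ U) (r : Γ(C, U)) (a : Γ(M, U)) :
    mres M h (r • a) = ores C h r • mres M h a := M.map_smul (homOfLE h) r a

lemma app_mres (f : M ⟶ N) (h : V ≤ U) (a : Γ(M, U)) :
    f.app V (mres M h a) = mres N h (f.app U a) :=
  CategoryTheory.congr_fun (f.mapPresheaf.naturality (homOfLE h).op) a

lemma app_smul (f : M ⟶ N) (r : Γ(C, U)) (a : Γ(M, U)) :
    f.app U (r • a) = r • f.app U a := Scheme.Modules.Hom.app_smul f r a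

lemma mod_hom_ext {f g : M ⟶ N} (h : ∀ (U : C.Opens) (a : Γ(M, U)), f.app U a = g.app U a) :
    f = g :=
  Scheme.Modules.hom_ext f g fun U ↦ by ext a; exact h U a

lemma ores_ext {x y : Γ(C, U)}
    (h : ∀ p ∈ U, ∃ (V : C.Opens) (hV : V ≤ U), p ∈ V ∧ ores C hV x = ores C hV y) : x = y := by
  choose V hV hp e using h
  refine eq_of_cover (ι := U) (fun p ↦ V p.1 p.2) (fun p hp' ↦ ?_) x y fun p ↦ ?_
  · exact Opens.mem_iSup.2 ⟨⟨p, hp'⟩, hp p hp'⟩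
  · have := congrArg (ores C (inf_le_right : U ⊓ V p.1 p.2 ≤ _)) (e p.1 p.2)
    simp only [ores_ores] at this
    exact this

lemma mres_ext {x y : Γ(M, U)}
    (h : ∀ p ∈ U, ∃ (V : C.Opens) (hV : V ≤ U), p ∈ V ∧ mres M hV x = mres M hV y) : x = y := by
  choose V hV hp e using h
  refine mod_eq_of_cover M (ι := U) (fun p ↦ V p.1 p.2) (fun p hp' ↦ ?_) x y fun p ↦ ?_
  · exact Opens.mem_iSup.2 ⟨⟨p, hp'⟩, hp p hp'⟩
  · have := congrArg (mres M (inf_le_right : U ⊓ V p.1 p.2 ≤ _)) (e p.1 p.2)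
    simp only [mres_mres] at this
    exact this

/-- Sections of a sheaf of modules glue, for a cover by open subsets of the given open set. -/
lemma mres_glue {ι : Type} (V : ι → C.Opens) (hV : ∀ i, V i ≤ U) (hU : U ≤ iSup V)
    (x : ∀ i, Γ(M, V i))
    (hx : ∀ i j, mres M (inf_le_left : V i ⊓ V j ≤ V i) (x i) = mres M inf_le_right (x j)) :
    ∃ y : Γ(M, U), ∀ i, mres M (hV i) y = x i := by
  obtain ⟨y, hy⟩ := mod_exists_glue M V U hU
    (fun i ↦ mres M (inf_le_right : U ⊓ V i ≤ V i) (x i)) fun i j ↦ by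
      have h := congrArg (mres M (le_inf (inf_le_left.trans inf_le_right)
        (inf_le_right.trans inf_le_right) : (U ⊓ V i) ⊓ (U ⊓ V j) ≤ V i ⊓ V j)) (hx i j)
      simp only [mres_mres] at h
      refine ((mres_mres _ _ _).trans h).trans (mres_mres _ _ _).symm
  refine ⟨y, fun i ↦ ?_⟩
  have h := congrArg (mres M (le_inf (hV i) le_rfl : V i ≤ U ⊓ V i)) (hy i)
  rw [mres_mres, mres_self] at h
  rw [← h]
  exact (mres_mres _ _ _).symm

/-- A section `u` of `M` over `U` that trivializes `M` over `U`. -/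
def IsGenerator (u : Γ(M, U)) : Prop :=
  ∀ (V : C.Opens) (h : V ≤ U), Function.Bijective fun r : Γ(C, V) ↦ r • mres M h u

lemma IsGenerator.restrict {u : Γ(M, U)} (hu : IsGenerator u) (h : V ≤ U) :
    IsGenerator (mres M h u) := fun W k ↦ by
  simpa only [mres_mres] using hu W (k.trans h)

lemma IsGenerator.exists_smul {u : Γ(M, U)} (hu : IsGenerator u) (h : V ≤ U) (x : Γ(M, V)) :
    ∃ r : Γ(C, V), r • mres M h u = x := (hu V h).2 x

lemma IsGenerator.eq_zero {u : Γ(M, U)} (hu : IsGenerator u) (h : V ≤ U) {r : Γ(C, V)}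
    (hr : r • mres M h u = 0) : r = 0 :=
  (hu V h).1 (by simpa using hr)

lemma IsInvertible.exists_generator {S : C.Modules} (hS : IsInvertible S) (p : C) :
    ∃ (U : C.Opens) (u : Γ(S, U)), p ∈ U ∧ IsGenerator u := by
  obtain ⟨U, hp, ⟨e⟩⟩ := hS p
  let one : ∀ V : U.toScheme.Opens, Γ(structureModule U, V) := fun V ↦ (1 : Γ(U.toScheme, V))
  refine ⟨U.ι ''ᵁ ⊤, e.inv.app ⊤ (one ⊤), by simpa using hp, fun V hV ↦ ?_⟩
  obtain ⟨V', rfl⟩ : ∃ V' : U.toScheme.Opens, V = U.ι ''ᵁ V' := by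
    refine ⟨U.ι ⁻¹ᵁ V, ?_⟩
    rw [Scheme.Hom.image_preimage_eq_opensRange_inf]
    exact (inf_eq_right.2 (hV.trans (Scheme.Hom.image_le_opensRange _ _))).symm
  have hone : mres (structureModule U) le_top (one ⊤) = one V' :=
    _root_.map_one (ores U.toScheme (le_top : V' ≤ ⊤))
  have h1 : mres S hV (e.inv.app ⊤ (one ⊤)) = e.inv.app V' (one V') := by
    rw [← hone, app_mres]
    rfl
  have key : ∀ r : Γ(C, U.ι ''ᵁ V'), r • mres S hV (e.inv.app ⊤ (one ⊤)) =
      e.inv.app V' (show Γ(structureModule U, V') from ((U.ι.appIso V').hom r)) := by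
    intro r
    have h2 : (show Γ(structureModule U, V') from ((U.ι.appIso V').hom r)) =
      ((U.ι.appIso V').hom r) • one V' :=
      (mul_one ((U.ι.appIso V').hom r : Γ(U.toScheme, V'))).symm
    rw [h1, h2, app_smul]
    have h3 (t : Γ(U.toScheme, V')) (m : Γ(S.restrict U.ι, V')) :
      t • m = (show Γ(S.restrict U.ι, V') from
        ((U.ι.appIso V').inv t • (show Γ(S, U.ι ''ᵁ V') from m))) := rfl
    rw [h3, Iso.hom_inv_id_apply]
  simp only [key]
  exact (ConcreteCategory.bijective_of_isIso (e.inv.app V')).comp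
    (ConcreteCategory.bijective_of_isIso (U.ι.appIso V').hom)

end

/-! ### Morphisms determined by a generator, pullback of generators -/

section

variable {C : Scheme.{0}} {M N : C.Modules} {U V W : C.Opens}

lemma mres_bijective_of_le (h : V ≤ U) (h' : U ≤ V) : Function.Bijective (mres M h) :=
  Function.bijective_iff_has_inverse.2
    ⟨mres M h', fun x ↦ by simp, fun x ↦ by simp⟩

/-- A generator of `M` over `V` can be sent to any section of a sheaf `G` which is extended
from `V`. -/
lemma IsGenerator.exists_hom {u : Γ(M, V)} (hu : IsGenerator u)
    (hN : ∀ W : C.Opens, Function.Bijective (mres N (inf_le_left : W ⊓ V ≤ W)))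
    (g : Γ(N, V)) : ∃ f : M ⟶ N, f.app V u = g := by
  choose r hr using fun (W : C.Opens) (m : Γ(M, W)) ↦ hu.exists_smul (inf_le_right : W ⊓ V ≤ V)
    (mres M (inf_le_left : W ⊓ V ≤ W) m)
  choose y hy using fun (W : C.Opens) (m : Γ(M, W)) ↦ (hN W).2
    (r W m • mres N (inf_le_right : W ⊓ V ≤ V) g)
  have uniq : ∀ (W : C.Opens) (m : Γ(M, W)) (t : Γ(C, W ⊓ V)),
      t • mres M inf_le_right u = mres M inf_le_left m → t = r W m :=
    fun W m t ht ↦ (hu _ inf_le_right).1 (ht.trans (hr W m).symm)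
  refine ⟨ModuleData.hom (fun W ↦ { toFun := y W, map_add' := ?_, map_smul' := ?_ }) ?_, ?_⟩
  · intro a b
    apply (hN W).1
    rw [map_add, hy, hy, hy, ← add_smul]
    congr 1
    refine (uniq _ _ _ ?_).symm
    rw [add_smul, hr, hr, map_add]
  · intro s a
    apply (hN W).1
    rw [RingHom.id_apply, mres_smul, hy, hy, ← mul_smul]
    congr 1
    refine (uniq _ _ _ ?_).symm
    rw [mul_smul, hr, mres_smul]
  · intro W W' h m
    apply (hN W').1
    change mres N inf_le_left (y W' (mres M h m)) =
      mres N inf_le_left (mres N h (y W m))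
    rw [hy, mres_mres]
    have h1 := congrArg (mres N (inf_le_inf_right V h)) (hy W m)
    rw [mres_mres] at h1
    rw [h1, mres_smul, mres_mres]
    congr 1
    refine (uniq _ _ _ ?_).symm
    have h2 := congrArg (mres M (inf_le_inf_right V h)) (hr W m)
    rw [mres_smul, mres_mres, mres_mres] at h2
    rw [h2, mres_mres]
  · apply (hN V).1
    refine (hy V u).trans ?_
    rw [← uniq V u 1 (one_smul _ _), one_smul]

lemma IsGenerator.hom_ext {u : Γ(M, V)} (hu : IsGenerator u)
    (hN : ∀ W : C.Opens, Function.Injective (mres N (inf_le_left : W ⊓ V ≤ W)))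
    {f f' : M ⟶ N} (h : f.app V u = f'.app V u) : f = f' := by
  refine mod_hom_ext fun W m ↦ hN W ?_
  obtain ⟨r, hr⟩ := hu.exists_smul (inf_le_right : W ⊓ V ≤ V)
    (mres M (inf_le_left : W ⊓ V ≤ W) m)
  rw [← app_mres, ← app_mres, ← hr, app_smul, app_smul, app_mres, app_mres, h]

/-- The sheaf `W ↦ Γ(M, W ∩ V)`. -/
def cut (M : C.Modules) (V : C.Opens) : C.Modules :=
  (Scheme.Modules.pushforward V.ι).obj (M.restrict V.ι)

lemma image_preimage_eq (V W : C.Opens) : V.ι ''ᵁ V.ι ⁻¹ᵁ W = V ⊓ W := by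
  rw [Scheme.Hom.image_preimage_eq_opensRange_inf, Scheme.Opens.opensRange_ι]

/-- Sections of `cut Z V` over `W` only depend on `V ∩ W`. -/
lemma cut_mres_bijective (Z : C.Modules) (V : C.Opens) {W W' : C.Opens} (h : W' ≤ W)
    (h' : V ⊓ W ≤ W') : Function.Bijective (mres (cut Z V) h) := by
  have h1 : V.ι ''ᵁ V.ι ⁻¹ᵁ W' ≤ V.ι ''ᵁ V.ι ⁻¹ᵁ W := by
    rw [image_preimage_eq, image_preimage_eq]
    exact inf_le_inf_left _ h
  have h2 : V.ι ''ᵁ V.ι ⁻¹ᵁ W ≤ V.ι ''ᵁ V.ι ⁻¹ᵁ W' := by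
    rw [image_preimage_eq, image_preimage_eq]
    exact le_inf inf_le_left h'
  exact mres_bijective_of_le (M := Z) h1 h2

lemma cut_smul (Z : C.Modules) (V W : C.Opens) (r : Γ(C, W)) (x : Γ(cut Z V, W)) :
    (r • x : Γ(cut Z V, W)) =
      (ores C (V.ι.image_preimage_le W) r • (show Γ(Z, V.ι ''ᵁ V.ι ⁻¹ᵁ W) from x) :) := by
  have h : ores C (V.ι.image_preimage_le W) r = (V.ι.appIso _).inv (V.ι.app W r) := by
    rw [← CommRingCat.comp_apply, Scheme.Hom.app_appIso_inv]
    rfl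
  rw [h]
  rfl

end

section Pullback

variable {B P : Scheme.{0}} (p : B ⟶ P) {M : P.Modules}

/-- The pulled back section `p^* u`. -/
def pullSection (M : P.Modules) {V : P.Opens} (u : Γ(M, V)) :
    Γ((Scheme.Modules.pullback p).obj M, p ⁻¹ᵁ V) :=
  ((Scheme.Modules.pullbackPushforwardAdjunction p).unit.app M).app V u

lemma pullSection_mres {V W : P.Opens} (h : W ≤ V) (u : Γ(M, V)) :
    pullSection p M (mres M h u) = mres _ (p.preimage_mono h) (pullSection p M u) :=
  app_mres ((Scheme.Modules.pullbackPushforwardAdjunction p).unit.app M) h u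

lemma pullSection_smul {V : P.Opens} (r : Γ(P, V)) (u : Γ(M, V)) :
    pullSection p M (r • u) = p.app V r • pullSection p M u :=
  app_smul ((Scheme.Modules.pullbackPushforwardAdjunction p).unit.app M) r u

lemma mres_pushforward (X : B.Modules) {V W : P.Opens} (h : W ≤ V) :
    mres ((Scheme.Modules.pushforward p).obj X) h = mres X (p.preimage_mono h) := rfl

lemma pushforward_cut_mres_bijective (Z : B.Modules) (V W : P.Opens) : Function.Bijective
    (mres ((Scheme.Modules.pushforward p).obj (cut Z (p ⁻¹ᵁ V))) (inf_le_left : W ⊓ V ≤ W)) := by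
  rw [mres_pushforward]
  exact cut_mres_bijective Z _ (p.preimage_mono inf_le_left) (le_inf inf_le_right inf_le_left)

lemma homEquiv_app_apply {Z : B.Modules} (f : (Scheme.Modules.pullback p).obj M ⟶ Z)
    {V : P.Opens} (u : Γ(M, V)) :
    (((Scheme.Modules.pullbackPushforwardAdjunction p).homEquiv M Z f).app V u :) =
      f.app (p ⁻¹ᵁ V) (pullSection p M u) := by
  rw [Adjunction.homEquiv_unit]
  rfl

/-- The pullback of a generator is a generator. As the pullback of modules is only known by its
universal property, the coordinate `ψ` with respect to `p^* u` is obtained from the adjunction, and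
`x = ψ x • p^* u` holds because both sides define morphisms to the sheaf `cut` that agree on
`p^* u`. -/
lemma IsGenerator.pullSection {V : P.Opens} {u : Γ(M, V)} (hu : IsGenerator u) :
    IsGenerator (pullSection p M u) := by
  set L := (Scheme.Modules.pullback p).obj M with hL
  set V' := p ⁻¹ᵁ V
  let adj := Scheme.Modules.pullbackPushforwardAdjunction p
  have hext : ∀ (Z : B.Modules) (f f' : L ⟶ cut Z V'),
      f.app V' (SusyNormal.pullSection p M u) =
        f'.app V' (SusyNormal.pullSection p M u) → f = f' := by
    intro Z f f' h
    apply (adj.homEquiv _ _).injective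
    refine hu.hom_ext (fun W ↦ (pushforward_cut_mres_bijective p Z V W).1) ?_
    exact (homEquiv_app_apply p f u).trans (h.trans (homEquiv_app_apply p f' u).symm)
  let one : ∀ W : B.Opens, Γ(structureModule B, W) := fun W ↦ (1 : Γ(B, W))
  obtain ⟨ψ', hψ'⟩ := hu.exists_hom (pushforward_cut_mres_bijective p (structureModule B) V) (one _)
  obtain ⟨ψ, rfl⟩ := (adj.homEquiv _ _).surjective ψ'
  have hψ : ψ.app V' (SusyNormal.pullSection p M u) = one _ := by
    exact (homEquiv_app_apply p ψ u).symm.trans hψ'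
  -- functions `ψ x` with `x = ψ x • p^* u`
  have hle : ∀ W : B.Opens, W ≤ V' → W ≤ V'.ι ''ᵁ V'.ι ⁻¹ᵁ W := fun W hW ↦ by
    rw [image_preimage_eq]; exact le_inf hW le_rfl
  have hle' : ∀ W : B.Opens, V'.ι ''ᵁ V'.ι ⁻¹ᵁ W ≤ V' := fun W ↦ by
    rw [image_preimage_eq]; exact inf_le_left
  have hle2 : ∀ W : B.Opens, V'.ι ''ᵁ V'.ι ⁻¹ᵁ W ≤ W := fun W ↦ by
    rw [image_preimage_eq]; exact inf_le_right
  let ev : ∀ W : B.Opens, Γ(L, W) → Γ(B, V'.ι ''ᵁ V'.ι ⁻¹ᵁ W) := fun W x ↦ ψ.app W x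
  have ev_smul : ∀ (W : B.Opens) (r : Γ(B, W)) (x : Γ(L, W)),
      ev W (r • x) = ores B (hle2 W) r * ev W x := fun W r x ↦
    (app_smul ψ r x).trans (cut_smul _ _ _ _ _)
  have ev_mres : ∀ (W W' : B.Opens) (h : W' ≤ W) (x : Γ(L, W)),
      ev W' (mres L h x) = ores B (by rw [image_preimage_eq, image_preimage_eq]; exact inf_le_inf_left _ h)
        (ev W x) :=
    fun W W' h x ↦ app_mres ψ h x
  have ev_add : ∀ (W : B.Opens) (x y : Γ(L, W)), ev W (x + y) = ev W x + ev W y :=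
    fun W x y ↦ map_add (ψ.app W).hom x y
  let κ : ∀ W : B.Opens, Γ(L, W) → Γ(L, V'.ι ''ᵁ V'.ι ⁻¹ᵁ W) := fun W x ↦
    ev W x • mres L (hle' W) (SusyNormal.pullSection p M u)
  have κ_add : ∀ (W : B.Opens) (x y : Γ(L, W)), κ W (x + y) = κ W x + κ W y := fun W x y ↦ by
    simp only [κ, ev_add, add_smul]
  have κ_smul : ∀ (W : B.Opens) (r : Γ(B, W)) (x : Γ(L, W)),
      κ W (r • x) = ores B (hle2 W) r • κ W x := fun W r x ↦ by
    simp only [κ, ev_smul, mul_smul]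
  have κ_mres : ∀ (W W' : B.Opens) (h : W' ≤ W) (x : Γ(L, W)), κ W' (mres L h x) =
      mres L (V'.ι.image_mono (V'.ι.preimage_mono h)) (κ W x) := fun W W' h x ↦ by
    simp only [κ, ev_mres, mres_smul, mres_mres]
  let θ : L ⟶ cut L V' := ModuleData.hom (N := cut L V') (fun W ↦
    { toFun := fun x ↦ (show Γ(cut L V', W) from κ W x)
      map_add' := κ_add W
      map_smul' := fun r x ↦ (κ_smul W r x).trans (cut_smul L V' W r (κ W x)).symm })
    fun {W W'} h x ↦ κ_mres W W' h x
  have hev : ev V' (SusyNormal.pullSection p M u) = 1 := hψ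
  have hθ : θ = (Scheme.Modules.restrictAdjunction V'.ι).unit.app L := by
    refine hext L _ _ ?_
    change κ V' (SusyNormal.pullSection p M u) =
      mres L (hle2 V') (SusyNormal.pullSection p M u)
    simp only [κ, hev, one_smul]
  have h1 : ∀ (W : B.Opens) (x : Γ(L, W)), ev W x •
      mres L (hle' W) (SusyNormal.pullSection p M u) = mres L (hle2 W) x :=
    fun W x ↦ CategoryTheory.congr_fun (congrArg (fun f : L ⟶ cut L V' ↦ f.app W) hθ) x
  intro W hW
  refine ⟨fun r r' hr ↦ ?_, fun x ↦ ⟨ores B (hle W hW) (ev W x), ?_⟩⟩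
  · have h2 : ∀ r : Γ(B, W), ores B (hle W hW)
        (ev W (r • mres L hW (SusyNormal.pullSection p M u))) = r := fun r ↦ by
      rw [ev_smul, ev_mres, hev, map_one, mul_one, ores_ores, ores_self]
    rw [← h2 r, ← h2 r']
    exact congrArg _ (congrArg _ hr)
  · have h3 := congrArg (mres L (hle W hW)) (h1 W x)
    rw [mres_smul, mres_mres, mres_mres, mres_self] at h3
    exact h3

end Pullback

/-! ### Closed immersions and restriction to sections -/

section ClosedImmersion

variable {Z C : Scheme.{0}} (i : Z ⟶ C) [IsClosedImmersion i]

lemma exists_open_preimage (V : Z.Opens) : ∃ U : C.Opens, i ⁻¹ᵁ U = V :=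
  ⟨_, i.isClosedEmbedding.isInducing.map_functorObj V⟩

/-- Functions on a closed subscheme locally extend to the ambient scheme. -/
lemma exists_local_extension {U : C.Opens} (r : Γ(Z, i ⁻¹ᵁ U)) (z : Z) (hz : z ∈ i ⁻¹ᵁ U) :
    ∃ (U' : C.Opens) (h : U' ≤ U) (r' : Γ(C, U')), z ∈ i ⁻¹ᵁ U' ∧
      i.app U' r' = ores Z (i.preimage_mono h) r := by
  obtain ⟨W, hW, hzW, hWU⟩ := exists_isAffineOpen_mem_and_subset (show i z ∈ U from hz)
  have hs := ((isClosedImmersion_iff_isAffineHom (f := i)).1 inferInstance).2 W hW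
  obtain ⟨r', hr'⟩ := hs (ores Z (i.preimage_mono hWU) r)
  exact ⟨W, hWU, r', hzW, hr'⟩

/-- Pushforward of modules along a closed immersion is full. -/
lemma exists_pushforward_map_eq {M N : Z.Modules}
    (φ : (Scheme.Modules.pushforward i).obj M ⟶ (Scheme.Modules.pushforward i).obj N) :
    ∃ ψ : M ⟶ N, (Scheme.Modules.pushforward i).map ψ = φ := by
  let E : Z.Opens → C.Opens := i.isClosedEmbedding.isInducing.functorObj
  have hE : ∀ V, i ⁻¹ᵁ E V = V := fun V ↦ i.isClosedEmbedding.isInducing.map_functorObj V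
  have hEm : ∀ {V V' : Z.Opens}, V' ≤ V → E V' ≤ E V := fun {V V'} h ↦
    i.isClosedEmbedding.isInducing.le_functorObj_iff.2 ((hE V').le.trans h)
  have hUE : ∀ U : C.Opens, U ≤ E (i ⁻¹ᵁ U) := fun U ↦
    i.isClosedEmbedding.isInducing.le_functorObj_iff.2 le_rfl
  let φ' : ∀ U : C.Opens, Γ(M, i ⁻¹ᵁ U) →+ Γ(N, i ⁻¹ᵁ U) := fun U ↦ (φ.app U).hom
  have φ'_res : ∀ {U U' : C.Opens} (h : U' ≤ U) (m : Γ(M, i ⁻¹ᵁ U)),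
      φ' U' (mres M (i.preimage_mono h) m) = mres N (i.preimage_mono h) (φ' U m) :=
    fun h m ↦ app_mres φ h m
  have φ'_smul : ∀ {U : C.Opens} (r : Γ(C, U)) (m : Γ(M, i ⁻¹ᵁ U)),
      φ' U (i.app U r • m) = i.app U r • φ' U m := fun r m ↦ app_smul φ r m
  have φ'_lin : ∀ {U : C.Opens} (r : Γ(Z, i ⁻¹ᵁ U)) (m : Γ(M, i ⁻¹ᵁ U)),
      φ' U (r • m) = r • φ' U m := by
    intro U r m
    refine mres_ext fun z hz ↦ ?_
    obtain ⟨U', h, r', hz', hr'⟩ := exists_local_extension i r z hz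
    refine ⟨i ⁻¹ᵁ U', i.preimage_mono h, hz', ?_⟩
    rw [← φ'_res h, mres_smul, mres_smul, ← hr', φ'_smul, φ'_res h]
  refine ⟨ModuleData.hom (fun V ↦
    { toFun := fun m ↦ mres N (hE V).ge (φ' (E V) (mres M (hE V).le m))
      map_add' := fun a b ↦ by simp only [map_add]
      map_smul' := fun r a ↦ by
        rw [mres_smul, φ'_lin, mres_smul, ores_ores, ores_self, RingHom.id_apply] }) ?_, ?_⟩
  · intro V V' h m
    change mres N (hE V').ge (φ' (E V') (mres M (hE V').le (mres M h m))) =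
      mres N h (mres N (hE V).ge (φ' (E V) (mres M (hE V).le m)))
    rw [mres_mres, mres_mres, ← mres_mres (hE V).le (i.preimage_mono (hEm h)), φ'_res (hEm h), mres_mres]
  · refine mod_hom_ext fun U (m : Γ(M, i ⁻¹ᵁ U)) ↦ ?_
    change mres N (hE _).ge (φ' (E (i ⁻¹ᵁ U)) (mres M (hE _).le m)) = φ' U m
    have h1 := φ'_res (hUE U) (mres M (hE _).le m)
    rw [mres_mres, mres_self] at h1
    rw [h1]

end ClosedImmersion

section PullbackPushforward

variable {B Z C : Scheme.{0}}

lemma pullback_hom_ext (p : B ⟶ C) {M : C.Modules} {N : B.Modules}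
    {f f' : (Scheme.Modules.pullback p).obj M ⟶ N}
    (h : ∀ (V : C.Opens) (u : Γ(M, V)), f.app (p ⁻¹ᵁ V) (pullSection p M u) =
      f'.app (p ⁻¹ᵁ V) (pullSection p M u)) : f = f' := by
  apply ((Scheme.Modules.pullbackPushforwardAdjunction p).homEquiv _ _).injective
  refine mod_hom_ext fun V u ↦ ?_
  exact (homEquiv_app_apply p f u).trans ((h V u).trans (homEquiv_app_apply p f' u).symm)

lemma exists_pullback_hom (p : B ⟶ C) {M : C.Modules} {N : B.Modules}
    (θ : M ⟶ (Scheme.Modules.pushforward p).obj N) :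
    ∃ f : (Scheme.Modules.pullback p).obj M ⟶ N, ∀ (V : C.Opens) (u : Γ(M, V)),
      f.app (p ⁻¹ᵁ V) (pullSection p M u) = θ.app V u := by
  obtain ⟨f, rfl⟩ := ((Scheme.Modules.pullbackPushforwardAdjunction p).homEquiv _ _).surjective θ
  exact ⟨f, fun V u ↦ (homEquiv_app_apply p f u).symm⟩

/-- For a closed immersion `i` and `f : B ⟶ Z`, one has `(f ≫ i)^* i_* S ≅ f^* S`. -/
lemma exists_pullback_pushforward_iso (f : B ⟶ Z) (i : Z ⟶ C) [IsClosedImmersion i]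
    {p : B ⟶ C} (hp : f ≫ i = p) (S : Z.Modules) :
    ∃ e : (Scheme.Modules.pullback p).obj ((Scheme.Modules.pushforward i).obj S) ≅
      (Scheme.Modules.pullback f).obj S, ∀ (V : C.Opens) (u : Γ(S, i ⁻¹ᵁ V)),
      e.hom.app (p ⁻¹ᵁ V) (pullSection p ((Scheme.Modules.pushforward i).obj S) u) =
        mres ((Scheme.Modules.pullback f).obj S) (by subst hp; exact le_rfl)
          (pullSection f S u) := by
  subst hp
  let θ : (Scheme.Modules.pushforward i).obj S ⟶ (Scheme.Modules.pushforward (f ≫ i)).obj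
      ((Scheme.Modules.pullback f).obj S) :=
    (Scheme.Modules.pushforward i).map
      ((Scheme.Modules.pullbackPushforwardAdjunction f).unit.app S) ≫
      (Scheme.Modules.pushforwardComp f i).hom.app _
  obtain ⟨g, hg⟩ := exists_pullback_hom (f ≫ i) θ
  have hg' : ∀ (V : C.Opens) (u : Γ(S, i ⁻¹ᵁ V)), g.app (f ⁻¹ᵁ i ⁻¹ᵁ V)
      (pullSection (f ≫ i) ((Scheme.Modules.pushforward i).obj S) u) = pullSection f S u := hg
  have : IsIso g := by
    refine isIso_of_coyoneda_map_bijective g fun T ↦ ⟨fun x x' h ↦ ?_, fun y ↦ ?_⟩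
    · refine pullback_hom_ext f fun V u ↦ ?_
      obtain ⟨U, rfl⟩ := exists_open_preimage i V
      rw [← hg' U u]
      exact CategoryTheory.congr_fun (congrArg (fun k ↦ k.app (f ⁻¹ᵁ i ⁻¹ᵁ U)) h) _
    · obtain ⟨ψ, hψ⟩ := exists_pushforward_map_eq i (N := (Scheme.Modules.pushforward f).obj T)
        ((Scheme.Modules.pullbackPushforwardAdjunction (f ≫ i)).homEquiv _ _ y ≫
          (Scheme.Modules.pushforwardComp f i).inv.app _)
      obtain ⟨x, hx⟩ := exists_pullback_hom f ψ
      refine ⟨x, pullback_hom_ext (f ≫ i) fun V u ↦ ?_⟩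
      have h1 : ψ.app (i ⁻¹ᵁ V) u = y.app _ (pullSection (f ≫ i) _ u) :=
        (CategoryTheory.congr_fun (congrArg (fun k ↦ k.app V) hψ) u).trans
          (homEquiv_app_apply (f ≫ i) y u)
      refine Eq.trans ?_ h1
      refine Eq.trans ?_ (hx (i ⁻¹ᵁ V) u)
      exact congrArg (x.app (f ⁻¹ᵁ i ⁻¹ᵁ V)) (hg' V u)
  exact ⟨asIso g, fun V u ↦ (hg' V u).trans (mres_self _ _).symm⟩

/-- If `p` does not meet the image of `i`, then `p^* i_* S = 0`. -/
lemma isZero_pullback_pushforward (p : B ⟶ C) (i : Z ⟶ C) [IsClosedImmersion i]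
    (hp : ∀ b z, p b ≠ i z) (S : Z.Modules) :
    IsZero ((Scheme.Modules.pullback p).obj ((Scheme.Modules.pushforward i).obj S)) := by
  rw [IsZero.iff_id_eq_zero]
  refine pullback_hom_ext p fun V u ↦ ?_
  let O : C.Opens := ⟨(Set.range i)ᶜ, i.isClosedEmbedding.isClosed_range.isOpen_compl⟩
  have h1 : p ⁻¹ᵁ V ≤ p ⁻¹ᵁ (V ⊓ O) := fun b hb ↦ ⟨hb, fun ⟨z, hz⟩ ↦ hp b z hz.symm⟩
  have h2 : mres ((Scheme.Modules.pushforward i).obj S) (inf_le_left : V ⊓ O ≤ V) u = 0 := by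
    have : i ⁻¹ᵁ (V ⊓ O) = ⊥ := by
      ext z
      simp [O]
    refine mres_ext (M := S) fun z hz ↦ ?_
    exact absurd hz (by rw [this]; exact id)
  have h3 := pullSection_mres p (M := (Scheme.Modules.pushforward i).obj S)
    (inf_le_left : V ⊓ O ≤ V) u
  rw [h2] at h3
  have h4 : pullSection p ((Scheme.Modules.pushforward i).obj S) u = 0 := by
    have := congrArg (mres _ h1) h3
    rw [mres_mres, mres_self] at this
    rw [← this]
    refine (congrArg _ (map_zero (((Scheme.Modules.pullbackPushforwardAdjunction p).unit.app
      ((Scheme.Modules.pushforward i).obj S)).app (V ⊓ O)).hom)).trans (map_zero _)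
  rw [h4]
  exact (map_zero ((𝟙 ((Scheme.Modules.pullback p).obj _) : _ ⟶ _).app (p ⁻¹ᵁ V)).hom).trans
    (map_zero (Scheme.Modules.Hom.app 0 (p ⁻¹ᵁ V)).hom).symm

lemma le_section {c : C ⟶ B} {p : B ⟶ C} (hp : p ≫ c = 𝟙 B) (V : B.Opens) :
    V ≤ p ⁻¹ᵁ c ⁻¹ᵁ V := by
  rw [← Scheme.Hom.comp_preimage, hp]
  exact le_rfl

end PullbackPushforward

/-! ### Self-dual lattices over Laurent polynomials -/

section LaurentModules

open LaurentPolynomial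

variable {R : Type*} [CommRing R]

lemma coeff_T_mul (k j : ℤ) (p : R[T;T⁻¹]) : (T k * p).coeff j = p.coeff (j - k) := by
  induction p using LaurentPolynomial.induction_on' with
  | add p q hp hq => simp only [mul_add, AddMonoidAlgebra.coeff_add, Finsupp.add_apply, hp, hq]
  | C_mul_T n r =>
    rw [show T k * (C r * T n) = C r * T (k + n) by rw [T_add]; ring, ← single_eq_C_mul_T,
      ← single_eq_C_mul_T]
    simp only [AddMonoidAlgebra.coeff_single, Finsupp.single_apply]
    congr 1
    apply propext
    omega

lemma laurent_eq_sum (p : R[T;T⁻¹]) : p = ∑ j ∈ p.coeff.support, C (p.coeff j) * T j := by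
  simp only [← single_eq_C_mul_T]
  ext k
  simp only [AddMonoidAlgebra.coeff_sum, Finsupp.finsetSum_apply, AddMonoidAlgebra.coeff_single,
    Finsupp.single_apply, Finset.sum_ite_eq', Finsupp.mem_support_iff]
  by_cases h : p.coeff k = 0 <;> simp [h]

variable {N : Type*} [AddCommGroup N] [Module R[T;T⁻¹] N] [Module R N] [IsScalarTower R R[T;T⁻¹] N]
  (a : N →ₗ[R[T;T⁻¹]] N →ₗ[R[T;T⁻¹]] R[T;T⁻¹]) {m : Ideal R}

lemma smul_smul_eq_C_mul_smul (r : R) (p : R[T;T⁻¹]) (n : N) : r • p • n = (C r * p) • n := by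
  rw [← smul_assoc, LaurentPolynomial.smul_eq_C_mul]

/-- A functional on `N` with values in `R ⧸ m` is a residue of the pairing with an element that
is built from the values of the functional on generators of `N`. -/
lemma exists_residue_eq (ℓ : N →ₗ[R] R ⧸ m) (hsymm : ∀ x y, a x y = a y x)
    (hrank : ∀ x y n, a x y • n = a n y • x) {ι : Type*} [Fintype ι] (s u : ι → N) (d : ℤ)
    (hsu : ∑ i, a (s i) (u i) = T d) (J : Finset ℤ)
    (hJ : ∀ i, ∀ j ∉ J, ℓ ((T (j - d) : R[T;T⁻¹]) • s i) = 0) :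
    ∃ c : ι → ℤ → R, ∀ n, ℓ n = Ideal.Quotient.mk m
      ((a (∑ i, ∑ j ∈ J, c i j • (T (1 - j) : R[T;T⁻¹]) • u i) n).coeff 1) := by
  choose c hc using fun (i : ι) (j : ℤ) ↦
    Ideal.Quotient.mk_surjective (ℓ ((T (j - d) : R[T;T⁻¹]) • s i))
  refine ⟨c, fun n ↦ ?_⟩
  have h1 : n = ∑ i, (T (-d) : R[T;T⁻¹]) • a n (u i) • s i := by
    rw [← Finset.smul_sum]
    rw [Finset.sum_congr rfl fun i _ ↦ hrank n (u i) (s i), ← Finset.sum_smul, hsu, smul_smul, ← T_add]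
    simp
  have h2 : ∀ (i : ι) (p : R[T;T⁻¹]), ℓ ((T (-d) : R[T;T⁻¹]) • p • s i) =
      Ideal.Quotient.mk m (∑ j ∈ J, c i j * p.coeff j) := by
    intro i p
    induction p using LaurentPolynomial.induction_on' with
    | add p q hp hq =>
      simp only [add_smul, smul_add, map_add, hp, hq, Finset.sum_add_distrib,
        AddMonoidAlgebra.coeff_add, Finsupp.add_apply, mul_add]
    | C_mul_T k r =>
      have h3 : (T (-d) : R[T;T⁻¹]) • (C r * T k : R[T;T⁻¹]) • s i =
          r • (T (k - d) : R[T;T⁻¹]) • s i := by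
        rw [smul_smul, smul_smul_eq_C_mul_smul, T_sub]
        congr 1
        ring
      rw [h3, map_smul, ← single_eq_C_mul_T]
      simp only [AddMonoidAlgebra.coeff_single, Finsupp.single_apply, mul_ite, mul_zero,
        Finset.sum_ite_eq]
      split_ifs with hk
      · rw [_root_.map_mul, hc, mul_comm]
        rfl
      · rw [hJ i k hk, smul_zero, map_zero]
  conv_lhs => rw [h1]
  simp only [map_sum, h2, LinearMap.sum_apply, AddMonoidAlgebra.coeff_sum,
    Finsupp.finsetSum_apply]
  refine Finset.sum_congr rfl fun i _ ↦ Finset.sum_congr rfl fun j _ ↦ ?_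
  have h4 : a (c i j • (T (1 - j) : R[T;T⁻¹]) • u i) n = C (c i j) * (T (1 - j) * a (u i) n) := by
    rw [smul_smul_eq_C_mul_smul, map_smul, LinearMap.smul_apply, smul_eq_mul, mul_assoc]
  rw [h4, ← LaurentPolynomial.smul_eq_C_mul, AddMonoidAlgebra.coeff_smul, Finsupp.smul_apply,
    coeff_T_mul, hsymm (u i) n, smul_eq_mul]
  congr 3
  omega

/-- Let `M₀` and `M₁` be an `R[T]`- and an `R[T⁻¹]`-lattice in `N` that are self-dual up to the
twists by `1` and `T²` for a symmetric pairing of rank one: the sections of a spinor bundle of the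
projective line on the two standard charts. Then `N = T M₀ + T⁻¹ M₁`, that is, the first
cohomology of the bundle vanishes after a twist by minus two points. -/
theorem exists_eq_add (hsymm : ∀ x y, a x y = a y x) (hrank : ∀ x y n, a x y • n = a n y • x)
    (M₀ M₁ : Submodule R N)
    (hM₀ : ∀ x ∈ M₀, (T 1 : R[T;T⁻¹]) • x ∈ M₀) (hM₁ : ∀ x ∈ M₁, (T (-1) : R[T;T⁻¹]) • x ∈ M₁)
    (h₀ : ∀ n, ∃ k : ℕ, (T k : R[T;T⁻¹]) • n ∈ M₀)
    (h₁ : ∀ n, ∃ k : ℕ, (T (-k) : R[T;T⁻¹]) • n ∈ M₁)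
    (p₀ : ∀ x ∈ M₀, ∀ y ∈ M₀, ∀ j < 0, (a x y).coeff j = 0)
    (p₁ : ∀ x ∈ M₁, ∀ y ∈ M₁, ∀ j > 2, (a x y).coeff j = 0)
    {ι κ : Type*} [Fintype ι] [Fintype κ] (s u : ι → N) (hs : ∀ i, s i ∈ M₀) (hu : ∀ i, u i ∈ M₀)
    (hsu : ∑ i, a (s i) (u i) = 1)
    (s' u' : κ → N) (hs' : ∀ i, s' i ∈ M₁) (hu' : ∀ i, u' i ∈ M₁)
    (hsu' : ∑ i, a (s' i) (u' i) = T 2) (n : N) :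
    ∃ x ∈ M₀, ∃ y ∈ M₁, n = (T 1 : R[T;T⁻¹]) • x + (T (-1) : R[T;T⁻¹]) • y := by
  let tm : ℤ → N →ₗ[R] N := fun k ↦ Algebra.lsmul R R N (T k : R[T;T⁻¹])
  have tm_apply : ∀ k x, tm k x = (T k : R[T;T⁻¹]) • x := fun _ _ ↦ rfl
  have TT : ∀ (j k : ℤ) (x : N), (T j : R[T;T⁻¹]) • (T k : R[T;T⁻¹]) • x =
      (T (j + k) : R[T;T⁻¹]) • x := fun j k x ↦ by rw [smul_smul, T_add]
  have hM₀' : ∀ (k : ℕ), ∀ x ∈ M₀, (T k : R[T;T⁻¹]) • x ∈ M₀ := by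
    intro k x hx
    induction k with
    | zero => simpa using hx
    | succ k ih =>
      have := hM₀ _ ih
      rwa [TT, add_comm] at this
  have hM₁' : ∀ (k : ℕ), ∀ x ∈ M₁, (T (-k) : R[T;T⁻¹]) • x ∈ M₁ := by
    intro k x hx
    induction k with
    | zero => simpa using hx
    | succ k ih =>
      have := hM₁ _ ih
      rw [TT] at this
      convert this using 3
      push_cast
      ring
  have hM₀Z : ∀ (k : ℤ), 0 ≤ k → ∀ x ∈ M₀, (T k : R[T;T⁻¹]) • x ∈ M₀ := fun k hk x hx ↦ by
    lift k to ℕ using hk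
    exact hM₀' k x hx
  have hM₁Z : ∀ (k : ℤ), k ≤ 0 → ∀ x ∈ M₁, (T k : R[T;T⁻¹]) • x ∈ M₁ := fun k hk x hx ↦ by
    obtain ⟨l, rfl⟩ : ∃ l : ℕ, k = -l := ⟨k.natAbs, by omega⟩
    exact hM₁' l x hx
  let Q : Submodule R N := M₀.map (tm 1) ⊔ M₁.map (tm (-1))
  have hQ₀ : ∀ x ∈ M₀, (T 1 : R[T;T⁻¹]) • x ∈ Q := fun x hx ↦
    Submodule.mem_sup_left (Submodule.mem_map_of_mem (f := tm 1) hx)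
  have hQ₁ : ∀ x ∈ M₁, (T (-1) : R[T;T⁻¹]) • x ∈ Q := fun x hx ↦
    Submodule.mem_sup_right (Submodule.mem_map_of_mem (f := tm (-1)) hx)
  have hQ₀Z : ∀ (k j : ℤ) (x : N), (T j : R[T;T⁻¹]) • x ∈ M₀ → j < k →
      (T k : R[T;T⁻¹]) • x ∈ Q := fun k j x hx hk ↦ by
    have := hQ₀ _ (hM₀Z (k - 1 - j) (by omega) _ hx)
    rw [TT, TT] at this
    convert this using 3
    ring
  have hQ₁Z : ∀ (k j : ℤ) (x : N), (T j : R[T;T⁻¹]) • x ∈ M₁ → k < j →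
      (T k : R[T;T⁻¹]) • x ∈ Q := fun k j x hx hk ↦ by
    have := hQ₁ _ (hM₁Z (k + 1 - j) (by omega) _ hx)
    rw [TT, TT] at this
    convert this using 3
    ring
  have hs0 : ∀ i, (T 0 : R[T;T⁻¹]) • s i ∈ M₀ := fun i ↦ by simpa using hs i
  have hs0' : ∀ i, (T 0 : R[T;T⁻¹]) • s' i ∈ M₁ := fun i ↦ by simpa using hs' i
  suffices hQ : Q = ⊤ by
    obtain ⟨_, ⟨x, hx, rfl⟩, _, ⟨y, hy, rfl⟩, h⟩ :=
      Submodule.mem_sup.1 (show n ∈ Q by rw [hQ]; trivial)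
    exact ⟨x, hx, y, hy, h.symm⟩
  by_contra hQ
  -- the quotient is finitely generated over `R`
  choose K hK using fun i ↦ h₁ (s i)
  choose K' hK' using fun i ↦ h₀ (s' i)
  have hfin : Module.Finite R (N ⧸ Q) := by
    let F : Set (N ⧸ Q) := ⋃ i, (fun k : ℤ ↦ Q.mkQ ((T k : R[T;T⁻¹]) • s i)) '' Set.Icc (-K i : ℤ) 0
    refine ⟨Submodule.fg_def.2 ⟨F, Set.finite_iUnion fun i ↦ (Set.finite_Icc _ _).image _, ?_⟩⟩
    have hF : ∀ i (k : ℤ), Q.mkQ ((T k : R[T;T⁻¹]) • s i) ∈ Submodule.span R F := by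
      intro i k
      by_cases hk : k ∈ Set.Icc (-K i : ℤ) 0
      · exact Submodule.subset_span (Set.mem_iUnion.2 ⟨i, k, hk, rfl⟩)
      · have : (T k : R[T;T⁻¹]) • s i ∈ Q := by
          rw [Set.mem_Icc, not_and_or, not_le, not_le] at hk
          rcases hk with hk | hk
          · exact hQ₁Z _ _ _ (hK i) hk
          · exact hQ₀Z _ _ _ (hs0 i) hk
        rw [show Q.mkQ ((T k : R[T;T⁻¹]) • s i) = 0 from (Submodule.Quotient.mk_eq_zero Q).2 this]
        exact Submodule.zero_mem _
    rw [eq_top_iff]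
    rintro x -
    obtain ⟨x, rfl⟩ := Q.mkQ_surjective x
    have h1 : x = ∑ i, a x (u i) • s i := by
      rw [Finset.sum_congr rfl fun i _ ↦ hrank x (u i) (s i), ← Finset.sum_smul, hsu, one_smul]
    rw [h1, map_sum]
    refine Submodule.sum_mem _ fun i _ ↦ ?_
    rw [laurent_eq_sum (a x (u i)), Finset.sum_smul, map_sum]
    refine Submodule.sum_mem _ fun j _ ↦ ?_
    rw [← smul_smul_eq_C_mul_smul, map_smul]
    exact Submodule.smul_mem _ _ (hF i j)
  -- hence it has a simple quotient
  have : Nontrivial (N ⧸ Q) := Submodule.Quotient.nontrivial_iff.2 hQ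
  obtain ⟨c, hc, -⟩ := (eq_top_or_exists_le_coatom (⊥ : Submodule R (N ⧸ Q))).resolve_left
    bot_ne_top
  obtain ⟨m, hm, ⟨e⟩⟩ := isSimpleModule_iff_quot_maximal.1 (isSimpleModule_iff_isCoatom.2 hc)
  let ℓ : N →ₗ[R] R ⧸ m := e.toLinearMap ∘ₗ c.mkQ ∘ₗ Q.mkQ
  have hℓsurj : Function.Surjective ℓ :=
    e.surjective.comp (c.mkQ_surjective.comp Q.mkQ_surjective)
  have hℓ : ∀ x ∈ Q, ℓ x = 0 := fun x hx ↦ by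
    have : Q.mkQ x = 0 := (Submodule.Quotient.mk_eq_zero Q).2 hx
    simp [ℓ, this]
  -- represent `ℓ` as a residue in two ways
  let κ₀ := ∑ i, K i
  let κ₁ := ∑ i, K' i
  obtain ⟨c₀, hc₀⟩ := exists_residue_eq a ℓ hsymm hrank s u 0 (by rw [hsu, T_zero])
    (Finset.Icc (-κ₀ : ℤ) 0) fun i j hj ↦ hℓ _ <| by
      rw [Finset.mem_Icc, not_and_or, not_le, not_le] at hj
      rcases hj with hj | hj
      · refine hQ₁Z _ _ _ (hK i) ?_
        have : K i ≤ κ₀ := Finset.single_le_sum (fun _ _ ↦ Nat.zero_le _) (Finset.mem_univ i)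
        omega
      · exact hQ₀Z _ _ _ (hs0 i) (by omega)
  obtain ⟨c₁, hc₁⟩ := exists_residue_eq a ℓ hsymm hrank s' u' 2 hsu'
    (Finset.Icc 2 (κ₁ + 2 : ℤ)) fun i j hj ↦ hℓ _ <| by
      rw [Finset.mem_Icc, not_and_or, not_le, not_le] at hj
      rcases hj with hj | hj
      · exact hQ₁Z _ _ _ (hs0' i) (by omega)
      · refine hQ₀Z _ _ _ (hK' i) ?_
        have : K' i ≤ κ₁ := Finset.single_le_sum (fun _ _ ↦ Nat.zero_le _) (Finset.mem_univ i)
        omega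
  set x := ∑ i, ∑ j ∈ Finset.Icc (-κ₀ : ℤ) 0, c₀ i j • (T (1 - j) : R[T;T⁻¹]) • u i
  set y := ∑ i, ∑ j ∈ Finset.Icc 2 (κ₁ + 2 : ℤ), c₁ i j • (T (1 - j) : R[T;T⁻¹]) • u' i
  have hx : (T (-1) : R[T;T⁻¹]) • x ∈ M₀ := by
    rw [← tm_apply]
    simp only [x, map_sum, map_smul]
    refine Submodule.sum_mem _ fun i _ ↦ Submodule.sum_mem _ fun j hj ↦ Submodule.smul_mem _ _ ?_
    rw [tm_apply, TT]
    exact hM₀Z _ (by rw [Finset.mem_Icc] at hj; omega) _ (hu i)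
  have hy : (T 1 : R[T;T⁻¹]) • y ∈ M₁ := by
    rw [← tm_apply]
    simp only [y, map_sum, map_smul]
    refine Submodule.sum_mem _ fun i _ ↦ Submodule.sum_mem _ fun j hj ↦ Submodule.smul_mem _ _ ?_
    rw [tm_apply, TT]
    exact hM₁Z _ (by rw [Finset.mem_Icc] at hj; omega) _ (hu' i)
  have haT : ∀ k z, a ((T k : R[T;T⁻¹]) • z) ((T k : R[T;T⁻¹]) • z) = T (2 * k) * a z z :=
    fun k z ↦ by
      rw [map_smul, map_smul, LinearMap.smul_apply, smul_eq_mul, smul_eq_mul, ← mul_assoc,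
        ← T_add, two_mul]
  let red : R[T;T⁻¹] →+* (R ⧸ m)[T;T⁻¹] := AddMonoidAlgebra.mapRingHom ℤ (Ideal.Quotient.mk m)
  have hred : ∀ p j, (red p).coeff j = Ideal.Quotient.mk m (p.coeff j) := fun p j ↦ by
    simp [red]
  -- modulo `m` all coefficients agree: the coefficient at `j` is the residue at `T ^ (1 - j) • n`
  have h1 : ∀ n, red (a x n) = red (a y n) := fun n ↦ by
    ext j
    have h2 := (hc₀ ((T (1 - j) : R[T;T⁻¹]) • n)).symm.trans (hc₁ ((T (1 - j) : R[T;T⁻¹]) • n))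
    rw [map_smul, map_smul, smul_eq_mul, smul_eq_mul, coeff_T_mul, coeff_T_mul,
      sub_sub_cancel] at h2
    rw [hred, hred, h2]
  -- `a x x` starts at `T ^ 2` since `T⁻¹ x ∈ M₀`, and `a y y` ends at `T ^ 0` since `T y ∈ M₁`
  have h2 : red (a x x) = 0 := by
    ext j
    by_cases hj : j < 2
    · have h3 := p₀ _ hx _ hx (j - 2) (by omega)
      rw [haT, coeff_T_mul] at h3
      rw [hred, show j = j - 2 - 2 * (-1) by ring, h3, map_zero]
      rfl
    · have h3 := p₁ _ hy _ hy (j + 2) (by omega)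
      rw [haT, coeff_T_mul] at h3
      rw [h1 x, hsymm y x, h1 y, hred, show j = j + 2 - 2 * 1 by ring, h3, map_zero]
      rfl
  have : IsDomain (R ⧸ m) := Ideal.Quotient.isDomain m
  -- as the pairing has rank one, `a x n ^ 2 = a x x * a n n`
  have h3 : ∀ n, red (a x n) = 0 := fun n ↦ by
    have h4 := congrArg (fun z ↦ a z n) (hrank x x n)
    simp only [map_smul, LinearMap.smul_apply, smul_eq_mul] at h4
    have h5 := congrArg red h4
    rw [_root_.map_mul, _root_.map_mul, h2, zero_mul, hsymm n x] at h5
    exact mul_self_eq_zero.1 h5.symm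
  obtain ⟨n, hn⟩ := hℓsurj 1
  have h4 := hc₀ n
  rw [← hred, h3, hn] at h4
  exact one_ne_zero h4

end LaurentModules

/-! ### Finite direct sums and cokernels -/

section Homological

variable {A : Type*} [Category* A]

/-- A decomposition of `Q` as a finite direct sum of objects `L k`. -/
structure Decomposition [Preadditive A] {K : Type*} (Q : A) (L : K → A) where
  π : ∀ k, Q ⟶ L k
  ι : ∀ k, L k ⟶ Q
  ι_π_self : ∀ k, ι k ≫ π k = 𝟙 _
  ι_π_ne : ∀ k l, k ≠ l → ι k ≫ π l = 0
  ext : ∀ {Z : A} {f g : Q ⟶ Z}, (∀ k, ι k ≫ f = ι k ≫ g) → f = g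

namespace Decomposition

variable [Preadditive A] {K : Type*} [Finite K] {Q : A} {L : K → A} (d : Decomposition Q L)

/-- The morphism from a direct sum with given components. -/
def desc {Z : A} (g : ∀ k, L k ⟶ Z) : Q ⟶ Z :=
  letI := Fintype.ofFinite K
  ∑ k, d.π k ≫ g k

/-- The morphism to a direct sum with given components. -/
def lift {Z : A} (g : ∀ k, Z ⟶ L k) : Z ⟶ Q :=
  letI := Fintype.ofFinite K
  ∑ k, g k ≫ d.ι k

@[simp]
lemma ι_desc {Z : A} (g : ∀ k, L k ⟶ Z) (k : K) : d.ι k ≫ d.desc g = g k := by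
  let := Fintype.ofFinite K
  rw [desc, Preadditive.comp_sum, Finset.sum_eq_single k]
  · rw [← Category.assoc, d.ι_π_self, Category.id_comp]
  · intro l _ hl
    rw [← Category.assoc, d.ι_π_ne _ _ hl.symm, zero_comp]
  · simp

@[simp]
lemma lift_π {Z : A} (g : ∀ k, Z ⟶ L k) (k : K) : d.lift g ≫ d.π k = g k := by
  let := Fintype.ofFinite K
  rw [lift, Preadditive.sum_comp, Finset.sum_eq_single k]
  · rw [Category.assoc, d.ι_π_self, Category.comp_id]
  · intro l _ hl
    rw [Category.assoc, d.ι_π_ne _ _ hl, comp_zero]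
  · simp

@[simp]
lemma ι_desc_assoc {Z Z' : A} (g : ∀ k, L k ⟶ Z) (k : K) (h : Z ⟶ Z') :
    d.ι k ≫ d.desc g ≫ h = g k ≫ h := by
  rw [← Category.assoc, ι_desc]

@[simp]
lemma lift_π_assoc {Z Z' : A} (g : ∀ k, Z ⟶ L k) (k : K) (h : L k ⟶ Z') :
    d.lift g ≫ d.π k ≫ h = g k ≫ h := by
  rw [← Category.assoc, lift_π]

lemma desc_ι : d.desc d.ι = 𝟙 Q := d.ext fun k ↦ by simp

lemma ext_left {Z : A} {f g : Z ⟶ Q} (h : ∀ k, f ≫ d.π k = g ≫ d.π k) : f = g := by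
  let := Fintype.ofFinite K
  rw [← Category.comp_id f, ← Category.comp_id g, ← d.desc_ι, desc]
  simp only [Preadditive.comp_sum, reassoc_of% h]

end Decomposition

variable {V K V₁ K₁ : Type*}
  {vtx : K → V} {vtx₁ : K₁ → V₁} {P Q P₁ Q₁ : A}
  {Pv : V → A} {L : K → A} {Pv₁ : V₁ → A} {L₁ : K₁ → A}

section

variable [Preadditive A]

lemma ι_comp_π_ne (dP : Decomposition P Pv) (dQ : Decomposition Q L)
    {ρ : ∀ k v, vtx k = v → (Pv v ⟶ L k)} {r : P ⟶ Q}
    (hr : ∀ k v (h : vtx k = v), r ≫ dQ.π k = dP.π v ≫ ρ k v h) {k : K} {v : V} (h : vtx k ≠ v) :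
    dP.ι v ≫ r ≫ dQ.π k = 0 := by
  rw [hr k _ rfl, ← Category.assoc, dP.ι_π_ne _ _ h.symm, zero_comp]

lemma ι_comp_π (dP : Decomposition P Pv) (dQ : Decomposition Q L)
    {ρ : ∀ k v, vtx k = v → (Pv v ⟶ L k)} {r : P ⟶ Q}
    (hr : ∀ k v (h : vtx k = v), r ≫ dQ.π k = dP.π v ≫ ρ k v h) {k : K} {v : V} (h : vtx k = v) :
    dP.ι v ≫ r ≫ dQ.π k = ρ k v h := by
  rw [hr k _ h, ← Category.assoc, dP.ι_π_self, Category.id_comp]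

end

variable [Abelian A]

/-- Let `r : ⨁ P_v ⟶ ⨁ L_k` be a morphism such that every piece `L_k` only depends on one `P_v`,
and let `r₁` arise from `r` by removing the piece `t` and all pieces at the vertices satisfying
`contr`. If these further pieces do not contribute to the cokernel modulo `t`, and if no element
of `P_v` has a non-zero component only in `L_t`, then `L_t`, `coker r` and `coker r₁` form a short
exact sequence. -/
theorem exists_shortExact_cokernel [Finite K] [Finite V₁] [Finite K₁]
    (dP : Decomposition P Pv) (dQ : Decomposition Q L)
    (dP₁ : Decomposition P₁ Pv₁) (dQ₁ : Decomposition Q₁ L₁)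
    {ρ : ∀ k v, vtx k = v → (Pv v ⟶ L k)} {ρ₁ : ∀ k v, vtx₁ k = v → (Pv₁ v ⟶ L₁ k)}
    {r : P ⟶ Q} (hr : ∀ k v (h : vtx k = v), r ≫ dQ.π k = dP.π v ≫ ρ k v h)
    {r₁ : P₁ ⟶ Q₁} (hr₁ : ∀ k v (h : vtx₁ k = v), r₁ ≫ dQ₁.π k = dP₁.π v ≫ ρ₁ k v h)
    (t : K) {contr : V → Prop} {vert : V₁ → V} (hvert : Function.Injective vert)
    (hvert_range : ∀ w, ¬ contr (vert w))
    {km : K₁ → K} (hkm : Function.Injective km)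
    (hkm_range : ∀ k, (k ≠ t ∧ ¬ contr (vtx k)) ↔ ∃ k₁, km k₁ = k)
    (hv : ∀ k w, vtx₁ k = w → vtx (km k) = vert w)
    (eP : ∀ w, Pv (vert w) ≅ Pv₁ w) (eL : ∀ k, L (km k) ≅ L₁ k)
    (he : ∀ k w (h : vtx₁ k = w),
      ρ (km k) (vert w) (hv k w h) ≫ (eL k).hom = (eP w).hom ≫ ρ₁ k w h)
    (hmono : ∀ {Z : A} (y : Z ⟶ Pv (vtx t)),
      (∀ k (h : vtx k = vtx t), k ≠ t → y ≫ ρ k _ h = 0) → y ≫ ρ t _ rfl = 0)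
    (hcontr : ∀ {Z : A} (h : Q ⟶ Z), r ≫ h = 0 → dQ.ι t ≫ h = 0 →
      ∀ k, contr (vtx k) → dQ.ι k ≫ h = 0) :
    ∃ (g : cokernel r ⟶ cokernel r₁) (w : (dQ.ι t ≫ cokernel.π r) ≫ g = 0),
      (ShortComplex.mk (dQ.ι t ≫ cokernel.π r) g w).ShortExact := by
  classical
  have hkm_ne : ∀ k, km k ≠ t := fun k ↦ ((hkm_range _).2 ⟨k, rfl⟩).1
  let α : P ⟶ P₁ := dP₁.lift fun w ↦ dP.π (vert w) ≫ (eP w).hom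
  let β : Q ⟶ Q₁ := dQ₁.lift fun k ↦ dQ.π (km k) ≫ (eL k).hom
  let γ : Q₁ ⟶ Q := dQ₁.desc fun k ↦ (eL k).inv ≫ dQ.ι (km k)
  have hαβ : r ≫ β = α ≫ r₁ := dQ₁.ext_left fun k ↦ by
    simp only [β, α, Category.assoc, Decomposition.lift_π, hr₁ k _ rfl,
      Decomposition.lift_π_assoc, reassoc_of% hr (km k) _ (hv k _ rfl), he]
  have hιβ : ∀ k, dQ.ι (km k) ≫ β = (eL k).hom ≫ dQ₁.ι k := fun k ↦ dQ₁.ext_left fun l ↦ by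
    simp only [β, Category.assoc, Decomposition.lift_π]
    by_cases h : k = l
    · subst h
      rw [dQ₁.ι_π_self, ← Category.assoc, dQ.ι_π_self, Category.id_comp, Category.comp_id]
    · rw [dQ₁.ι_π_ne _ _ h, ← Category.assoc, dQ.ι_π_ne _ _ (fun h' ↦ h (hkm h')), zero_comp,
        comp_zero]
  have hιβ0 : ∀ k, (∀ k₁, km k₁ ≠ k) → dQ.ι k ≫ β = 0 := fun k hk ↦ dQ₁.ext_left fun l ↦ by
    simp only [β, Category.assoc, Decomposition.lift_π, zero_comp]
    rw [← Category.assoc, dQ.ι_π_ne _ _ (hk l).symm, zero_comp]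
  have hγβ : γ ≫ β = 𝟙 _ := dQ₁.ext fun k ↦ by
    simp only [γ, Decomposition.ι_desc_assoc, Category.assoc, hιβ, Iso.inv_hom_id_assoc,
      Category.comp_id]
  have hβ : Epi β := (IsSplitEpi.mk' ⟨γ, hγβ⟩ : IsSplitEpi β).epi
  let g : cokernel r ⟶ cokernel r₁ := cokernel.map r r₁ α β hαβ
  have hg : cokernel.π r ≫ g = β ≫ cokernel.π r₁ := by simp [g]
  have hgepi : Epi g := by
    have : Epi (cokernel.π r ≫ g) := by rw [hg]; exact epi_comp _ _
    exact epi_of_epi (cokernel.π r) g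
  have w : (dQ.ι t ≫ cokernel.π r) ≫ g = 0 := by
    rw [Category.assoc, hg, ← Category.assoc, hιβ0 t hkm_ne, zero_comp]
  refine ⟨g, w, ?_⟩
  have hexact : (ShortComplex.mk (dQ.ι t ≫ cokernel.π r) g w).Exact := by
    -- a map which kills `L t` kills the further pieces that are removed, so it factors through `β`
    have key : ∀ {Z : A} (h : cokernel r ⟶ Z), (dQ.ι t ≫ cokernel.π r) ≫ h = 0 →
        ∃ h₁ : cokernel r₁ ⟶ Z, g ≫ h₁ = h := by
      intro Z h ht
      set h' := cokernel.π r ≫ h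
      have hrh : r ≫ h' = 0 := by simp [h']
      have hth : dQ.ι t ≫ h' = 0 := by rw [← ht, Category.assoc]
      have hβh : β ≫ γ ≫ h' = h' := dQ.ext fun k ↦ by
        by_cases hk : ∃ k₁, km k₁ = k
        · obtain ⟨k, rfl⟩ := hk
          rw [← Category.assoc, hιβ]
          simp only [γ, Category.assoc, Decomposition.ι_desc_assoc, Iso.hom_inv_id_assoc]
        · rw [← Category.assoc, hιβ0 k fun k₁ h ↦ hk ⟨k₁, h⟩, zero_comp]
          by_cases hkt : k = t
          · rw [hkt, hth]
          · refine (hcontr h' hrh hth k ?_).symm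
            by_contra hc
            exact hk ((hkm_range k).1 ⟨hkt, hc⟩)
      have hr₁h : r₁ ≫ γ ≫ h' = 0 := dP₁.ext fun w ↦ by
        rw [comp_zero, ← cancel_epi (eP w).hom, comp_zero]
        -- on the summand at `vert w`, the maps `r` and `r₁` only differ by the component at `t`
        have h1 : ((eP w).hom ≫ dP₁.ι w ≫ r₁) ≫ γ +
            (dP.ι (vert w) ≫ r ≫ dQ.π t) ≫ dQ.ι t = dP.ι (vert w) ≫ r := dQ.ext_left fun k ↦ by
          simp only [Preadditive.add_comp, Category.assoc]
          by_cases hk : ∃ k₁, km k₁ = k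
          · obtain ⟨k, rfl⟩ := hk
            have h2 : γ ≫ dQ.π (km k) = dQ₁.π k ≫ (eL k).inv := dQ₁.ext fun l ↦ by
              simp only [γ, Decomposition.ι_desc_assoc, Category.assoc]
              by_cases hl : l = k
              · subst hl
                rw [dQ.ι_π_self, ← Category.assoc, dQ₁.ι_π_self, Category.id_comp,
                  Category.comp_id]
              · rw [dQ.ι_π_ne _ _ fun h ↦ hl (hkm h), ← Category.assoc, dQ₁.ι_π_ne _ _ hl,
                  zero_comp, comp_zero]
            rw [dQ.ι_π_ne _ _ (hkm_ne k).symm, comp_zero, comp_zero, comp_zero, add_zero, h2]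
            by_cases hw : vtx₁ k = w
            · rw [ι_comp_π dP dQ hr (hv k w hw),
                reassoc_of% ι_comp_π dP₁ dQ₁ hr₁ hw, ← reassoc_of% he k w hw,
                Iso.hom_inv_id, Category.comp_id]
            · rw [ι_comp_π_ne dP dQ hr fun h ↦ hw (hvert ((hv k _ rfl).symm.trans h)),
                reassoc_of% ι_comp_π_ne dP₁ dQ₁ hr₁ hw, zero_comp, comp_zero]
          · have h2 : γ ≫ dQ.π k = 0 := dQ₁.ext fun l ↦ by
              simp only [γ, Decomposition.ι_desc_assoc, Category.assoc, comp_zero]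
              rw [dQ.ι_π_ne _ _ fun h ↦ hk ⟨l, h⟩, comp_zero]
            rw [h2, comp_zero, comp_zero, comp_zero, zero_add]
            by_cases hkt : k = t
            · rw [hkt, dQ.ι_π_self, Category.comp_id]
            · rw [dQ.ι_π_ne _ _ (Ne.symm hkt), comp_zero, comp_zero, comp_zero,
                ι_comp_π_ne dP dQ hr]
              rintro h
              refine hk ((hkm_range k).1 ⟨hkt, ?_⟩)
              rw [h]
              exact hvert_range w
        have h3 := congrArg (· ≫ h') h1
        simpa only [Preadditive.add_comp, Category.assoc, hth, comp_zero, add_zero, hrh] using h3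
      refine ⟨cokernel.desc r₁ (γ ≫ h') hr₁h, ?_⟩
      rw [← cancel_epi (cokernel.π r), ← Category.assoc, hg, Category.assoc, cokernel.π_desc, hβh]
    refine ShortComplex.exact_of_g_is_cokernel _ (CokernelCofork.IsColimit.ofπ' _ _ fun h ht ↦ ?_)
    exact ⟨(key h ht).choose, (key h ht).choose_spec⟩
  have hmono' : Mono (dQ.ι t ≫ cokernel.π r) := by
    rw [Preadditive.mono_iff_cancel_zero]
    intro Z a ha
    have hex : (ShortComplex.mk r (cokernel.π r) (cokernel.condition r)).Exact :=
      ShortComplex.exact_of_g_is_cokernel _ (cokernelIsCokernel r)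
    -- up to an epimorphism, an element of `L t` in the kernel is the image of an element `p` under `r`
    obtain ⟨Z', q, hq, p, hp⟩ := (ShortComplex.exact_iff_exact_up_to_refinements _).1 hex
      (a ≫ dQ.ι t) (by simpa using ha)
    simp only at hp
    rw [← cancel_epi q, comp_zero]
    have h1 : ∀ k v (h : vtx k = v), k ≠ t → (p ≫ dP.π v) ≫ ρ k v h = 0 := fun k v h hk ↦ by
      rw [Category.assoc, ← hr k v h, ← Category.assoc, ← hp, Category.assoc, Category.assoc,
        dQ.ι_π_ne _ _ (Ne.symm hk), comp_zero, comp_zero]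
    have h2 := hmono (p ≫ dP.π (vtx t)) fun k h hk ↦ h1 k _ h hk
    rw [Category.assoc, ← hr t _ rfl, ← Category.assoc, ← hp, Category.assoc, Category.assoc,
      dQ.ι_π_self, Category.comp_id] at h2
    exact h2
  exact ShortComplex.ShortExact.mk' hexact hmono' hgepi

end Homological

/-! ### Affine charts on families of projective lines -/

lemma eval₂_bijective_of_isLocalization {R R' A A' : Type*} [CommRing R] [CommRing R'] [CommRing A]
    [CommRing A'] [Algebra R R'] [Algebra A A'] (φ : R →+* A) (φ' : R' →+* A')
    (hφ : ∀ r, φ' (algebraMap R R' r) = algebraMap A A' (φ r)) (f : R) [IsLocalization.Away f R']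
    [IsLocalization.Away (φ f) A'] (z : A)
    (h : Function.Bijective (Polynomial.eval₂RingHom φ z)) :
    Function.Bijective (Polynomial.eval₂RingHom φ' (algebraMap A A' z)) := by
  let e := RingEquiv.ofBijective _ h
  let _ : Algebra (Polynomial R) (Polynomial R') := Polynomial.algebra R R'
  have _ := Polynomial.isLocalization (Submonoid.powers f) R'
  have H : ((Submonoid.powers f).map Polynomial.C).map e.toMonoidHom = Submonoid.powers (φ f) := by
    rw [Submonoid.map_powers, Submonoid.map_powers]
    congr 1
    exact Polynomial.eval₂_C _ _
  let E := IsLocalization.ringEquivOfRingEquiv (Polynomial R') A' e H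
  have : Polynomial.eval₂RingHom φ' (algebraMap A A' z) = (E : Polynomial R' →+* A') := by
    refine IsLocalization.ringHom_ext ((Submonoid.powers f).map Polynomial.C) ?_
    refine Polynomial.ringHom_ext (fun r ↦ ?_) ?_
    · have h1 : E (algebraMap (Polynomial R) (Polynomial R') (Polynomial.C r)) = _ :=
        IsLocalization.ringEquivOfRingEquiv_eq H _
      simp only [RingHom.comp_apply, RingHom.coe_coe, h1]
      simp [e, hφ, Polynomial.algebraMap_def]
    · have h1 : E (algebraMap (Polynomial R) (Polynomial R') Polynomial.X) = _ :=
        IsLocalization.ringEquivOfRingEquiv_eq H _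
      simp only [RingHom.comp_apply, RingHom.coe_coe, h1]
      simp [e, Polynomial.algebraMap_def]
  rw [this]
  exact E.bijective

/-- A presentation of `P` over the open set `V` of `B` as a projective line: two affine lines over
`V` with coordinates `z` and `w`, glued along `z w = 1`. -/
structure Chart {P B : Scheme.{0}} (c : P ⟶ B) (V : B.Opens) where
  affine : IsAffineOpen V
  U₀ : P.Opens
  U₁ : P.Opens
  affine₀ : IsAffineOpen U₀
  affine₁ : IsAffineOpen U₁
  sup_eq : U₀ ⊔ U₁ = c ⁻¹ᵁ V
  z : Γ(P, U₀)
  w : Γ(P, U₁)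
  basicOpen_z : P.basicOpen z = U₀ ⊓ U₁
  basicOpen_w : P.basicOpen w = U₀ ⊓ U₁
  mul_eq_one : ∀ (W : P.Opens) (h₀ : W ≤ U₀) (h₁ : W ≤ U₁), ores P h₀ z * ores P h₁ w = 1
  bijective₀ : Function.Bijective
    (Polynomial.eval₂RingHom (c.appLE V U₀ (le_sup_left.trans_eq sup_eq)).hom z)
  bijective₁ : Function.Bijective
    (Polynomial.eval₂RingHom (c.appLE V U₁ (le_sup_right.trans_eq sup_eq)).hom w)

namespace Chart

variable {P B : Scheme.{0}} {c : P ⟶ B} {V : B.Opens} (χ : Chart c V)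

lemma le₀ : χ.U₀ ≤ c ⁻¹ᵁ V := le_sup_left.trans_eq χ.sup_eq

lemma le₁ : χ.U₁ ≤ c ⁻¹ᵁ V := le_sup_right.trans_eq χ.sup_eq

/-- Exchange of the two affine lines. -/
def swap : Chart c V where
  affine := χ.affine
  U₀ := χ.U₁
  U₁ := χ.U₀
  affine₀ := χ.affine₁
  affine₁ := χ.affine₀
  sup_eq := by rw [sup_comm, χ.sup_eq]
  z := χ.w
  w := χ.z
  basicOpen_z := by rw [inf_comm, χ.basicOpen_w]
  basicOpen_w := by rw [inf_comm, χ.basicOpen_z]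
  mul_eq_one W h₀ h₁ := by rw [mul_comm, χ.mul_eq_one W h₁ h₀]
  bijective₀ := χ.bijective₁
  bijective₁ := χ.bijective₀

lemma shrink_bijective {U : P.Opens} (hV : IsAffineOpen V) (hU : IsAffineOpen U) (h : U ≤ c ⁻¹ᵁ V)
    (f : Γ(B, V)) (z : Γ(P, U))
    (hz : Function.Bijective (Polynomial.eval₂RingHom (c.appLE V U h).hom z))
    (hb : U ⊓ c ⁻¹ᵁ B.basicOpen f = P.basicOpen (c.appLE V U h f)) :
    Function.Bijective (Polynomial.eval₂RingHom
      (c.appLE (B.basicOpen f) (U ⊓ c ⁻¹ᵁ B.basicOpen f) inf_le_right).hom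
      (ores P inf_le_left z)) := by
  have key : ∀ (W : P.Opens) (hW : W = P.basicOpen (c.appLE V U h f)) (h1 : W ≤ U)
      (h2 : W ≤ c ⁻¹ᵁ B.basicOpen f), Function.Bijective (Polynomial.eval₂RingHom
      (c.appLE (B.basicOpen f) W h2).hom (ores P h1 z)) := by
    rintro W rfl h1 h2
    have i1 := hV.isLocalization_basicOpen f
    have i2 := hU.isLocalization_basicOpen (c.appLE V U h f)
    refine eval₂_bijective_of_isLocalization (c.appLE V U h).hom _ (fun r ↦ ?_) f z hz
    have := congr($(c.map_appLE h2 (homOfLE (B.basicOpen_le f)).op) r)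
    refine this.trans ?_
    exact (congr($(c.appLE_map h (homOfLE h1).op) r)).symm
  exact key _ hb _ _

/-- Restriction of a chart to a principal open set of the base. -/
def shrink (f : Γ(B, V)) : Chart c (B.basicOpen f) where
  affine := χ.affine.basicOpen f
  U₀ := χ.U₀ ⊓ c ⁻¹ᵁ B.basicOpen f
  U₁ := χ.U₁ ⊓ c ⁻¹ᵁ B.basicOpen f
  affine₀ := by
    have := χ.affine₀.basicOpen (c.appLE V χ.U₀ χ.le₀ f)
    rwa [Scheme.basicOpen_appLE] at this
  affine₁ := by
    have := χ.affine₁.basicOpen (c.appLE V χ.U₁ χ.le₁ f)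
    rwa [Scheme.basicOpen_appLE] at this
  sup_eq := by
    rw [← inf_sup_right, χ.sup_eq, inf_eq_right]
    exact c.preimage_mono (B.basicOpen_le f)
  z := ores P inf_le_left χ.z
  w := ores P inf_le_left χ.w
  basicOpen_z := by
    refine (P.basicOpen_res _ _).trans ?_
    rw [χ.basicOpen_z]
    ext1
    simp only [Opens.coe_inf]
    ext p; simp only [Set.mem_inter_iff]; tauto
  basicOpen_w := by
    refine (P.basicOpen_res _ _).trans ?_
    rw [χ.basicOpen_w]
    ext1
    simp only [Opens.coe_inf]
    ext p; simp only [Set.mem_inter_iff]; tauto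
  mul_eq_one W h₀ h₁ := by
    rw [ores_ores, ores_ores, χ.mul_eq_one]
  bijective₀ := shrink_bijective χ.affine χ.affine₀ χ.le₀ f _ χ.bijective₀ (by
    rw [Scheme.basicOpen_appLE])
  bijective₁ := shrink_bijective χ.affine χ.affine₁ χ.le₁ f _ χ.bijective₁ (by
    rw [Scheme.basicOpen_appLE])

end Chart

section

open MvPolynomial HomogeneousLocalization

variable (R : CommRingCat.{0})

/-- The homogeneous coordinate ring of the projective line, with its grading. -/
abbrev coordGrading : ℕ → Submodule R (MvPolynomial (Fin 2) R) := homogeneousSubmodule (Fin 2) R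

instance : GradedRing (coordGrading R) := MvPolynomial.gradedAlgebra

lemma X_mem (i : Fin 2) : (X i : MvPolynomial (Fin 2) R) ∈ coordGrading R 1 := isHomogeneous_X R i

/-- The coefficients, as elements of the degree zero part of the localization at `xᵢ`. -/
def awayCoeff (i : Fin 2) : R →+* Away (coordGrading R) (X i) :=
  (fromZeroRingHom (coordGrading R) (Submonoid.powers (X i))).comp
    (algebraMap R (coordGrading R 0))

/-- The coordinate `xⱼ / xᵢ`. -/
def awayCoord (i j : Fin 2) : Away (coordGrading R) (X i) :=
  Away.mk (coordGrading R) (X_mem R i) 1 (X j) (by simpa using X_mem R j)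

lemma val_awayCoord (i j : Fin 2) :
    algebraMap (MvPolynomial (Fin 2) R) (Localization.Away (X i)) (X i) * (awayCoord R i j).val =
    algebraMap (MvPolynomial (Fin 2) R) (Localization.Away (X i)) (X j) := by
  rw [awayCoord, Away.val_mk, Localization.mk_eq_mk']
  refine Eq.trans ?_ (IsLocalization.mk'_spec' (Localization.Away (X i)) (X j)
    (⟨X i ^ 1, 1, rfl⟩ : Submonoid.powers (X i : MvPolynomial (Fin 2) R)))
  simp only [pow_one]

lemma IsHomogeneous_eval₂_mul {σ : Type*} {R S : Type*} [CommSemiring R] [CommSemiring S]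
    {p : MvPolynomial σ R} {n : ℕ} (hp : p.IsHomogeneous n) (f : R →+* S) (g : σ → S) (c : S) :
    p.eval₂ f (fun k ↦ c * g k) = c ^ n * p.eval₂ f g := by
  rw [eval₂_eq, eval₂_eq, Finset.mul_sum]
  refine Finset.sum_congr rfl fun d hd ↦ ?_
  rw [hp.degree_eq_sum_deg_support hd, Finset.prod_congr rfl fun i _ ↦ mul_pow _ _ _,
    Finset.prod_mul_distrib, Finset.prod_pow_eq_pow_sum]
  ring

lemma bijective_awayCoord {i j : Fin 2} (hij : ∀ k, k = i ∨ k = j) (hne : j ≠ i) :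
    Function.Bijective (Polynomial.eval₂RingHom (awayCoeff R i) (awayCoord R i j)) := by
  let L := Localization.Away (X i : MvPolynomial (Fin 2) R)
  let v : Away (coordGrading R) (X i) →+* L := algebraMap _ _
  constructor
  · let ev : MvPolynomial (Fin 2) R →+* Polynomial R :=
      eval₂Hom Polynomial.C fun k ↦ if k = i then 1 else Polynomial.X
    have hev : IsUnit (ev (X i)) := by simp [ev]
    let ψ : L →+* Polynomial R := IsLocalization.Away.lift (X i) hev
    have : (ψ.comp v).comp (Polynomial.eval₂RingHom (awayCoeff R i) (awayCoord R i j)) =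
        RingHom.id _ := by
      refine Polynomial.ringHom_ext (fun r ↦ ?_) ?_
      · simp only [RingHom.comp_apply, Polynomial.coe_eval₂RingHom, Polynomial.eval₂_C]
        refine (IsLocalization.Away.lift_eq (X i) hev (C r)).trans ?_
        simp [ev]
      · simp only [RingHom.comp_apply, Polynomial.coe_eval₂RingHom, Polynomial.eval₂_X]
        have := congrArg ψ (val_awayCoord R i j)
        rw [map_mul, IsLocalization.Away.lift_eq (X i) hev, IsLocalization.Away.lift_eq (X i) hev]
          at this
        have h1 : ev (X i) = 1 := by simp [ev]
        have h2 : ev (X j) = Polynomial.X := by simp [ev, hne]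
        rwa [h1, h2, one_mul] at this
    exact Function.LeftInverse.injective (g := ψ.comp v) fun p ↦ RingHom.congr_fun this p
  · intro y
    obtain ⟨n, x, hx, rfl⟩ := Away.mk_surjective (coordGrading R) (X_mem R i) y
    have hx' : x.IsHomogeneous n := by simpa using hx
    refine ⟨x.eval₂ Polynomial.C fun k ↦ if k = i then 1 else Polynomial.X, ?_⟩
    apply HomogeneousLocalization.val_injective
    rw [Away.val_mk, Localization.mk_eq_mk', IsLocalization.eq_mk'_iff_mul_eq]
    have h1 := IsHomogeneous_eval₂_mul hx' (algebraMap (MvPolynomial (Fin 2) R) L |>.comp C)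
      (fun k ↦ v (if k = i then 1 else awayCoord R i j)) (algebraMap (MvPolynomial (Fin 2) R) L (X i))
    have h2 : (fun k ↦ algebraMap (MvPolynomial (Fin 2) R) L (X i) *
        v (if k = i then 1 else awayCoord R i j)) =
        fun k ↦ algebraMap (MvPolynomial (Fin 2) R) L (X k) := by
      funext k
      rcases hij k with rfl | rfl
      · simp
      · rw [if_neg hne]; exact val_awayCoord R i k
    rw [h2] at h1
    have h3 : eval₂Hom (algebraMap (MvPolynomial (Fin 2) R) L |>.comp C)
        (fun k ↦ algebraMap (MvPolynomial (Fin 2) R) L (X k)) = algebraMap _ L :=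
      MvPolynomial.ringHom_ext (by simp) (by simp)
    have h4 : (v.comp (Polynomial.eval₂RingHom (awayCoeff R i) (awayCoord R i j))).comp
        (eval₂Hom Polynomial.C fun k ↦ if k = i then 1 else Polynomial.X) =
        eval₂Hom (algebraMap (MvPolynomial (Fin 2) R) L |>.comp C)
          (fun k ↦ v (if k = i then 1 else awayCoord R i j)) := by
      refine MvPolynomial.ringHom_ext (fun r ↦ ?_) fun k ↦ ?_
      · simp only [RingHom.comp_apply, coe_eval₂Hom, eval₂_C, Polynomial.coe_eval₂RingHom,
          Polynomial.eval₂_C]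
        rfl
      · simp only [RingHom.comp_apply, coe_eval₂Hom, eval₂_X, Polynomial.coe_eval₂RingHom]
        split_ifs <;> simp
    refine (congrArg (· * _) (RingHom.congr_fun h4 x)).trans ?_
    refine Eq.trans ?_ (RingHom.congr_fun h3 x)
    rw [coe_eval₂Hom, coe_eval₂Hom, h1, mul_comm, map_pow]

/-- The structure morphism of the projective line, with its source spelled out. -/
def projToSpec : Proj (coordGrading R) ⟶ Spec R := projectiveLineToSpec R

lemma ι_projToSpec (i : Fin 2) :
    (Proj.basicOpen (coordGrading R) (X i)).ι ≫ projToSpec R =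
      Proj.basicOpenToSpec (coordGrading R) (X i) ≫ Spec.map (CommRingCat.ofHom (awayCoeff R i)) := by
  have h := Proj.awayι_toSpecZero (coordGrading R) (X i) (X_mem R i) one_pos
  rw [← Proj.basicOpenIsoSpec_inv_ι, Category.assoc, Iso.inv_comp_eq, Proj.basicOpenIsoSpec_hom] at h
  refine (Category.assoc _ _ _).symm.trans ((congrArg (· ≫ _) h).trans ?_)
  rw [Category.assoc, ← Spec.map_comp]
  rfl

lemma appLE_projToSpec (i : Fin 2)
    (h : Proj.basicOpen (coordGrading R) (X i) ≤ projToSpec R ⁻¹ᵁ ⊤) :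
    (projToSpec R).appLE ⊤ (Proj.basicOpen (coordGrading R) (X i)) h =
      (Scheme.ΓSpecIso R).hom ≫ CommRingCat.ofHom (awayCoeff R i) ≫
        Proj.awayToSection (coordGrading R) (X i) := by
  have h1 := congrArg (fun f ↦ Scheme.Hom.appTop f ≫ (Proj.basicOpen (coordGrading R) (X i)).topIso.hom)
    (ι_projToSpec R i)
  have h2 : Scheme.Hom.appTop (Proj.basicOpenToSpec (coordGrading R) (X i)) = _ :=
    Proj.basicOpenToSpec_app_top (coordGrading R) (X i)
  simp only [Scheme.Hom.comp_appTop, h2, Category.assoc, Iso.inv_hom_id, Category.comp_id] at h1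
  rw [Scheme.ΓSpecIso_naturality_assoc] at h1
  refine Eq.trans ?_ h1
  rw [Scheme.Hom.appLE]
  congr 1

lemma basicOpen_awayCoord (i j : Fin 2) :
    (Proj (coordGrading R)).basicOpen (Proj.awayToSection (coordGrading R) (X i) (awayCoord R i j)) =
      Proj.basicOpen (coordGrading R) (X i) ⊓ Proj.basicOpen (coordGrading R) (X j) := by
  set U := Proj.basicOpen (coordGrading R) (X i)
  have h := Proj.awayι_preimage_basicOpen (coordGrading R) (X_mem R i) one_pos (X_mem R j) one_pos
  have e : Away.isLocalizationElem (X_mem R i) (X_mem R j) = awayCoord R i j := by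
    apply HomogeneousLocalization.val_injective
    rw [awayCoord, Away.val_mk, Away.val_mk, pow_one]
  rw [e] at h
  have h1 : Proj.basicOpenToSpec (coordGrading R) (X i) ⁻¹ᵁ _ =
      Proj.basicOpenToSpec (coordGrading R) (X i) ⁻¹ᵁ _ := congrArg _ h
  rw [← Scheme.Hom.comp_preimage, ← Proj.basicOpenIsoSpec_inv_ι,
    ← Proj.basicOpenIsoSpec_hom _ _ (X_mem R i) one_pos, Iso.hom_inv_id_assoc,
    Proj.basicOpenIsoSpec_hom] at h1
  have h2 : Proj.basicOpenToSpec (coordGrading R) (X i) ⁻¹ᵁ PrimeSpectrum.basicOpen (awayCoord R i j)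
      = _ := congrArg _ (basicOpen_eq_of_affine (R := .of (Away (coordGrading R) (X i)))
        (awayCoord R i j)).symm
  rw [← Scheme.Opens.ι_image_basicOpen_topIso_inv, ← image_preimage_eq, h1, h2,
    Scheme.preimage_basicOpen]
  congr 2
  have h3 := congr($(Proj.basicOpenToSpec_app_top (coordGrading R) (X i))
    ((Scheme.ΓSpecIso _).inv (awayCoord R i j)))
  refine Eq.trans ?_ h3.symm
  simp
  rfl

lemma awayCoord_mul (i j : Fin 2) (W : (Proj (coordGrading R)).Opens)
    (h₀ : W ≤ Proj.basicOpen (coordGrading R) (X i))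
    (h₁ : W ≤ Proj.basicOpen (coordGrading R) (X j)) :
    ores (Proj (coordGrading R)) h₀ (Proj.awayToSection (coordGrading R) (X i) (awayCoord R i j)) *
      ores (Proj (coordGrading R)) h₁ (Proj.awayToSection (coordGrading R) (X j) (awayCoord R j i)) =
        1 := by
  have hW : W ≤ Proj.basicOpen (coordGrading R) (X i * X j) := by
    rw [Proj.basicOpen_mul]; exact le_inf h₀ h₁
  have e0 := congr($(Proj.awayMap_awayToSection (coordGrading R) (f := X i) (X_mem R j) rfl)
    (awayCoord R i j))
  have e1 := congr($(Proj.awayMap_awayToSection (coordGrading R) (f := X j) (X_mem R i)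
    (mul_comm (X i) (X j))) (awayCoord R j i))
  have e2 : awayMap (coordGrading R) (X_mem R j) rfl (awayCoord R i j) *
      awayMap (coordGrading R) (X_mem R i) (mul_comm (X i) (X j)) (awayCoord R j i) = 1 := by
    apply HomogeneousLocalization.val_injective
    rw [val_mul, val_one, awayCoord, awayCoord, Away.mk, Away.mk, val_awayMap_mk, val_awayMap_mk,
      Localization.mk_mul, ← Localization.mk_one, Localization.mk_eq_mk_iff]
    refine Localization.r_of_eq ?_
    simp
    ring
  have e3 := congrArg (fun x ↦ ores (Proj (coordGrading R)) hW
    (Proj.awayToSection (coordGrading R) _ x)) e2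
  simp only [map_mul, map_one] at e3
  refine Eq.trans ?_ e3
  congr 1
  · refine Eq.trans ?_ (congrArg (ores (Proj (coordGrading R)) hW) e0).symm
    exact (ores_ores _ _ _).symm
  · refine Eq.trans ?_ (congrArg (ores (Proj (coordGrading R)) hW) e1).symm
    exact (ores_ores _ _ _).symm

lemma stdChart_bijective {i j : Fin 2} (hij : ∀ k, k = i ∨ k = j) (hne : j ≠ i)
    (h : Proj.basicOpen (coordGrading R) (X i) ≤ projToSpec R ⁻¹ᵁ ⊤) :
    Function.Bijective (Polynomial.eval₂RingHom
      ((projToSpec R).appLE ⊤ (Proj.basicOpen (coordGrading R) (X i)) h).hom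
      (Proj.awayToSection (coordGrading R) (X i) (awayCoord R i j))) := by
  let e := (Scheme.ΓSpecIso R).commRingCatIsoToRingEquiv
  let e' := (Proj.basicOpenIsoAway (coordGrading R) (X i) (X_mem R i) one_pos).commRingCatIsoToRingEquiv
  have h1 : Polynomial.eval₂RingHom
      ((projToSpec R).appLE ⊤ (Proj.basicOpen (coordGrading R) (X i)) h).hom
      (Proj.awayToSection (coordGrading R) (X i) (awayCoord R i j)) =
      ((e' : _ →+* _).comp (Polynomial.eval₂RingHom (awayCoeff R i) (awayCoord R i j))).comp
        (Polynomial.mapEquiv e : _ →+* _) := by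
    refine Polynomial.ringHom_ext (fun r ↦ ?_) ?_
    · rw [appLE_projToSpec]
      simp [e, e']
      rfl
    · simp [e, e']
      rfl
  rw [h1]
  exact (e'.bijective.comp (bijective_awayCoord R hij hne)).comp (Polynomial.mapEquiv e).bijective

/-- The standard chart of the projective line over an affine base. -/
def stdChart : Chart (projToSpec R) ⊤ where
  affine := isAffineOpen_top _
  U₀ := Proj.basicOpen (coordGrading R) (X 0)
  U₁ := Proj.basicOpen (coordGrading R) (X 1)
  affine₀ := Proj.isAffineOpen_basicOpen _ _ (X_mem R 0) one_pos
  affine₁ := Proj.isAffineOpen_basicOpen _ _ (X_mem R 1) one_pos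
  sup_eq := by
    have h := Proj.iSup_basicOpen_eq_top' (coordGrading R) (fun i : Fin 2 ↦ X i)
      (fun i ↦ ⟨1, X_mem R i⟩) (by
        refine top_le_iff.1 fun p _ ↦ ?_
        induction p using MvPolynomial.induction_on with
        | C r => exact Subalgebra.algebraMap_mem _ (algebraMap R (coordGrading R 0) r)
        | add p q hp hq => exact add_mem (hp trivial) (hq trivial)
        | mul_X p i hp => exact mul_mem (hp trivial) (Algebra.subset_adjoin ⟨i, rfl⟩))
    refine Eq.trans ?_ h
    refine le_antisymm (sup_le (le_iSup (fun i : Fin 2 ↦ Proj.basicOpen (coordGrading R) (X i)) 0)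
      (le_iSup (fun i : Fin 2 ↦ Proj.basicOpen (coordGrading R) (X i)) 1)) (iSup_le fun i ↦ ?_)
    fin_cases i
    · exact le_sup_left
    · exact le_sup_right
  z := Proj.awayToSection (coordGrading R) (X 0) (awayCoord R 0 1)
  w := Proj.awayToSection (coordGrading R) (X 1) (awayCoord R 1 0)
  basicOpen_z := basicOpen_awayCoord R 0 1
  basicOpen_w := (basicOpen_awayCoord R 1 0).trans (inf_comm _ _)
  mul_eq_one := awayCoord_mul R 0 1
  bijective₀ := stdChart_bijective R (by decide) (by decide) _
  bijective₁ := stdChart_bijective R (by decide) (by decide) _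

end

lemma image_inf {X Y : Scheme.{0}} (t : X ⟶ Y) [IsOpenImmersion t] (U U' : X.Opens) :
    t ''ᵁ (U ⊓ U') = t ''ᵁ U ⊓ t ''ᵁ U' := by
  ext1
  exact Set.image_inter t.isOpenEmbedding.injective

lemma appIso_inv_ores {X Y : Scheme.{0}} (t : X ⟶ Y) [IsOpenImmersion t] {U U' : X.Opens}
    (h : U' ≤ U) (h' : t ''ᵁ U' ≤ t ''ᵁ U) (a : Γ(X, U)) :
    ores Y h' ((t.appIso U).inv a) = (t.appIso U').inv (ores X h a) :=
  (congr($(t.appIso_inv_naturality (homOfLE h).op) a)).symm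

lemma chart_bijective_of_isPullback {P P' B B' : Scheme.{0}} {c : P ⟶ B} {c' : P' ⟶ B'} {t : P' ⟶ P}
    {j : B' ⟶ B} [IsOpenImmersion j] [IsOpenImmersion t] (e : t ≫ c = c' ≫ j) {U : P'.Opens}
    (h : U ≤ c' ⁻¹ᵁ ⊤) (h' : t ''ᵁ U ≤ c ⁻¹ᵁ j ''ᵁ ⊤) (z : Γ(P', U))
    (hz : Function.Bijective (Polynomial.eval₂RingHom (c'.appLE ⊤ U h).hom z)) :
    Function.Bijective (Polynomial.eval₂RingHom (c.appLE (j ''ᵁ ⊤) (t ''ᵁ U) h').hom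
      ((t.appIso U).inv z)) := by
  have h1 : c.appLE (j ''ᵁ ⊤) (t ''ᵁ U) h' =
      (j.appIso ⊤).hom ≫ c'.appLE ⊤ U h ≫ (t.appIso U).inv := by
    rw [← Category.assoc, Iso.eq_comp_inv, Scheme.Hom.appIso_hom', Scheme.Hom.appIso_hom',
      Scheme.Hom.appLE_comp_appLE, Scheme.Hom.appLE_comp_appLE]
    congr 1
  let e₁ := (j.appIso ⊤).commRingCatIsoToRingEquiv
  let e₂ := (t.appIso U).symm.commRingCatIsoToRingEquiv
  have h2 : Polynomial.eval₂RingHom (c.appLE (j ''ᵁ ⊤) (t ''ᵁ U) h').hom ((t.appIso U).inv z) =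
      ((e₂ : _ →+* _).comp (Polynomial.eval₂RingHom (c'.appLE ⊤ U h).hom z)).comp
        (Polynomial.mapEquiv e₁ : _ →+* _) := by
    refine Polynomial.ringHom_ext (fun r ↦ ?_) ?_
    · rw [h1]
      simp [e₁, e₂]
    · simp [e₁, e₂]
  rw [h2]
  exact (e₂.bijective.comp hz).comp (Polynomial.mapEquiv e₁).bijective

/-- Transport of a chart along a base change to an open subscheme. -/
def Chart.ofIsPullback {P P' B B' : Scheme.{0}} {c : P ⟶ B} {c' : P' ⟶ B'} {t : P' ⟶ P}
    {j : B' ⟶ B} [IsOpenImmersion j] [IsOpenImmersion t] (h : IsPullback t c' c j)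
    (χ : Chart c' ⊤) : Chart c (j ''ᵁ ⊤) where
  affine := χ.affine.image_of_isOpenImmersion j
  U₀ := t ''ᵁ χ.U₀
  U₁ := t ''ᵁ χ.U₁
  affine₀ := χ.affine₀.image_of_isOpenImmersion t
  affine₁ := χ.affine₁.image_of_isOpenImmersion t
  sup_eq := by
    have h1 : t ''ᵁ χ.U₀ ⊔ t ''ᵁ χ.U₁ = t ''ᵁ (χ.U₀ ⊔ χ.U₁) := by
      ext1; simp [Set.image_union]
    rw [h1, χ.sup_eq]
    exact IsOpenImmersion.image_preimage_eq_preimage_image_of_isPullback h.flip ⊤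
  z := (t.appIso χ.U₀).inv χ.z
  w := (t.appIso χ.U₁).inv χ.w
  basicOpen_z := by rw [← Scheme.image_basicOpen, χ.basicOpen_z, image_inf]
  basicOpen_w := by rw [← Scheme.image_basicOpen, χ.basicOpen_w, image_inf]
  mul_eq_one W h₀ h₁ := by
    obtain ⟨W, rfl⟩ : ∃ W', W = t ''ᵁ W' :=
      ⟨t ⁻¹ᵁ W, by
        rw [t.image_preimage_eq_opensRange_inf, right_eq_inf]
        exact h₀.trans (t.image_le_opensRange _)⟩
    have h₀' : W ≤ χ.U₀ := by simpa using t.preimage_mono h₀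
    have h₁' : W ≤ χ.U₁ := by simpa using t.preimage_mono h₁
    rw [appIso_inv_ores t h₀', appIso_inv_ores t h₁', ← map_mul, χ.mul_eq_one, map_one]
  bijective₀ := chart_bijective_of_isPullback h.w _ _ _ χ.bijective₀
  bijective₁ := chart_bijective_of_isPullback h.w _ _ _ χ.bijective₁

lemma IsProjectiveLineBundle.exists_chart {P B : Scheme.{0}} {c : P ⟶ B}
    (hc : IsProjectiveLineBundle c) (b : B) (V : B.Opens) (hb : b ∈ V) :
    ∃ (V' : B.Opens) (_ : V' ≤ V), b ∈ V' ∧ Nonempty (Chart c V') := by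
  obtain ⟨R, j, t, hj, hbj, h⟩ := hc b
  have ht : IsOpenImmersion t := MorphismProperty.of_isPullback h.flip hj
  let χ : Chart c (j ''ᵁ ⊤) := Chart.ofIsPullback h (stdChart R)
  have hb' : b ∈ j ''ᵁ ⊤ := by
    obtain ⟨y, rfl⟩ := hbj
    exact ⟨y, trivial, rfl⟩
  obtain ⟨f, hf, hbf⟩ := χ.affine.exists_basicOpen_le ⟨b, hb⟩ hb'
  exact ⟨_, hf, hbf, ⟨χ.shrink f⟩⟩

/-! ### Derivations on affine open sets -/

lemma ores_glue {C : Scheme.{0}} {ι : Type} {U : C.Opens} (V : ι → C.Opens) (hV : ∀ i, V i ≤ U)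
    (hU : U ≤ iSup V) (x : ∀ i, Γ(C, V i))
    (hx : ∀ i j, ores C (inf_le_left : V i ⊓ V j ≤ V i) (x i) = ores C inf_le_right (x j)) :
    ∃ y : Γ(C, U), ∀ i, ores C (hV i) y = x i :=
  (TopCat.Sheaf.existsUnique_gluing' C.sheaf V U (fun i ↦ homOfLE (hV i)) hU x hx).exists

section

variable {P : Scheme.{0}} {U : P.Opens}

lemma exists_ores_eq_of_basicOpen (hU : IsAffineOpen U) (g : Γ(P, U)) (a : Γ(P, P.basicOpen g)) :
    ∃ (n : ℕ) (p : Γ(P, U)), ores P (P.basicOpen_le g) (g ^ n) * a = ores P (P.basicOpen_le g) p := by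
  have := hU.isLocalization_basicOpen g
  obtain ⟨⟨p, ⟨_, n, rfl⟩⟩, h⟩ := IsLocalization.surj (Submonoid.powers g) a
  exact ⟨n, p, (mul_comm _ _).trans h⟩

lemma exists_pow_mul_eq_zero (hU : IsAffineOpen U) (g : Γ(P, U)) {x : Γ(P, U)}
    (hx : ores P (P.basicOpen_le g) x = 0) : ∃ n : ℕ, g ^ n * x = 0 := by
  have := hU.isLocalization_basicOpen g
  obtain ⟨⟨_, n, rfl⟩, h⟩ := (IsLocalization.map_eq_zero_iff (Submonoid.powers g)
    Γ(P, P.basicOpen g) x).1 hx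
  exact ⟨n, h⟩

lemma isUnit_ores_basicOpen (g : Γ(P, U)) : IsUnit (ores P (P.basicOpen_le g) g) :=
  P.toRingedSpace.isUnit_res_basicOpen g

lemma exists_basicOpen (hU : IsAffineOpen U) {W : P.Opens} (hW : W ≤ U) {x : P} (hx : x ∈ W) :
    ∃ g : Γ(P, U), P.basicOpen g ≤ W ∧ x ∈ P.basicOpen g :=
  hU.exists_basicOpen_le ⟨x, hx⟩ (hW hx)

/-- Locally, a function is a fraction of functions on a given affine open set. -/
lemma exists_local_fraction (hU : IsAffineOpen U) {W : P.Opens} (hW : W ≤ U) (a : Γ(P, W)) {x : P}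
    (hx : x ∈ W) : ∃ (W' : P.Opens) (h : W' ≤ W), x ∈ W' ∧ ∃ p q : Γ(P, U),
      IsUnit (ores P (h.trans hW) q) ∧ ores P (h.trans hW) q * ores P h a = ores P (h.trans hW) p := by
  obtain ⟨g, hg, hxg⟩ := exists_basicOpen hU hW hx
  obtain ⟨n, p, h⟩ := exists_ores_eq_of_basicOpen hU g (ores P hg a)
  refine ⟨_, hg, hxg, p, g ^ n, ?_, h⟩
  rw [map_pow]
  exact (isUnit_ores_basicOpen g).pow n

variable (δ : Derivation ℤ Γ(P, U) Γ(P, U))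

lemma ores_derivation_eq_zero (hU : IsAffineOpen U) {W : P.Opens} (hW : W ≤ U) {x : Γ(P, U)}
    (hx : ores P hW x = 0) : ores P hW (δ x) = 0 := by
  refine ores_ext fun y hy ↦ ?_
  obtain ⟨g, hg, hyg⟩ := exists_basicOpen hU hW hy
  refine ⟨_, hg, hyg, ?_⟩
  have hx' : ores P (P.basicOpen_le g) x = 0 := by
    rw [← ores_ores hW hg, hx, map_zero]
  obtain ⟨n, hn⟩ := exists_pow_mul_eq_zero hU g hx'
  have h1 := congrArg (ores P (P.basicOpen_le g)) (congrArg δ hn)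
  rw [δ.leibniz, map_zero, map_add, smul_eq_mul, smul_eq_mul, map_mul, map_mul, hx', zero_mul,
    add_zero, map_zero, map_pow] at h1
  rw [ores_ores, map_zero]
  exact ((isUnit_ores_basicOpen g).pow n).mul_right_eq_zero.1 h1

/-- The relation `b = δ a` for functions `a` and `b` on an open set inside `U`: the quotient rule
holds for all presentations of `a` as a fraction. -/
def IsDerivative {W : P.Opens} (hW : W ≤ U) (a b : Γ(P, W)) : Prop :=
  ∀ (W' : P.Opens) (h : W' ≤ W) (p q : Γ(P, U)),
    ores P (h.trans hW) q * ores P h a = ores P (h.trans hW) p →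
    ores P (h.trans hW) q * ores P h b + ores P (h.trans hW) (δ q) * ores P h a =
      ores P (h.trans hW) (δ p)

variable {δ} {W W' : P.Opens}

lemma IsDerivative.restrict {hW : W ≤ U} {a b : Γ(P, W)} (h : IsDerivative δ hW a b) (h' : W' ≤ W) :
    IsDerivative δ (h'.trans hW) (ores P h' a) (ores P h' b) := fun W'' h'' p q e ↦ by
  rw [ores_ores] at e
  have := h W'' (h''.trans h') p q e
  rwa [ores_ores, ores_ores]

lemma IsDerivative.unique (hU : IsAffineOpen U) {hW : W ≤ U} {a b b' : Γ(P, W)}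
    (h : IsDerivative δ hW a b) (h' : IsDerivative δ hW a b') : b = b' := by
  refine ores_ext fun x hx ↦ ?_
  obtain ⟨W', hW', hxW', p, q, hq, e⟩ := exists_local_fraction hU hW a hx
  refine ⟨W', hW', hxW', ?_⟩
  have := (h W' hW' p q e).trans (h' W' hW' p q e).symm
  exact hq.mul_left_cancel (add_right_cancel this)

lemma IsDerivative.of_fraction (hU : IsAffineOpen U) {hW : W ≤ U} {a b : Γ(P, W)} (p q : Γ(P, U))
    (hq : IsUnit (ores P hW q)) (e : ores P hW q * a = ores P hW p)
    (e' : ores P hW q * b + ores P hW (δ q) * a = ores P hW (δ p)) :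
    IsDerivative δ hW a b := by
  intro W' h p₂ q₂ e₂
  replace e := congrArg (ores P h) e
  replace e' := congrArg (ores P h) e'
  replace hq := hq.map (ores P h)
  simp only [map_mul, map_add, ores_ores] at e e' hq
  have h1 : ores P (h.trans hW) (q₂ * p - q * p₂) = 0 := by
    rw [map_sub, map_mul, map_mul, ← e, ← e₂]; ring
  have h2 := ores_derivation_eq_zero δ hU (h.trans hW) h1
  rw [map_sub, δ.leibniz, δ.leibniz] at h2
  simp only [smul_eq_mul, map_sub, map_add, map_mul] at h2
  refine hq.mul_left_cancel ?_
  rw [← e, ← e₂] at h2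
  linear_combination ores P (h.trans hW) q₂ * e' + h2

lemma IsDerivative.of_local {hW : W ≤ U} {a b : Γ(P, W)}
    (h : ∀ x ∈ W, ∃ (W' : P.Opens) (h' : W' ≤ W), x ∈ W' ∧
      IsDerivative δ (h'.trans hW) (ores P h' a) (ores P h' b)) :
    IsDerivative δ hW a b := by
  intro W' hW' p q e
  refine ores_ext fun x hx ↦ ?_
  obtain ⟨W₁, h₁, hx₁, H⟩ := h x (hW' hx)
  refine ⟨W' ⊓ W₁, inf_le_left, ⟨hx, hx₁⟩, ?_⟩
  replace e := congrArg (ores P (inf_le_left : W' ⊓ W₁ ≤ W')) e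
  have := H (W' ⊓ W₁) inf_le_right p q (by simpa using e)
  simpa using this

lemma exists_isDerivative (hU : IsAffineOpen U) (hW : W ≤ U) (a : Γ(P, W)) :
    ∃ b, IsDerivative δ hW a b := by
  have H : ∀ x : W, ∃ (W' : P.Opens) (h : W' ≤ W) (b : Γ(P, W')), x.1 ∈ W' ∧
      IsDerivative δ (h.trans hW) (ores P h a) b := by
    intro x
    obtain ⟨W', h, hxW, p, q, hq, e⟩ := exists_local_fraction hU hW a x.2
    obtain ⟨i, hi⟩ := hq.exists_right_inv
    refine ⟨W', h, i * (ores P (h.trans hW) (δ p) -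
      ores P (h.trans hW) (δ q) * ores P h a), hxW,
      IsDerivative.of_fraction hU p q hq e ?_⟩
    rw [← mul_assoc, hi]; ring
  choose V hV b hxV hb using H
  obtain ⟨y, hy⟩ := ores_glue V hV (fun x hx ↦ Opens.mem_iSup.2 ⟨⟨x, hx⟩, hxV _⟩) b fun i j ↦ by
    have h1 := (hb i).restrict (inf_le_left : V i ⊓ V j ≤ V i)
    have h2 := (hb j).restrict (inf_le_right : V i ⊓ V j ≤ V j)
    rw [ores_ores] at h1 h2
    exact h1.unique hU h2
  refine ⟨y, IsDerivative.of_local fun x hx ↦ ⟨V ⟨x, hx⟩, hV _, hxV _, ?_⟩⟩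
  rw [hy]
  exact hb _

lemma IsDerivative.add (hU : IsAffineOpen U) {hW : W ≤ U} {a b a' b' : Γ(P, W)}
    (h : IsDerivative δ hW a b) (h' : IsDerivative δ hW a' b') :
    IsDerivative δ hW (a + a') (b + b') := by
  refine .of_local fun x hx ↦ ?_
  obtain ⟨W₁, h₁, hx₁, p, q, hq, e⟩ := exists_local_fraction hU hW a hx
  obtain ⟨W₂, h₂, hx₂, p', q', hq', e'⟩ := exists_local_fraction hU (h₁.trans hW)
    (ores P h₁ a') hx₁
  rw [ores_ores] at e'
  replace e := congrArg (ores P h₂) e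
  replace hq := hq.map (ores P h₂)
  simp only [map_mul, ores_ores] at e hq
  have k := h W₂ (h₂.trans h₁) p q e
  have k' := h' W₂ (h₂.trans h₁) p' q' e'
  refine ⟨W₂, h₂.trans h₁, hx₂, .of_fraction hU (q' * p + q * p') (q * q') ?_ ?_ ?_⟩
  · rw [map_mul]; exact hq.mul hq'
  · simp only [map_mul, map_add]
    linear_combination ores P _ q' * e + ores P _ q * e'
  · simp only [map_add, δ.leibniz, smul_eq_mul, map_mul]
    linear_combination ores P _ q' * k + ores P _ q * k' +
      ores P _ (δ q') * e + ores P _ (δ q) * e'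

lemma IsDerivative.mul (hU : IsAffineOpen U) {hW : W ≤ U} {a b a' b' : Γ(P, W)}
    (h : IsDerivative δ hW a b) (h' : IsDerivative δ hW a' b') :
    IsDerivative δ hW (a * a') (a * b' + a' * b) := by
  refine .of_local fun x hx ↦ ?_
  obtain ⟨W₁, h₁, hx₁, p, q, hq, e⟩ := exists_local_fraction hU hW a hx
  obtain ⟨W₂, h₂, hx₂, p', q', hq', e'⟩ := exists_local_fraction hU (h₁.trans hW)
    (ores P h₁ a') hx₁
  rw [ores_ores] at e'
  replace e := congrArg (ores P h₂) e
  replace hq := hq.map (ores P h₂)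
  simp only [map_mul, ores_ores] at e hq
  have k := h W₂ (h₂.trans h₁) p q e
  have k' := h' W₂ (h₂.trans h₁) p' q' e'
  refine ⟨W₂, h₂.trans h₁, hx₂, .of_fraction hU (p * p') (q * q') ?_ ?_ ?_⟩
  · rw [map_mul]; exact hq.mul hq'
  · simp only [map_mul, ← e, ← e']
    ring
  · simp only [map_add, δ.leibniz, smul_eq_mul, map_mul, ← e, ← e', ← k, ← k']
    ring

/-- A derivation of the ring of functions on an affine open set `U` which vanishes on functions
from the base extends to a derivation over `U` of the structure sheaf. -/
lemma exists_derivationAlong {B : Scheme.{0}} {c : P ⟶ B} {V : B.Opens} (hV : IsAffineOpen V)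
    (hU : IsAffineOpen U) (h : U ≤ c ⁻¹ᵁ V) (δ : Derivation ℤ Γ(P, U) Γ(P, U))
    (hδ : ∀ r, δ (c.appLE V U h r) = 0) :
    ∃ D : DerivationAlong (𝟙 P) c U, ∀ a, D.toFun U U le_rfl (le_id_preimage U) a = δ a := by
  choose d hd using fun (W : P.Opens) (hW : W ≤ U) (a : Γ(P, W)) ↦ exists_isDerivative (δ := δ) hU hW a
  have d_res : ∀ (W W' : P.Opens) (hW : W ≤ U) (hW' : W' ≤ W) (a : Γ(P, W)),
      d W' (hW'.trans hW) (ores P hW' a) = ores P hW' (d W hW a) := fun W W' hW hW' a ↦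
    (hd _ _ _).unique hU ((hd W hW a).restrict hW')
  refine ⟨{ toFun V W hU hV a := d W hU (ores P (U := V) hV a), map_add := ?_, leibniz := ?_,
            map_base := ?_, map_res := ?_ }, ?_⟩
  · intro V W hWU hV a b
    rw [_root_.map_add (ores P (U := V) hV)]
    exact (hd _ _ _).unique hU ((hd _ _ _).add hU (hd _ _ _))
  · intro V W hWU hV a b
    rw [_root_.map_mul (ores P (U := V) hV)]
    exact (hd _ _ _).unique hU ((hd _ _ _).mul hU (hd _ _ _))
  · intro O V' W hWU hV' hO y
    have hWO : W ≤ c ⁻¹ᵁ O := hV'.trans hO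
    have e : ores P (U := V') hV' (c.appLE O V' hO y) = c.appLE O W hWO y :=
      congr($(c.appLE_map hO (homOfLE hV').op) y)
    refine (hd _ _ _).unique hU (.of_local fun x hx ↦ ?_)
    obtain ⟨f, hf, hxf⟩ := hV.exists_basicOpen_le ⟨c x, hWO hx⟩ (h (hWU hx))
    obtain ⟨n, r, hr⟩ := exists_ores_eq_of_basicOpen hV f (ores B hf y)
    have hf' : W ⊓ c ⁻¹ᵁ B.basicOpen f ≤ c ⁻¹ᵁ B.basicOpen f := inf_le_right
    have app : ∀ s : Γ(B, V), ores P (inf_le_left.trans hWU) (c.appLE V U h s) =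
        c.appLE (B.basicOpen f) _ hf' (ores B (B.basicOpen_le f) s) := fun s ↦
      (congr($(c.appLE_map h (homOfLE (inf_le_left.trans hWU)).op) s)).trans
        (congr($(c.map_appLE hf' (homOfLE (B.basicOpen_le f)).op) s)).symm
    refine ⟨W ⊓ c ⁻¹ᵁ B.basicOpen f, inf_le_left, ⟨hx, hxf⟩,
      .of_fraction hU (c.appLE V U h r) (c.appLE V U h (f ^ n)) ?_ ?_ ?_⟩
    · rw [app, map_pow]
      exact ((isUnit_ores_basicOpen f).pow n).map (c.appLE _ _ hf').hom
    · rw [app, app, e]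
      have : ores P (inf_le_left : W ⊓ c ⁻¹ᵁ B.basicOpen f ≤ W) (c.appLE O W hWO y) =
          c.appLE (B.basicOpen f) _ hf' (ores B hf y) :=
        (congr($(c.appLE_map hWO (homOfLE inf_le_left).op) y)).trans
        (congr($(c.map_appLE hf' (homOfLE hf).op) y)).symm
      rw [this, ← map_mul, hr]
    · rw [hδ, hδ]
      simp
  · intro V V' W W' hV hW hU' hf hf' a
    have e : ores P (U := V') hf' (ores P hV a) = ores P hW (ores P (U := V) hf a) :=
      (ores_ores _ _ _).trans (ores_ores _ _ _).symm
    exact (congrArg _ e).trans (d_res _ _ _ _ _)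
  · intro a
    have e : ores P (U := U) (le_id_preimage U) a = a := ores_self _ _
    refine (congrArg _ e).trans ?_
    have := hd U le_rfl a U le_rfl a 1 (by simp)
    simpa using this

end

/-! ### The pairing of a spinor bundle with values in vector fields -/

namespace DerivationAlong

variable {P B : Scheme.{0}} {c : P ⟶ B} {U W W' : P.Opens} (D : DerivationAlong (𝟙 P) c U)

/-- The action of a vector field on functions. -/
def apply (hW : W ≤ U) (a : Γ(P, W)) : Γ(P, W) := D.toFun W W hW (le_id_preimage W) a

lemma apply_add (hW : W ≤ U) (a b : Γ(P, W)) :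
    D.apply hW (a + b) = D.apply hW a + D.apply hW b := D.map_add _ _ _ _ _ _

lemma appLE_id (a : Γ(P, W)) : (𝟙 P : P ⟶ P).appLE W W (le_id_preimage W) a = a :=
  map_rfl_apply P a

lemma apply_mul (hW : W ≤ U) (a b : Γ(P, W)) :
    D.apply hW (a * b) = a * D.apply hW b + b * D.apply hW a := by
  have := D.leibniz W W hW (le_id_preimage W) a b
  rwa [appLE_id, appLE_id] at this

lemma apply_base (hW : W ≤ U) {O : B.Opens} (hO : W ≤ c ⁻¹ᵁ O) (y : Γ(B, O)) :
    D.apply hW (c.appLE O W hO y) = 0 := D.map_base O W W hW (le_id_preimage W) hO y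

lemma apply_ores (hW : W ≤ U) (h : W' ≤ W) (a : Γ(P, W)) :
    D.apply (h.trans hW) (ores P h a) = ores P h (D.apply hW a) :=
  D.map_res h h hW (le_id_preimage W) (le_id_preimage W') a

/-- The derivation of the ring of functions on an open set given by a vector field. -/
def toDerivation (hW : W ≤ U) : Derivation ℤ Γ(P, W) Γ(P, W) :=
  Derivation.mk' (AddMonoidHom.toIntLinearMap ⟨⟨D.apply hW, by simpa using D.apply_mul hW 0 0⟩,
    D.apply_add hW⟩) (D.apply_mul hW)

lemma toDerivation_apply (hW : W ≤ U) (a : Γ(P, W)) : D.toDerivation hW a = D.apply hW a := rfl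

lemma apply_one (hW : W ≤ U) : D.apply hW (1 : Γ(P, W)) = 0 := (D.toDerivation hW).map_one_eq_zero

end DerivationAlong

section

variable {P B : Scheme.{0}} {c : P ⟶ B} {S : P.Modules}
  (σ : S ≅ sheafHom S (derivationSheaf (𝟙 P) c)) {W W' : P.Opens}

/-- The vector field `s ⊗ u` attached to sections `s` and `u` of a spinor bundle. -/
def spinField (s u : Γ(S, W)) : DerivationAlong (𝟙 P) c W :=
  LocalHom.toFun (σ.hom.app W s) W le_rfl u

/-- The derivative of a function along the vector field `s ⊗ u`. -/
def spinDer (s u : Γ(S, W)) (h : Γ(P, W)) : Γ(P, W) := (spinField σ s u).apply le_rfl h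

lemma spinField_mres (h : W' ≤ W) (s u : Γ(S, W)) :
    spinField σ (mres S h s) (mres S h u) = (spinField σ s u).res h := by
  have h1 : σ.hom.app W' (mres S h s) = LocalHom.res h (σ.hom.app W s) := app_mres σ.hom h s
  rw [spinField, h1]
  exact LocalHom.map_res _ h le_rfl u

lemma spinField_smul_left (r : Γ(P, W)) (s u : Γ(S, W)) :
    spinField σ (r • s) u = r • spinField σ s u := by
  have h1 : σ.hom.app W (r • s) = r • σ.hom.app W s := app_smul σ.hom r s
  rw [spinField, h1]
  refine DerivationAlong.ext ?_
  funext V W' hW' hV a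
  refine congrArg (fun t : Γ(P, W) ↦ P.presheaf.map (homOfLE hW').op t * _) (map_rfl_apply P r)

lemma spinField_smul_right (r : Γ(P, W)) (s u : Γ(S, W)) :
    spinField σ s (r • u) = r • spinField σ s u := LocalHom.map_smul _ _ _ _ _

lemma spinField_add_left (s s' u : Γ(S, W)) :
    spinField σ (s + s') u = spinField σ s u + spinField σ s' u := by
  have h1 : σ.hom.app W (s + s') = σ.hom.app W s + σ.hom.app W s' := map_add (σ.hom.app W).hom _ _
  rw [spinField, h1]
  rfl

lemma spinField_add_right (s u u' : Γ(S, W)) :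
    spinField σ s (u + u') = spinField σ s u + spinField σ s u' := LocalHom.map_add _ _ _ _ _

lemma smul_apply (r : Γ(P, W)) (D : DerivationAlong (𝟙 P) c W) (h : W' ≤ W) (a : Γ(P, W')) :
    (r • D).apply h a = ores P h r * D.apply h a := rfl

lemma spinDer_smul_left (r : Γ(P, W)) (s u : Γ(S, W)) (h : Γ(P, W)) :
    spinDer σ (r • s) u h = r * spinDer σ s u h := by
  rw [spinDer, spinField_smul_left, smul_apply, ores_self]; rfl

lemma spinDer_smul_right (r : Γ(P, W)) (s u : Γ(S, W)) (h : Γ(P, W)) :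
    spinDer σ s (r • u) h = r * spinDer σ s u h := by
  rw [spinDer, spinField_smul_right, smul_apply, ores_self]; rfl

lemma spinDer_add_left (s s' u : Γ(S, W)) (h : Γ(P, W)) :
    spinDer σ (s + s') u h = spinDer σ s u h + spinDer σ s' u h := by
  rw [spinDer, spinField_add_left]; rfl

lemma spinDer_add_right (s u u' : Γ(S, W)) (h : Γ(P, W)) :
    spinDer σ s (u + u') h = spinDer σ s u h + spinDer σ s u' h := by
  rw [spinDer, spinField_add_right]; rfl

lemma spinDer_ores (h : W' ≤ W) (s u : Γ(S, W)) (f : Γ(P, W)) :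
    spinDer σ (mres S h s) (mres S h u) (ores P h f) = ores P h (spinDer σ s u f) := by
  rw [spinDer, spinField_mres]
  exact DerivationAlong.apply_ores _ le_rfl h f

/-- The pairing of a line bundle is symmetric. -/
lemma spinDer_comm (hS : IsInvertible S) (s u : Γ(S, W)) (f : Γ(P, W)) :
    spinDer σ s u f = spinDer σ u s f := by
  refine ores_ext fun x hx ↦ ?_
  obtain ⟨V, e, hxV, he⟩ := hS.exists_generator x
  refine ⟨W ⊓ V, inf_le_left, ⟨hx, hxV⟩, ?_⟩
  rw [← spinDer_ores, ← spinDer_ores]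
  obtain ⟨α, hα⟩ := he.exists_smul inf_le_right (mres S (inf_le_left : W ⊓ V ≤ W) s)
  obtain ⟨β, hβ⟩ := he.exists_smul inf_le_right (mres S (inf_le_left : W ⊓ V ≤ W) u)
  rw [← hα, ← hβ, spinDer_smul_left, spinDer_smul_left, spinDer_smul_right, spinDer_smul_right]
  ring

/-- The pairing of a line bundle has rank one. -/
lemma spinDer_smul_comm (hS : IsInvertible S) (s u n : Γ(S, W)) (f : Γ(P, W)) :
    spinDer σ s u f • n = spinDer σ n u f • s := by
  refine mres_ext fun x hx ↦ ?_
  obtain ⟨V, e, hxV, he⟩ := hS.exists_generator x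
  refine ⟨W ⊓ V, inf_le_left, ⟨hx, hxV⟩, ?_⟩
  rw [mres_smul, mres_smul, ← spinDer_ores, ← spinDer_ores]
  obtain ⟨α, hα⟩ := he.exists_smul inf_le_right (mres S (inf_le_left : W ⊓ V ≤ W) s)
  obtain ⟨γ, hγ⟩ := he.exists_smul inf_le_right (mres S (inf_le_left : W ⊓ V ≤ W) n)
  rw [← hα, ← hγ, spinDer_smul_left, spinDer_smul_left, smul_smul, smul_smul]
  congr 1
  ring

/-- A generator of a spinor bundle induces a generator of the sheaf of vector fields. -/
lemma exists_spinField_of_isGenerator {e : Γ(S, W)} (he : IsGenerator e)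
    (D : DerivationAlong (𝟙 P) c W) : ∃ r : Γ(P, W), D = r • spinField σ e e := by
  choose ρ hρ using fun (W' : P.Opens) (h : W' ≤ W) (a : Γ(S, W')) ↦ he.exists_smul h a
  have inj : ∀ (W' : P.Opens) (h : W' ≤ W) (r r' : Γ(P, W')),
      r • mres S h e = r' • mres S h e → r = r' := fun W' h r r' e' ↦ (he W' h).1 e'
  let H : LocalHom S (derivationSheaf (𝟙 P) c) W :=
    { toFun W' h a := (ρ W' h a • D.res h : DerivationAlong (𝟙 P) c W')
      map_add W' h a b := by
        have : ρ W' h (a + b) = ρ W' h a + ρ W' h b := inj W' h _ _ (by rw [add_smul, hρ, hρ, hρ])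
        rw [this]
        exact add_smul (ρ W' h a) (ρ W' h b) (D.res h)
      map_smul W' h r a := by
        have : ρ W' h (r • a) = r * ρ W' h a := inj W' h _ _ (by rw [mul_smul, hρ, hρ])
        rw [this]
        exact mul_smul r (ρ W' h a) (D.res h)
      map_res {W' W''} h h' a := by
        have : ρ W'' (h.trans h') (mres S h a) = ores P h (ρ W' h' a) := inj W'' (h.trans h') _ _ (by
          rw [hρ, ← mres_mres h' h e, ← mres_smul, hρ])
        refine (congrArg (· • (D.res (h.trans h') : DerivationAlong (𝟙 P) c W'')) this).trans ?_
        refine DerivationAlong.ext ?_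
        funext V W₃ hW₃ hV b
        exact congrArg (· * _) (ores_ores h hW₃ (ρ W' h' a)) }
  obtain ⟨s, hs⟩ : ∃ s, σ.hom.app W s = H :=
    ⟨σ.inv.app W H, congr($(congrArg (fun f ↦ Scheme.Modules.Hom.app f W) σ.inv_hom_id) H)⟩
  obtain ⟨r, rfl⟩ := he.exists_smul le_rfl s
  rw [mres_self] at hs
  refine ⟨r, ?_⟩
  rw [← spinField_smul_left, spinField, hs]
  have : ρ W le_rfl e = 1 := inj W le_rfl _ _ (by rw [hρ, mres_self, one_smul])
  change D = ρ W le_rfl e • D.res le_rfl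
  rw [this]
  exact (one_smul _ _).symm

end

section

variable {P B : Scheme.{0}} {c : P ⟶ B} {V : B.Opens} {U : P.Opens} (h : U ≤ c ⁻¹ᵁ V)

/-- On an affine line over an affine base there is a vector field `∂/∂z`. -/
lemma exists_coordinate_field (hV : IsAffineOpen V) (hU : IsAffineOpen U) (z : Γ(P, U))
    (hz : Function.Bijective (Polynomial.eval₂RingHom (c.appLE V U h).hom z)) :
    ∃ D : DerivationAlong (𝟙 P) c U, D.apply le_rfl z = 1 := by
  let e := RingEquiv.ofBijective _ hz
  let δ : Derivation ℤ Γ(P, U) Γ(P, U) :=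
    Derivation.mk' ((e : Polynomial Γ(B, V) →+* Γ(P, U)).toAddMonoidHom.comp
      ((Polynomial.derivative : Polynomial Γ(B, V) →ₗ[_] _).toAddMonoidHom.comp
      (e.symm : Γ(P, U) →+* Polynomial Γ(B, V)).toAddMonoidHom)).toIntLinearMap fun a b ↦ by
        simp [Polynomial.derivative_mul]
        ring
  have hδ : ∀ p, δ (e p) = e (Polynomial.derivative p) := fun p ↦ by simp [δ]
  obtain ⟨D, hD⟩ := exists_derivationAlong hV hU h δ fun r ↦ by
    have := hδ (Polynomial.C r)
    simpa [e] using this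
  refine ⟨D, (hD z).trans ?_⟩
  have := hδ Polynomial.X
  simpa [e] using this

/-- If `e` generates a spinor bundle, then `e ⊗ e` generates the vector fields, so it is a unit
multiple of `∂/∂z`. -/
lemma isUnit_spinDer {S : P.Modules} (σ : S ≅ sheafHom S (derivationSheaf (𝟙 P) c))
    (hV : IsAffineOpen V) (hU : IsAffineOpen U) (z : Γ(P, U))
    (hz : Function.Bijective (Polynomial.eval₂RingHom (c.appLE V U h).hom z))
    {W : P.Opens} (hW : W ≤ U) {e : Γ(S, W)} (he : IsGenerator e) :
    IsUnit (spinDer σ e e (ores P hW z)) := by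
  obtain ⟨D, hD⟩ := exists_coordinate_field h hV hU z hz
  obtain ⟨r, hr⟩ := exists_spinField_of_isGenerator σ he (D.res hW)
  have h1 : (D.res hW).apply le_rfl (ores P hW z) = 1 := by
    refine (D.apply_ores le_rfl hW z).trans ?_
    rw [hD, map_one]
  rw [hr, smul_apply] at h1
  exact IsUnit.of_mul_eq_one_right _ h1

/-- A vector field acts on polynomials in the coordinate by the chain rule. -/
lemma apply_eval₂ (D : DerivationAlong (𝟙 P) c U) (z : Γ(P, U)) (p : Polynomial Γ(B, V)) :
    D.apply le_rfl (p.eval₂ (c.appLE V U h).hom z) =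
      (Polynomial.derivative p).eval₂ (c.appLE V U h).hom z * D.apply le_rfl z := by
  induction p using Polynomial.induction_on' with
  | add p q hp hq =>
    rw [Polynomial.eval₂_add, D.apply_add, hp, hq, Polynomial.derivative_add, Polynomial.eval₂_add]
    ring
  | monomial n r =>
    have h1 : D.apply le_rfl ((c.appLE V U h).hom r) = 0 := D.apply_base le_rfl h r
    have h2 := (D.toDerivation le_rfl).leibniz_pow z n
    simp only [D.toDerivation_apply, smul_eq_mul, nsmul_eq_mul] at h2
    rw [Polynomial.eval₂_monomial, D.apply_mul, h1, h2, Polynomial.derivative_monomial,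
      Polynomial.eval₂_monomial]
    simp
    ring

end

section

variable {P : Scheme.{0}} {S : P.Modules} {U : P.Opens}

lemma basicOpen_ores {W : P.Opens} (hW : W ≤ U) (g : Γ(P, U)) :
    P.basicOpen (ores P hW g) = W ⊓ P.basicOpen g := P.basicOpen_res g _

lemma IsInvertible.exists_basicOpen_generator (hS : IsInvertible S) (hU : IsAffineOpen U) {x : P}
    (hx : x ∈ U) : ∃ (f : Γ(P, U)) (u : Γ(S, P.basicOpen f)), x ∈ P.basicOpen f ∧ IsGenerator u := by
  obtain ⟨W, u, hxW, hu⟩ := hS.exists_generator x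
  obtain ⟨f, hf, hxf⟩ := exists_basicOpen hU (inf_le_left : U ⊓ W ≤ U) ⟨hx, hxW⟩
  exact ⟨f, _, hxf, hu.restrict (hf.trans inf_le_right)⟩

lemma IsGenerator.exists_pow_smul_eq_zero {W : P.Opens} {u : Γ(S, W)} (hu : IsGenerator u)
    (hW : IsAffineOpen W) (g : Γ(P, W)) {s : Γ(S, W)} (hs : mres S (P.basicOpen_le g) s = 0) :
    ∃ n : ℕ, g ^ n • s = 0 := by
  obtain ⟨r, rfl⟩ := hu.exists_smul le_rfl s
  rw [mres_self, mres_smul] at hs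
  obtain ⟨n, hn⟩ := exists_pow_mul_eq_zero hW g (hu.eq_zero _ hs)
  exact ⟨n, by rw [smul_smul, hn, zero_smul]⟩

/-- A section of an invertible sheaf over a principal open subset of an affine open set extends
after multiplication by a power of the equation. -/
lemma IsInvertible.exists_extension (hS : IsInvertible S) (hU : IsAffineOpen U) (g : Γ(P, U))
    (n : Γ(S, P.basicOpen g)) :
    ∃ (k : ℕ) (x : Γ(S, U)), mres S (P.basicOpen_le g) x = ores P (P.basicOpen_le g) (g ^ k) • n := by
  choose f u hxf hu using fun x : U ↦ hS.exists_basicOpen_generator hU x.2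
  obtain ⟨t, ht⟩ := hU.isCompact.elim_finite_subcover (fun x ↦ (P.basicOpen (f x) : Set P))
    (fun x ↦ (P.basicOpen (f x)).2) fun x hx ↦ Set.mem_iUnion.2 ⟨⟨x, hx⟩, hxf _⟩
  let W : t → P.Opens := fun i ↦ P.basicOpen (f i)
  have hW : ∀ i, W i ≤ U := fun i ↦ P.basicOpen_le _
  have hcov : U ≤ iSup W := fun x hx ↦ by
    obtain ⟨i, hi, hxi⟩ := Set.mem_iUnion₂.1 (ht hx)
    exact Opens.mem_iSup.2 ⟨⟨i, hi⟩, hxi⟩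
  have hWg : ∀ (W : P.Opens) (hW : W ≤ U), P.basicOpen (ores P hW g) ≤ P.basicOpen g :=
    fun W hW ↦ (P.basicOpen_res g _).trans_le inf_le_right
  have h1 : ∀ i, ∃ (k : ℕ) (y : Γ(S, W i)), mres S (P.basicOpen_le (ores P (hW i) g)) y =
      ores P ((P.basicOpen_le (ores P (hW i) g)).trans (hW i)) (g ^ k) • mres S (hWg _ (hW i)) n := by
    intro i
    obtain ⟨r, hr⟩ := (hu i).exists_smul (P.basicOpen_le (ores P (hW i) g))
      (mres S (hWg _ (hW i)) n)
    obtain ⟨k, a, ha⟩ := exists_ores_eq_of_basicOpen (hU.basicOpen (f i)) (ores P (hW i) g) r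
    refine ⟨k, a • u i, ?_⟩
    rw [mres_smul, ← ha, ← hr, mul_smul, ← map_pow, ores_ores]
  choose k y hy using h1
  let K := Finset.univ.sup k
  have h1 : ∀ i, ∃ y' : Γ(S, W i), mres S (P.basicOpen_le (ores P (hW i) g)) y' =
      ores P ((P.basicOpen_le (ores P (hW i) g)).trans (hW i)) (g ^ K) • mres S (hWg _ (hW i)) n := by
    intro i
    refine ⟨ores P (hW i) (g ^ (K - k i)) • y i, ?_⟩
    rw [mres_smul, hy, smul_smul, ores_ores, ← map_mul, ← pow_add,
      Nat.sub_add_cancel (Finset.le_sup (Finset.mem_univ i))]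
  choose y' hy' using h1
  have h2 : ∀ i j, ∃ m : ℕ, ores P (inf_le_left.trans (hW i) : W i ⊓ W j ≤ U) (g ^ m) •
      (mres S inf_le_left (y' i) - mres S inf_le_right (y' j)) = 0 := by
    intro i j
    have haff : IsAffineOpen (W i ⊓ W j) := by
      have := hU.basicOpen (f i * f j)
      rwa [Scheme.basicOpen_mul] at this
    obtain ⟨m, hm⟩ := ((hu i).restrict (inf_le_left : W i ⊓ W j ≤ W i)).exists_pow_smul_eq_zero haff
      (ores P (inf_le_left.trans (hW i)) g)
      (s := mres S inf_le_left (y' i) - mres S inf_le_right (y' j)) (by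
        have l1 : P.basicOpen (ores P (inf_le_left.trans (hW i) : W i ⊓ W j ≤ U) g) ≤
            P.basicOpen (ores P (hW i) g) := by
          rw [basicOpen_ores, basicOpen_ores]
          exact inf_le_inf_right _ inf_le_left
        have l2 : P.basicOpen (ores P (inf_le_left.trans (hW i) : W i ⊓ W j ≤ U) g) ≤
            P.basicOpen (ores P (hW j) g) := by
          rw [basicOpen_ores, basicOpen_ores]
          exact inf_le_inf_right _ inf_le_right
        have e1 := congrArg (mres S l1) (hy' i)
        have e2 := congrArg (mres S l2) (hy' j)
        rw [mres_mres, mres_smul, mres_mres, ores_ores] at e1 e2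
        rw [map_sub, mres_mres, mres_mres, e1, e2, sub_self])
    exact ⟨m, by rwa [map_pow]⟩
  choose m hm using h2
  let M := Finset.univ.sup fun p : t × t ↦ m p.1 p.2
  have hM : ∀ i j, m i j ≤ M := fun i j ↦
    Finset.le_sup (f := fun p : t × t ↦ m p.1 p.2) (Finset.mem_univ (i, j))
  obtain ⟨x, hx⟩ := mres_glue W hW hcov (fun i ↦ ores P (hW i) (g ^ M) • y' i) fun i j ↦ by
    rw [← sub_eq_zero, mres_smul, mres_smul, ores_ores, ores_ores, ← smul_sub,
      ← Nat.sub_add_cancel (hM i j), pow_add, map_mul, mul_smul, hm, smul_zero]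
  refine ⟨M + K, x, mres_ext fun p hp ↦ ?_⟩
  obtain ⟨i, hi⟩ := Opens.mem_iSup.1 (hcov (P.basicOpen_le _ hp))
  refine ⟨P.basicOpen (ores P (hW i) g), hWg _ _, ?_, ?_⟩
  · rw [basicOpen_ores]
    exact ⟨hi, hp⟩
  · rw [mres_mres, ← mres_mres (hW i) (P.basicOpen_le _), hx, mres_smul, hy', smul_smul, mres_smul,
      ores_ores, ores_ores, ← map_mul, pow_add]

end

/-! ### Functions on a chart -/

section

open LaurentPolynomial

variable {R : Type*} [CommRing R]

lemma coeff_toLaurent_natCast (p : Polynomial R) (n : ℕ) :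
    (Polynomial.toLaurent p).coeff (n : ℤ) = p.coeff n := by
  rw [coeff_toLaurent]
  exact Finsupp.mapDomain_apply Nat.castEmbedding.injective _ n

lemma coeff_toLaurent_of_neg (p : Polynomial R) {j : ℤ} (hj : j < 0) :
    (Polynomial.toLaurent p).coeff j = 0 := by
  rw [coeff_toLaurent]
  refine Finsupp.mapDomain_of_notMem_range _ _ ?_
  rintro ⟨n, rfl⟩
  simp at hj
  omega

/-- A Laurent polynomial which is a polynomial in `T` and in `T⁻¹` is constant. -/
lemma eq_C_of_toLaurent_eq_invert {p q : Polynomial R}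
    (h : Polynomial.toLaurent p = invert (Polynomial.toLaurent q)) :
    ∃ r, p = Polynomial.C r ∧ q = Polynomial.C r := by
  have hp : p = Polynomial.C (p.coeff 0) := by
    ext n
    rw [Polynomial.coeff_C]
    split_ifs with hn
    · rw [hn]
    · rw [← coeff_toLaurent_natCast, h, invert_apply, coeff_toLaurent_of_neg]
      omega
  refine ⟨p.coeff 0, hp, ?_⟩
  apply Polynomial.toLaurent_injective
  apply (invert (R := R)).injective
  rw [← h, Polynomial.toLaurent_C, invert_C, ← Polynomial.toLaurent_C, ← hp]

/-- `exists_eq_add` over a ring `A` identified with the ring of Laurent polynomials. -/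
lemma exists_eq_add_of_equiv {A N : Type*} [CommRing A] [AddCommGroup N] [Module A N]
    (E : R[T;T⁻¹] ≃+* A) (a : N → N → A)
    (add_left : ∀ x x' y, a (x + x') y = a x y + a x' y)
    (smul_left : ∀ (r : A) x y, a (r • x) y = r * a x y)
    (hsymm : ∀ x y, a x y = a y x) (hrank : ∀ x y n, a x y • n = a n y • x)
    (M₀ M₁ : AddSubgroup N)
    (hM₀ : ∀ (p : Polynomial R), ∀ x ∈ M₀, E (Polynomial.toLaurent p) • x ∈ M₀)
    (hM₁ : ∀ (p : Polynomial R), ∀ x ∈ M₁, E (invert (Polynomial.toLaurent p)) • x ∈ M₁)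
    (h₀ : ∀ n, ∃ k : ℕ, E (T k) • n ∈ M₀) (h₁ : ∀ n, ∃ k : ℕ, E (T (-k)) • n ∈ M₁)
    (p₀ : ∀ x ∈ M₀, ∀ y ∈ M₀, ∃ p : Polynomial R, a x y = E (Polynomial.toLaurent p))
    (p₁ : ∀ x ∈ M₁, ∀ y ∈ M₁, ∃ p : Polynomial R, a x y = E (T 2 * invert (Polynomial.toLaurent p)))
    {ι κ : Type*} [Fintype ι] [Fintype κ] (s u : ι → N) (hs : ∀ i, s i ∈ M₀) (hu : ∀ i, u i ∈ M₀)
    (hsu : ∑ i, a (s i) (u i) = 1)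
    (s' u' : κ → N) (hs' : ∀ i, s' i ∈ M₁) (hu' : ∀ i, u' i ∈ M₁)
    (hsu' : ∑ i, a (s' i) (u' i) = E (T 2)) (n : N) :
    ∃ x ∈ M₀, ∃ y ∈ M₁, n = E (T 1) • x + E (T (-1)) • y := by
  let _ : Module R[T;T⁻¹] N := Module.compHom N (E : R[T;T⁻¹] →+* A)
  let _ : Module R N := Module.compHom N ((E : R[T;T⁻¹] →+* A).comp C)
  have smul_def : ∀ (p : R[T;T⁻¹]) (x : N), p • x = E p • x := fun _ _ ↦ rfl
  have smul_def' : ∀ (r : R) (x : N), r • x = E (C r) • x := fun _ _ ↦ rfl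
  have _ : IsScalarTower R R[T;T⁻¹] N := ⟨fun r p x ↦ by
    rw [smul_def, smul_def', smul_def, LaurentPolynomial.smul_eq_C_mul, map_mul, mul_smul]⟩
  have add_right : ∀ x y y', a x (y + y') = a x y + a x y' := fun x y y' ↦ by
    rw [hsymm, add_left, hsymm y, hsymm y']
  have smul_right : ∀ (r : A) x y, a x (r • y) = r * a x y := fun r x y ↦ by
    rw [hsymm, smul_left, hsymm y]
  let a' : N →ₗ[R[T;T⁻¹]] N →ₗ[R[T;T⁻¹]] R[T;T⁻¹] := LinearMap.mk₂ _ (fun x y ↦ E.symm (a x y))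
    (fun x x' y ↦ by rw [add_left, map_add])
    (fun p x y ↦ by rw [smul_def, smul_left, map_mul, E.symm_apply_apply, smul_eq_mul])
    (fun x y y' ↦ by rw [add_right, map_add])
    (fun p x y ↦ by rw [smul_def, smul_right, map_mul, E.symm_apply_apply, smul_eq_mul])
  have a'_def : ∀ x y, a' x y = E.symm (a x y) := fun _ _ ↦ rfl
  let M₀' : Submodule R N := { M₀ with
    smul_mem' := fun r x hx ↦ by
      have := hM₀ (Polynomial.C r) x hx
      rwa [Polynomial.toLaurent_C] at this }
  let M₁' : Submodule R N := { M₁ with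
    smul_mem' := fun r x hx ↦ by
      have := hM₁ (Polynomial.C r) x hx
      rwa [Polynomial.toLaurent_C, invert_C] at this }
  refine exists_eq_add a' (fun x y ↦ by rw [a'_def, a'_def, hsymm])
    (fun x y n ↦ by rw [a'_def, a'_def, smul_def, smul_def, E.apply_symm_apply, E.apply_symm_apply, hrank])
    M₀' M₁' (fun x hx ↦ ?_) (fun x hx ↦ ?_) h₀ h₁ (fun x hx y hy j hj ↦ ?_) (fun x hx y hy j hj ↦ ?_)
    s u hs hu ?_ s' u' hs' hu' ?_ n
  · have := hM₀ Polynomial.X x hx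
    rwa [Polynomial.toLaurent_X] at this
  · have := hM₁ Polynomial.X x hx
    rwa [Polynomial.toLaurent_X, invert_T] at this
  · obtain ⟨p, hp⟩ := p₀ x hx y hy
    rw [a'_def, hp, E.symm_apply_apply, coeff_toLaurent_of_neg p hj]
  · obtain ⟨p, hp⟩ := p₁ x hx y hy
    rw [a'_def, hp, E.symm_apply_apply, coeff_T_mul, invert_apply, coeff_toLaurent_of_neg]
    omega
  · simp only [a'_def, ← map_sum, hsu, map_one]
  · simp only [a'_def, ← map_sum, hsu', E.symm_apply_apply]

end

namespace Chart

open LaurentPolynomial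

variable {P B : Scheme.{0}} {c : P ⟶ B} {V : B.Opens} (χ : Chart c V)

/-- The polynomial in the coordinate `z` with given coefficients. -/
def poly₀ : Polynomial Γ(B, V) ≃+* Γ(P, χ.U₀) := RingEquiv.ofBijective _ χ.bijective₀

/-- The polynomial in the coordinate `w` with given coefficients. -/
def poly₁ : Polynomial Γ(B, V) ≃+* Γ(P, χ.U₁) := RingEquiv.ofBijective _ χ.bijective₁

@[simp] lemma poly₀_X : χ.poly₀ Polynomial.X = χ.z := Polynomial.eval₂_X _ _

@[simp] lemma poly₁_X : χ.poly₁ Polynomial.X = χ.w := Polynomial.eval₂_X _ _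

@[simp] lemma poly₀_C (r : Γ(B, V)) : χ.poly₀ (Polynomial.C r) = c.appLE V χ.U₀ χ.le₀ r :=
  Polynomial.eval₂_C _ _

@[simp] lemma poly₁_C (r : Γ(B, V)) : χ.poly₁ (Polynomial.C r) = c.appLE V χ.U₁ χ.le₁ r :=
  Polynomial.eval₂_C _ _

/-- Functions on the intersection of the two affine lines are Laurent polynomials. -/
lemma exists_laurent : ∃ E : Γ(B, V)[T;T⁻¹] ≃+* Γ(P, χ.U₀ ⊓ χ.U₁),
    (∀ p, E (Polynomial.toLaurent p) = ores P inf_le_left (χ.poly₀ p)) ∧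
    (∀ p, E (invert (Polynomial.toLaurent p)) = ores P inf_le_right (χ.poly₁ p)) := by
  have key : ∀ (W : P.Opens) (hW : W = P.basicOpen χ.z) (h₀ : W ≤ χ.U₀) (h₁ : W ≤ χ.U₁),
      ∃ E : Γ(B, V)[T;T⁻¹] ≃+* Γ(P, W),
      (∀ p, E (Polynomial.toLaurent p) = ores P h₀ (χ.poly₀ p)) ∧
      (∀ p, E (invert (Polynomial.toLaurent p)) = ores P h₁ (χ.poly₁ p)) := by
    rintro W rfl h₀ h₁
    have := χ.affine₀.isLocalization_basicOpen χ.z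
    have H : (Submonoid.powers (Polynomial.X : Polynomial Γ(B, V))).map χ.poly₀.toMonoidHom =
        Submonoid.powers χ.z := by
      rw [Submonoid.map_powers]
      congr 1
      exact χ.poly₀_X
    let E : Γ(B, V)[T;T⁻¹] ≃+* Γ(P, P.basicOpen χ.z) :=
      IsLocalization.ringEquivOfRingEquiv (M := Submonoid.powers (Polynomial.X : Polynomial Γ(B, V)))
        (T := Submonoid.powers χ.z) _ _ χ.poly₀ H
    have hE : ∀ p, E (Polynomial.toLaurent p) = ores P h₀ (χ.poly₀ p) := fun p ↦
      IsLocalization.ringEquivOfRingEquiv_eq H p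
    refine ⟨E, hE, fun p ↦ ?_⟩
    have h1 : ((E : Γ(B, V)[T;T⁻¹] →+* _).comp
        (invert (R := Γ(B, V)) : Γ(B, V)[T;T⁻¹] →+* Γ(B, V)[T;T⁻¹])).comp Polynomial.toLaurent =
        (ores P h₁).comp (χ.poly₁ : Polynomial Γ(B, V) →+* Γ(P, χ.U₁)) := by
      refine Polynomial.ringHom_ext (fun r ↦ ?_) ?_
      · have := hE (Polynomial.C r)
        simp only [RingHom.comp_apply, RingHom.coe_coe, Polynomial.toLaurent_C, invert_C, poly₁_C]
        rw [Polynomial.toLaurent_C, poly₀_C] at this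
        rw [this]
        exact (congr($(c.appLE_map χ.le₀ (homOfLE h₀).op) r)).trans
          (congr($(c.appLE_map χ.le₁ (homOfLE h₁).op) r)).symm
      · have hX := hE Polynomial.X
        rw [Polynomial.toLaurent_X, poly₀_X] at hX
        have h2 : E (T 1) * E (T (-1)) = 1 := by
          rw [← map_mul, ← T_add]; simp
        have h3 := χ.mul_eq_one _ h₀ h₁
        rw [← hX] at h3
        simp only [RingHom.comp_apply, RingHom.coe_coe, Polynomial.toLaurent_X, invert_T, poly₁_X]
        exact (left_inv_eq_right_inv ((mul_comm _ _).trans h2) h3)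
    exact RingHom.congr_fun h1 p
  exact key _ χ.basicOpen_z.symm _ _

/-- A function on both affine lines is a function on the base. -/
lemma exists_eq_appLE {f : Γ(P, χ.U₀)} {g : Γ(P, χ.U₁)}
    (h : ores P (inf_le_left : χ.U₀ ⊓ χ.U₁ ≤ _) f = ores P inf_le_right g) :
    ∃ r : Γ(B, V), f = c.appLE V χ.U₀ χ.le₀ r ∧ g = c.appLE V χ.U₁ χ.le₁ r := by
  obtain ⟨E, h₀, h₁⟩ := χ.exists_laurent
  obtain ⟨p, rfl⟩ := χ.poly₀.surjective f
  obtain ⟨q, rfl⟩ := χ.poly₁.surjective g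
  rw [← h₀, ← h₁] at h
  obtain ⟨r, rfl, rfl⟩ := eq_C_of_toLaurent_eq_invert (E.injective h)
  exact ⟨r, by simp, by simp⟩

/-- The line bundle of degree `-1` has no sections. -/
lemma eq_zero_of_mul_eq {f : Γ(P, χ.U₀)} {g : Γ(P, χ.U₁)}
    (h : ores P (inf_le_left : χ.U₀ ⊓ χ.U₁ ≤ _) (χ.z * f) = ores P inf_le_right g) :
    f = 0 ∧ g = 0 := by
  obtain ⟨r, hr, rfl⟩ := χ.exists_eq_appLE h
  obtain ⟨p, rfl⟩ := χ.poly₀.surjective f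
  rw [← χ.poly₀_X, ← map_mul, ← χ.poly₀_C] at hr
  have hr' := χ.poly₀.injective hr
  have r0 : r = 0 := by simpa using (congrArg (Polynomial.coeff · 0) hr').symm
  subst r0
  have p0 : p = 0 := by
    ext n
    simpa using congrArg (Polynomial.coeff · (n + 1)) hr'
  rw [p0]
  simp

/-- Sections of the line bundle of degree `1` are linear in the coordinate. -/
lemma exists_linear {f : Γ(P, χ.U₀)} {g : Γ(P, χ.U₁)}
    (h : ores P (inf_le_left : χ.U₀ ⊓ χ.U₁ ≤ _) f = ores P inf_le_left χ.z * ores P inf_le_right g) :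
    ∃ α β : Γ(B, V), f = c.appLE V χ.U₀ χ.le₀ α + c.appLE V χ.U₀ χ.le₀ β * χ.z ∧
      g = c.appLE V χ.U₁ χ.le₁ α * χ.w + c.appLE V χ.U₁ χ.le₁ β := by
  obtain ⟨p, rfl⟩ := χ.poly₀.surjective f
  have hp := congrArg χ.poly₀ (Polynomial.X_mul_divX_add p)
  rw [map_add, map_mul, poly₀_X, poly₀_C] at hp
  set α := p.coeff 0
  have h2 : ores P inf_le_left (c.appLE V χ.U₀ χ.le₀ α) =
      ores P (inf_le_right : χ.U₀ ⊓ χ.U₁ ≤ _) (c.appLE V χ.U₁ χ.le₁ α) :=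
    (congr($(c.appLE_map χ.le₀ (homOfLE inf_le_left).op) α)).trans
      (congr($(c.appLE_map χ.le₁ (homOfLE inf_le_right).op) α)).symm
  have hzw := χ.mul_eq_one _ (inf_le_left : χ.U₀ ⊓ χ.U₁ ≤ _) inf_le_right
  obtain ⟨β, hβ, hg⟩ := χ.exists_eq_appLE (f := χ.poly₀ p.divX)
    (g := g - c.appLE V χ.U₁ χ.le₁ α * χ.w) (by
      rw [← hp, map_add, map_mul, h2] at h
      rw [map_sub, map_mul]
      linear_combination (ores P (inf_le_right : χ.U₀ ⊓ χ.U₁ ≤ _) χ.w) * h -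
        (ores P inf_le_left (χ.poly₀ p.divX) - ores P (inf_le_right : χ.U₀ ⊓ χ.U₁ ≤ _) g) * hzw)
  refine ⟨α, β, ?_, ?_⟩
  · rw [← hp, hβ]; ring
  · rw [← hg]; ring

end Chart

/-! ### Spinor bundles on families of projective lines have degree one -/

section

variable {P B : Scheme.{0}} {c : P ⟶ B} {S : P.Modules}
  (σ : S ≅ sheafHom S (derivationSheaf (𝟙 P) c)) {V : B.Opens} {U : P.Opens}

/-- Conversely, a section `e` such that `e ⊗ e` is a unit multiple of a coordinate field is a
generator. -/
lemma isGenerator_of_isUnit_spinDer (hS : IsInvertible S) {e : Γ(S, U)} {f : Γ(P, U)}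
    (h : IsUnit (spinDer σ e e f)) : IsGenerator e := by
  intro W hW
  have hW' : IsUnit (spinDer σ (mres S hW e) (mres S hW e) (ores P hW f)) := by
    rw [spinDer_ores]
    exact h.map (ores P hW)
  constructor
  · intro r r' hr
    have := congrArg (fun x ↦ spinDer σ x (mres S hW e) (ores P hW f)) hr
    simp only [spinDer_smul_left] at this
    exact hW'.mul_right_cancel this
  · intro x
    obtain ⟨i, hi⟩ := hW'.exists_left_inv
    refine ⟨i * spinDer σ x (mres S hW e) (ores P hW f), ?_⟩
    change (i * _) • mres S hW e = x
    rw [mul_smul, ← spinDer_smul_comm σ hS, smul_smul, hi, one_smul]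

/-- On an affine line the values of the pairing generate the unit ideal. -/
lemma exists_sum_spinDer_eq_one (hS : IsInvertible S) (h : U ≤ c ⁻¹ᵁ V) (hV : IsAffineOpen V)
    (hU : IsAffineOpen U) (z : Γ(P, U))
    (hz : Function.Bijective (Polynomial.eval₂RingHom (c.appLE V U h).hom z)) :
    ∃ (n : ℕ) (s u : Fin n → Γ(S, U)), ∑ i, spinDer σ (s i) (u i) z = 1 := by
  let A : Set Γ(P, U) := Set.range fun x : Γ(S, U) ↦ spinDer σ x x z
  have hA : Ideal.span A = ⊤ := by
    rw [← hU.self_le_iSup_basicOpen_iff]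
    intro p hp
    obtain ⟨f, u, hpf, hu⟩ := hS.exists_basicOpen_generator hU hp
    obtain ⟨k, x, hx⟩ := hS.exists_extension hU f u
    refine Opens.mem_iSup.2 ⟨⟨_, x, rfl⟩, ?_⟩
    have h1 : IsUnit (ores P (P.basicOpen_le f) (spinDer σ x x z)) := by
      rw [← spinDer_ores, hx, spinDer_smul_left, spinDer_smul_right, map_pow]
      have hf := (isUnit_ores_basicOpen f).pow k
      exact hf.mul (hf.mul (isUnit_spinDer h σ hV hU z hz (P.basicOpen_le f) hu))
    have h2 := basicOpen_ores (P.basicOpen_le f) (spinDer σ x x z)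
    rw [Scheme.basicOpen_of_isUnit _ h1] at h2
    rw [h2] at hpf
    exact hpf.2
  have h1 : (1 : Γ(P, U)) ∈ Submodule.span Γ(P, U) A := by
    change (1 : Γ(P, U)) ∈ Ideal.span A
    rw [hA]; trivial
  obtain ⟨n, f, g, hfg⟩ := Submodule.mem_span_set'.1 h1
  choose x hx using fun i ↦ (g i).2
  refine ⟨n, fun i ↦ f i • x i, x, ?_⟩
  rw [← hfg]
  refine Finset.sum_congr rfl fun i _ ↦ ?_
  rw [spinDer_smul_left, smul_eq_mul]
  exact congrArg _ (hx i)

end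

/-- A chart of a family of projective lines together with generators of a line bundle on the two
affine lines which present the line bundle as the bundle of degree one. -/
structure SpinChart {P B : Scheme.{0}} (c : P ⟶ B) (S : P.Modules) (V : B.Opens) extends
    Chart c V where
  e₀ : Γ(S, U₀)
  e₁ : Γ(S, U₁)
  generator₀ : IsGenerator e₀
  generator₁ : IsGenerator e₁
  transition : ∀ (W : P.Opens) (h₀ : W ≤ U₀) (h₁ : W ≤ U₁),
    mres S h₁ e₁ = ores P h₀ z • mres S h₀ e₀

namespace SpinChart

variable {P B : Scheme.{0}} {c : P ⟶ B} {S : P.Modules} {V : B.Opens} (χ : SpinChart c S V)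

/-- Exchange of the two affine lines. -/
def swap : SpinChart c S V where
  toChart := χ.toChart.swap
  e₀ := χ.e₁
  e₁ := χ.e₀
  generator₀ := χ.generator₁
  generator₁ := χ.generator₀
  transition W h₀ h₁ := by
    replace h₀ : W ≤ χ.U₁ := h₀
    replace h₁ : W ≤ χ.U₀ := h₁
    change mres S h₁ χ.e₀ = ores P h₀ χ.w • mres S h₀ χ.e₁
    rw [χ.transition W h₁ h₀, smul_smul, mul_comm, χ.mul_eq_one W h₁ h₀, one_smul]

/-- Restriction to a principal open set of the base. -/
def shrink (f : Γ(B, V)) : SpinChart c S (B.basicOpen f) where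
  toChart := χ.toChart.shrink f
  e₀ := mres S inf_le_left χ.e₀
  e₁ := mres S inf_le_left χ.e₁
  generator₀ := χ.generator₀.restrict _
  generator₁ := χ.generator₁.restrict _
  transition W h₀ h₁ := by
    replace h₀ : W ≤ χ.U₀ ⊓ c ⁻¹ᵁ B.basicOpen f := h₀
    replace h₁ : W ≤ χ.U₁ ⊓ c ⁻¹ᵁ B.basicOpen f := h₁
    change mres S h₁ (mres S inf_le_left χ.e₁) =
      ores P h₀ (ores P inf_le_left χ.z) • mres S h₀ (mres S inf_le_left χ.e₀)
    rw [mres_mres, mres_mres, ores_ores, χ.transition W (h₀.trans inf_le_left)]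

end SpinChart

lemma IsInvertible.exists_extension_of_eq {P : Scheme.{0}} {S : P.Modules} {U W : P.Opens}
    (hS : IsInvertible S) (hU : IsAffineOpen U) (g : Γ(P, U)) (hW : P.basicOpen g = W)
    (hWU : W ≤ U) (n : Γ(S, W)) :
    ∃ (k : ℕ) (x : Γ(S, U)), mres S hWU x = ores P hWU (g ^ k) • n := by
  subst hW
  exact hS.exists_extension hU g n

section

open LaurentPolynomial

variable {P B : Scheme.{0}} {c : P ⟶ B} {S : P.Modules} {V : B.Opens}

/-- The derivative of the coordinate `z` in terms of the derivative of the coordinate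
`w = 1 / z`. -/
lemma Chart.spinDer_z (σ : S ≅ sheafHom S (derivationSheaf (𝟙 P) c)) (χ : Chart c V)
    {W : P.Opens} (h₀ : W ≤ χ.U₀) (h₁ : W ≤ χ.U₁)
    (x y : Γ(S, W)) :
    spinDer σ x y (ores P h₀ χ.z) = - (ores P h₀ χ.z) ^ 2 * spinDer σ x y (ores P h₁ χ.w) := by
  have h := (spinField σ x y).apply_mul le_rfl (ores P h₀ χ.z) (ores P h₁ χ.w)
  rw [χ.mul_eq_one, DerivationAlong.apply_one] at h
  have hzw := χ.mul_eq_one W h₀ h₁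
  change 0 = ores P h₀ χ.z * spinDer σ x y (ores P h₁ χ.w) +
    ores P h₁ χ.w * spinDer σ x y (ores P h₀ χ.z) at h
  linear_combination (- ores P h₀ χ.z) * h - spinDer σ x y (ores P h₀ χ.z) * hzw

/-- The first cohomology of a spinor bundle vanishes after a twist by minus the divisors `z = 0` and
`w = 0`, on the Čech cocycles of a chart. -/
lemma Chart.exists_eq_add (σ : S ≅ sheafHom S (derivationSheaf (𝟙 P) c)) (χ : Chart c V)
    (hS : IsInvertible S) (n : Γ(S, χ.U₀ ⊓ χ.U₁)) :
    ∃ (x : Γ(S, χ.U₀)) (y : Γ(S, χ.U₁)),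
      n = mres S inf_le_left (χ.z • x) + mres S inf_le_right (χ.w • y) := by
  obtain ⟨E, hE₀, hE₁⟩ := χ.exists_laurent
  set i₀ : χ.U₀ ⊓ χ.U₁ ≤ χ.U₀ := inf_le_left
  set i₁ : χ.U₀ ⊓ χ.U₁ ≤ χ.U₁ := inf_le_right
  have hT : ∀ k : ℕ, E (T k) = ores P i₀ (χ.z ^ k) := fun k ↦ by
    rw [← Polynomial.toLaurent_X_pow, hE₀, map_pow, Chart.poly₀_X]
  have hT' : ∀ k : ℕ, E (T (-k)) = ores P i₁ (χ.w ^ k) := fun k ↦ by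
    rw [← invert_T, ← Polynomial.toLaurent_X_pow, hE₁, map_pow, Chart.poly₁_X]
  obtain ⟨m, s, u, hsu⟩ := exists_sum_spinDer_eq_one σ hS χ.le₀ χ.affine χ.affine₀ χ.z χ.bijective₀
  obtain ⟨m', s', u', hsu'⟩ :=
    exists_sum_spinDer_eq_one σ hS χ.le₁ χ.affine χ.affine₁ χ.w χ.bijective₁
  have hT1 : E (T 1) = ores P i₀ χ.z := by simpa using hT 1
  have hT2 : E (T 2) = ores P i₀ χ.z ^ 2 := by
    have := hT 2
    rwa [map_pow] at this
  have hT1' : E (T (-1)) = ores P i₁ χ.w := by simpa using hT' 1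
  obtain ⟨_, ⟨x, rfl⟩, _, ⟨y, rfl⟩, h⟩ := exists_eq_add_of_equiv E
    (fun x y ↦ spinDer σ x y (ores P i₀ χ.z))
    (fun x x' y ↦ spinDer_add_left σ x x' y _) (fun r x y ↦ spinDer_smul_left σ r x y _)
    (fun x y ↦ spinDer_comm σ hS x y _) (fun x y n ↦ spinDer_smul_comm σ hS x y n _)
    (mres S i₀).range (mres S i₁).range
    (by
      rintro p _ ⟨x, rfl⟩
      exact ⟨χ.poly₀ p • x, by rw [mres_smul, hE₀]⟩)
    (by
      rintro p _ ⟨x, rfl⟩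
      exact ⟨χ.poly₁ p • x, by rw [mres_smul, hE₁]⟩)
    (fun n ↦ by
      obtain ⟨k, x, hx⟩ := hS.exists_extension_of_eq χ.affine₀ χ.z χ.basicOpen_z i₀ n
      exact ⟨k, x, by rw [hx, hT]⟩)
    (fun n ↦ by
      obtain ⟨k, x, hx⟩ := hS.exists_extension_of_eq χ.affine₁ χ.w χ.basicOpen_w i₁ n
      exact ⟨k, x, by rw [hx, hT']⟩)
    (by
      rintro _ ⟨x, rfl⟩ _ ⟨y, rfl⟩
      obtain ⟨p, hp⟩ := χ.poly₀.surjective (spinDer σ x y χ.z)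
      exact ⟨p, by rw [spinDer_ores, hE₀, hp]⟩)
    (by
      rintro _ ⟨x, rfl⟩ _ ⟨y, rfl⟩
      obtain ⟨p, hp⟩ := χ.poly₁.surjective (- spinDer σ x y χ.w)
      exact ⟨p, by rw [χ.spinDer_z σ i₀ i₁, spinDer_ores, map_mul, hE₁, hp, hT2, map_neg]; ring⟩)
    (fun i ↦ mres S i₀ (s i)) (fun i ↦ mres S i₀ (u i)) (fun i ↦ ⟨_, rfl⟩) (fun i ↦ ⟨_, rfl⟩)
    (by simp only [spinDer_ores, ← map_sum, hsu, map_one])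
    (fun i ↦ mres S i₁ ((-1 : Γ(P, χ.U₁)) • s' i)) (fun i ↦ mres S i₁ (u' i)) (fun i ↦ ⟨_, rfl⟩)
    (fun i ↦ ⟨_, rfl⟩)
    (by
      simp only [χ.spinDer_z σ i₀ i₁, spinDer_ores, spinDer_smul_left, ← Finset.mul_sum, ← map_sum,
        hsu', hT2, map_mul, map_neg, map_one]
      ring) n
  exact ⟨x, y, by rw [h, mres_smul, mres_smul, hT1, hT1']⟩

/-- A spinor bundle has degree one on a family of projective lines, Zariski locally on the base. -/
theorem exists_spinChart (σ : S ≅ sheafHom S (derivationSheaf (𝟙 P) c))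
    (hc : IsProjectiveLineBundle c) (hS : IsInvertible S) (b : B)
    (V : B.Opens) (hb : b ∈ V) :
    ∃ (V' : B.Opens) (_ : V' ≤ V), b ∈ V' ∧ Nonempty (SpinChart c S V') := by
  obtain ⟨V, hVV, hbV, ⟨χ⟩⟩ := hc.exists_chart b V hb
  obtain ⟨m, s, u, hsu⟩ := exists_sum_spinDer_eq_one σ hS χ.le₀ χ.affine χ.affine₀ χ.z χ.bijective₀
  -- the value of a polynomial in `z` at `z = 0`
  let ev : Γ(P, χ.U₀) →+* Γ(B, V) := Polynomial.constantCoeff.comp χ.poly₀.symm.toRingHom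
  have ev_z : ev χ.z = 0 := by
    have : χ.poly₀.symm χ.z = Polynomial.X := by rw [← χ.poly₀_X, RingEquiv.symm_apply_apply]
    simp [ev, this]
  have ev_C : ∀ r, ev (c.appLE V χ.U₀ χ.le₀ r) = r := fun r ↦ by
    have : χ.poly₀.symm (c.appLE V χ.U₀ χ.le₀ r) = Polynomial.C r := by
      rw [← χ.poly₀_C, RingEquiv.symm_apply_apply]
    simp [ev, this]
  -- a section `u₀` which does not vanish at the point `z = 0` over `b`: not all products can vanish
  -- there, and `⟨s, u⟩ ^ 2 = ⟨s, s⟩ ⟨u, u⟩`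
  obtain ⟨u₀, hu₀⟩ : ∃ u₀ : Γ(S, χ.U₀), b ∈ B.basicOpen (ev (spinDer σ u₀ u₀ χ.z)) := by
    by_contra! H
    have h1 : ∀ i, ¬ IsUnit (B.presheaf.germ V b hbV (ev (spinDer σ (s i) (u i) χ.z))) := by
      intro i hi
      have h2 : spinDer σ (s i) (u i) χ.z * spinDer σ (s i) (u i) χ.z =
          spinDer σ (u i) (u i) χ.z * spinDer σ (s i) (s i) χ.z := by
        have := congrArg (fun x ↦ spinDer σ x (s i) χ.z)
          (spinDer_smul_comm σ hS (s i) (u i) (u i) χ.z)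
        simp only [spinDer_smul_left] at this
        rwa [spinDer_comm σ hS (u i) (s i)] at this
      have h3 := hi.mul hi
      rw [← map_mul, ← map_mul, h2, map_mul, map_mul] at h3
      exact H (s i) ((B.mem_basicOpen _ b hbV).2 (isUnit_of_mul_isUnit_right h3))
    have h4 := congrArg (fun x ↦ B.presheaf.germ V b hbV (ev x)) hsu
    simp only [map_sum, map_one] at h4
    have h5 : (1 : B.presheaf.stalk b) ∈ IsLocalRing.maximalIdeal (B.presheaf.stalk b) := by
      rw [← h4]
      exact Ideal.sum_mem _ fun i _ ↦ (IsLocalRing.mem_maximalIdeal _).2 (h1 i)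
    exact (IsLocalRing.mem_maximalIdeal _).1 h5 isUnit_one
  obtain ⟨x, y, hxy⟩ := χ.exists_eq_add σ hS (mres S inf_le_left u₀)
  set i₀ : χ.U₀ ⊓ χ.U₁ ≤ χ.U₀ := inf_le_left
  set i₁ : χ.U₀ ⊓ χ.U₁ ≤ χ.U₁ := inf_le_right
  have hzw := χ.mul_eq_one _ i₀ i₁
  -- `e` agrees with `u₀` at `z = 0`, and it extends to `w y` on the second chart
  let e := u₀ - χ.z • x
  have he : mres S i₀ e = ores P i₁ χ.w • mres S i₁ y := by
    rw [map_sub, hxy, mres_smul, mres_smul]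
    abel
  have hy : mres S i₁ y = ores P i₀ χ.z • mres S i₀ e := by
    rw [he, smul_smul, hzw, one_smul]
  -- the square of `e` is a constant multiple `r ∂/∂z`, since `⟨e, e⟩ z = -⟨y, y⟩ w` on the overlap
  obtain ⟨r, hr, hr'⟩ := χ.exists_eq_appLE (f := spinDer σ e e χ.z) (g := - spinDer σ y y χ.w) (by
    rw [map_neg, ← spinDer_ores, ← spinDer_ores, he, spinDer_smul_left, spinDer_smul_right,
      χ.spinDer_z σ i₀ i₁]
    linear_combination (- spinDer σ (mres S i₁ y) (mres S i₁ y) (ores P i₁ χ.w)) *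
      (1 + ores P i₀ χ.z * ores P i₁ χ.w) * hzw)
  -- the constant is found at `z = 0`
  have hre : r = ev (spinDer σ u₀ u₀ χ.z) := by
    rw [← ev_C r, ← hr, show e = u₀ + (- χ.z) • x by simp only [e, neg_smul, sub_eq_add_neg]]
    simp only [spinDer_add_left, spinDer_add_right, spinDer_smul_left, spinDer_smul_right, map_add,
      map_mul, map_neg, ev_z]
    ring
  rw [← hre] at hu₀
  have unit : ∀ (U : P.Opens) (hU : U ≤ c ⁻¹ᵁ V), IsUnit (ores P
      (inf_le_left : U ⊓ c ⁻¹ᵁ B.basicOpen r ≤ U) (c.appLE V U hU r)) := fun U hU ↦ by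
    have h1 : ores P (inf_le_left : U ⊓ c ⁻¹ᵁ B.basicOpen r ≤ U) (c.appLE V U hU r) =
        c.appLE (B.basicOpen r) _ inf_le_right (ores B (B.basicOpen_le r) r) :=
      (congr($(c.appLE_map hU (homOfLE inf_le_left).op) r)).trans
        (congr($(c.map_appLE (inf_le_right : U ⊓ c ⁻¹ᵁ B.basicOpen r ≤ _)
          (homOfLE (B.basicOpen_le r)).op) r)).symm
    rw [h1]
    exact (isUnit_ores_basicOpen r).map (c.appLE _ _ _).hom
  have g₀ : IsGenerator (mres S (inf_le_left : χ.U₀ ⊓ c ⁻¹ᵁ B.basicOpen r ≤ χ.U₀) e) :=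
    isGenerator_of_isUnit_spinDer σ hS (f := ores P inf_le_left χ.z) (by
      rw [spinDer_ores, hr]
      exact unit _ _)
  have g₁ : IsGenerator (mres S (inf_le_left : χ.U₁ ⊓ c ⁻¹ᵁ B.basicOpen r ≤ χ.U₁) y) :=
    isGenerator_of_isUnit_spinDer σ hS (f := ores P inf_le_left χ.w) (by
      rw [spinDer_ores, ← neg_neg (spinDer σ y y χ.w), hr', map_neg]
      exact (unit _ _).neg)
  refine ⟨B.basicOpen r, (B.basicOpen_le r).trans hVV, hu₀, ⟨
    { toChart := χ.shrink r
      e₀ := mres S inf_le_left e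
      e₁ := mres S inf_le_left y
      generator₀ := g₀
      generator₁ := g₁
      transition := ?_ }⟩⟩
  intro W h₀ h₁
  replace h₀ : W ≤ χ.U₀ ⊓ c ⁻¹ᵁ B.basicOpen r := h₀
  replace h₁ : W ≤ χ.U₁ ⊓ c ⁻¹ᵁ B.basicOpen r := h₁
  change mres S h₁ (mres S inf_le_left y) =
    ores P h₀ (ores P inf_le_left χ.z) • mres S h₀ (mres S inf_le_left e)
  have := congrArg (mres S (le_inf (h₀.trans inf_le_left) (h₁.trans inf_le_left))) hy
  rw [mres_smul, mres_mres, mres_mres, ores_ores] at this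
  rw [mres_mres, mres_mres, ores_ores, this]

end

/-! ### Values of sections of a spinor bundle at disjoint sections -/

namespace SpinChart

variable {P B : Scheme.{0}} {c : P ⟶ B} {S : P.Modules} {V : B.Opens} (χ : SpinChart c S V)

/-- The section `s` is `α e₀ + β e₁`, where `e₀` and `e₁ = z e₀` are regarded as global sections of
the bundle of degree one. -/
def IsSection (s : Γ(S, c ⁻¹ᵁ V)) (α β : Γ(B, V)) : Prop :=
  mres S χ.le₀ s = (c.appLE V χ.U₀ χ.le₀ α + c.appLE V χ.U₀ χ.le₀ β * χ.z) • χ.e₀ ∧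
  mres S χ.le₁ s = (c.appLE V χ.U₁ χ.le₁ α * χ.w + c.appLE V χ.U₁ χ.le₁ β) • χ.e₁

lemma appLE_res₀ (α : Γ(B, V)) {W : P.Opens} (h : W ≤ χ.U₀) :
    ores P h (c.appLE V χ.U₀ χ.le₀ α) = c.appLE V W (h.trans χ.le₀) α :=
  congr($(c.appLE_map χ.le₀ (homOfLE h).op) α)

lemma appLE_res₁ (α : Γ(B, V)) {W : P.Opens} (h : W ≤ χ.U₁) :
    ores P h (c.appLE V χ.U₁ χ.le₁ α) = c.appLE V W (h.trans χ.le₁) α :=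
  congr($(c.appLE_map χ.le₁ (homOfLE h).op) α)

lemma IsSection.swap {χ : SpinChart c S V} {s : Γ(S, c ⁻¹ᵁ V)} {α β : Γ(B, V)}
    (h : χ.IsSection s α β) : χ.swap.IsSection s β α := by
  constructor
  · refine h.2.trans ?_
    rw [add_comm]
    rfl
  · refine h.1.trans ?_
    rw [add_comm]
    rfl

lemma ext {x y : Γ(S, c ⁻¹ᵁ V)} (h₀ : mres S χ.le₀ x = mres S χ.le₀ y)
    (h₁ : mres S χ.le₁ x = mres S χ.le₁ y) : x = y := by
  refine mres_ext fun p hp ↦ ?_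
  rw [← χ.sup_eq] at hp
  obtain hp | hp := hp
  · exact ⟨_, χ.le₀, hp, h₀⟩
  · exact ⟨_, χ.le₁, hp, h₁⟩

lemma exists_isSection (s : Γ(S, c ⁻¹ᵁ V)) : ∃ α β, χ.IsSection s α β := by
  obtain ⟨f, hf⟩ := χ.generator₀.exists_smul le_rfl (mres S χ.le₀ s)
  obtain ⟨g, hg⟩ := χ.generator₁.exists_smul le_rfl (mres S χ.le₁ s)
  rw [mres_self] at hf hg
  obtain ⟨α, β, rfl, rfl⟩ := χ.exists_linear (f := f) (g := g) (by
    refine (χ.generator₀ _ inf_le_left).1 ?_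
    have h1 := congrArg (mres S (inf_le_left : χ.U₀ ⊓ χ.U₁ ≤ χ.U₀)) hf
    have h2 := congrArg (mres S (inf_le_right : χ.U₀ ⊓ χ.U₁ ≤ χ.U₁)) hg
    rw [mres_mres, mres_smul] at h1 h2
    rw [χ.transition _ inf_le_left inf_le_right, smul_smul] at h2
    change _ • _ = _ • _
    rw [h1, ← h2, mul_comm])
  exact ⟨α, β, hf.symm, hg.symm⟩

lemma exists_section (α β : Γ(B, V)) : ∃ s, χ.IsSection s α β := by
  let U : Bool → P.Opens := fun i ↦ cond i χ.U₁ χ.U₀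
  let x : ∀ i, Γ(S, U i) := fun i ↦ match i with
    | false => (c.appLE V χ.U₀ χ.le₀ α + c.appLE V χ.U₀ χ.le₀ β * χ.z) • χ.e₀
    | true => (c.appLE V χ.U₁ χ.le₁ α * χ.w + c.appLE V χ.U₁ χ.le₁ β) • χ.e₁
  have key : ∀ (W : P.Opens) (h₀ : W ≤ χ.U₀) (h₁ : W ≤ χ.U₁),
      mres S h₀ (x false) = mres S h₁ (x true) := by
    intro W h₀ h₁
    change mres S h₀ (_ • _) = mres S h₁ (_ • _)
    rw [mres_smul, mres_smul, χ.transition W h₀ h₁, smul_smul]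
    congr 1
    simp only [map_add, map_mul, appLE_res₀, appLE_res₁]
    linear_combination (-c.appLE V W (h₀.trans χ.le₀) α) * χ.mul_eq_one W h₀ h₁
  obtain ⟨s, hs⟩ := mres_glue (M := S) (U := c ⁻¹ᵁ V) U
    (by rintro (_ | _); exacts [χ.le₀, χ.le₁])
    (by
      rw [← χ.sup_eq]
      exact sup_le (le_iSup U false) (le_iSup U true)) x
    (by
      rintro (_ | _) (_ | _)
      · rfl
      · exact key _ _ _
      · exact (key _ _ _).symm
      · rfl)
  exact ⟨s, hs false, hs true⟩

/-- The value at a section `p` of `P ⟶ B` whose image lies in the first affine line. -/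
lemma IsSection.pullSection₀ {χ : SpinChart c S V} {s : Γ(S, c ⁻¹ᵁ V)} {α β : Γ(B, V)}
    (hs : χ.IsSection s α β) {p : B ⟶ P} (hp : p ≫ c = 𝟙 B) (h : V ≤ p ⁻¹ᵁ χ.U₀) :
    mres _ (le_section hp V) (pullSection p S s) =
      (α + β * ores B h (p.app χ.U₀ χ.z)) • mres _ h (pullSection p S χ.e₀) := by
  have h1 := congrArg (fun x ↦ mres _ h (pullSection p S x)) hs.1
  simp only [pullSection_mres, pullSection_smul, mres_smul, mres_mres, map_add, map_mul] at h1
  have h2 (a : Γ(B, V)) : ores B h (p.app χ.U₀ (c.appLE V χ.U₀ χ.le₀ a)) = a := by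
    have e1 : ores B h (p.app χ.U₀ (c.appLE V χ.U₀ χ.le₀ a)) =
        p.appLE χ.U₀ V h (c.appLE V χ.U₀ χ.le₀ a) :=
      rfl
    rw [e1, ← CommRingCat.comp_apply, Scheme.Hom.appLE_comp_appLE]
    have key : ∀ (q : B ⟶ B) (hq : q = 𝟙 B) (h' : V ≤ q ⁻¹ᵁ V), q.appLE V V h' a = a := by
      rintro _ rfl h'
      exact map_rfl_apply B a
    exact key _ hp _
  rw [h2, h2] at h1
  exact h1

lemma IsSection.pullSection₁ {χ : SpinChart c S V} {s : Γ(S, c ⁻¹ᵁ V)} {α β : Γ(B, V)}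
    (hs : χ.IsSection s α β) {p : B ⟶ P} (hp : p ≫ c = 𝟙 B) (h : V ≤ p ⁻¹ᵁ χ.U₁) :
    mres _ (le_section hp V) (pullSection p S s) =
      (α * ores B h (p.app χ.U₁ χ.w) + β) • mres _ h (pullSection p S χ.e₁) := by
  rw [add_comm]
  exact hs.swap.pullSection₀ hp h

/-- The values at two sections of `P ⟶ B` are coordinates on the sections of the bundle of degree
one. -/
def Separates {p₁ p₂ : B ⟶ P} (h₁ : p₁ ≫ c = 𝟙 B) (h₂ : p₂ ≫ c = 𝟙 B) : Prop :=
  ∃ (x₁ y₁ x₂ y₂ : Γ(B, V)) (γ₁ : Γ((Scheme.Modules.pullback p₁).obj S, V))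
    (γ₂ : Γ((Scheme.Modules.pullback p₂).obj S, V)), IsGenerator γ₁ ∧ IsGenerator γ₂ ∧
    IsUnit (x₁ * y₂ - x₂ * y₁) ∧ ∀ s α β, χ.IsSection s α β →
      mres _ (le_section h₁ V) (pullSection p₁ S s) = (α * x₁ + β * y₁) • γ₁ ∧
      mres _ (le_section h₂ V) (pullSection p₂ S s) = (α * x₂ + β * y₂) • γ₂

variable {p₁ p₂ : B ⟶ P} (h₁ : p₁ ≫ c = 𝟙 B) (h₂ : p₂ ≫ c = 𝟙 B)

lemma separates_of_le₀ (k₁ : V ≤ p₁ ⁻¹ᵁ χ.U₀) (k₂ : V ≤ p₂ ⁻¹ᵁ χ.U₀)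
    (h : IsUnit (ores B k₂ (p₂.app χ.U₀ χ.z) - ores B k₁ (p₁.app χ.U₀ χ.z))) :
    χ.Separates h₁ h₂ := by
  refine ⟨1, ores B k₁ (p₁.app χ.U₀ χ.z), 1, ores B k₂ (p₂.app χ.U₀ χ.z), _, _,
    (χ.generator₀.pullSection p₁).restrict k₁,
    (χ.generator₀.pullSection p₂).restrict k₂, ?_, fun s α β hs ↦ ⟨?_, ?_⟩⟩
  rotate_left
  · rw [hs.pullSection₀ h₁ k₁, mul_one]
  · rw [hs.pullSection₀ h₂ k₂, mul_one]
  · rwa [one_mul, one_mul]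

lemma separates_of_le₁ (k₁ : V ≤ p₁ ⁻¹ᵁ χ.U₀) (k₂ : V ≤ p₂ ⁻¹ᵁ χ.U₁)
    (h : IsUnit (1 - ores B k₂ (p₂.app χ.U₁ χ.w) * ores B k₁ (p₁.app χ.U₀ χ.z))) :
    χ.Separates h₁ h₂ := by
  refine ⟨1, ores B k₁ (p₁.app χ.U₀ χ.z), ores B k₂ (p₂.app χ.U₁ χ.w), 1, _, _,
    (χ.generator₀.pullSection p₁).restrict k₁,
    (χ.generator₁.pullSection p₂).restrict k₂, ?_, fun s α β hs ↦ ⟨?_, ?_⟩⟩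
  rotate_left
  · rw [hs.pullSection₀ h₁ k₁, mul_one]
  · rw [hs.pullSection₁ h₂ k₂, mul_one]
  · rwa [one_mul]

lemma ores_app_ores (p : B ⟶ P) {U U' : P.Opens} {W : B.Opens} (h : U' ≤ U) (k : W ≤ p ⁻¹ᵁ U')
    (f : Γ(P, U)) :
    ores B k (p.app U' (ores P h f)) = ores B (k.trans (p.preimage_mono h)) (p.app U f) :=
  congr($(p.map_appLE k (homOfLE h).op) f)

lemma isUnit_ores_of_le {f : Γ(B, V)} {W : B.Opens} (hW : W ≤ V) (h : W ≤ B.basicOpen f) :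
    IsUnit (ores B hW f) := by
  rw [← ores_ores (B.basicOpen_le f) h]
  exact (isUnit_ores_basicOpen f).map _

lemma le_preimage_inf {p : B ⟶ P} (hp : p ≫ c = 𝟙 B) {W W' : B.Opens} {U : P.Opens}
    (h : W ≤ p ⁻¹ᵁ U) (h' : W ≤ W') : W ≤ p ⁻¹ᵁ (U ⊓ c ⁻¹ᵁ W') :=
  le_inf h (h'.trans (le_section hp W'))

/-- The coordinates of two distinct points in the same fiber of an affine line over `B` differ by a
unit of the local ring. -/
lemma isUnit_germ_sub (h₁ : p₁ ≫ c = 𝟙 B) (h₂ : p₂ ≫ c = 𝟙 B) (b : B) (hb : b ∈ V)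
    (k₁ : p₁ b ∈ χ.U₀) (k₂ : p₂ b ∈ χ.U₀)
    (hne : p₁ b ≠ p₂ b) :
    IsUnit (B.presheaf.germ (p₂ ⁻¹ᵁ χ.U₀) b k₂ (p₂.app χ.U₀ χ.z) -
      B.presheaf.germ (p₁ ⁻¹ᵁ χ.U₀) b k₁ (p₁.app χ.U₀ χ.z)) := by
  by_contra H
  let ev (p : B ⟶ P) (k : p b ∈ χ.U₀) : Γ(P, χ.U₀) →+* B.presheaf.stalk b :=
    (B.presheaf.germ (p ⁻¹ᵁ χ.U₀) b k).hom.comp (p.app χ.U₀).hom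
  have ev_base (p : B ⟶ P) (hp : p ≫ c = 𝟙 B) (k : p b ∈ χ.U₀) (a : Γ(B, V)) :
      ev p k (c.appLE V χ.U₀ χ.le₀ a) = B.presheaf.germ V b hb a := by
    change B.presheaf.germ (p ⁻¹ᵁ χ.U₀) b k (p.app χ.U₀ (c.appLE V χ.U₀ χ.le₀ a)) = _
    have e1 : p.app χ.U₀ (c.appLE V χ.U₀ χ.le₀ a) =
        (p ≫ c).appLE V (p ⁻¹ᵁ χ.U₀) (p.preimage_mono χ.le₀) a := by
      rw [← Scheme.Hom.appLE_comp_appLE _ _ _ _ _ χ.le₀ le_rfl]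
      simp only [CommRingCat.comp_apply, Scheme.Hom.app_eq_appLE]
    rw [e1]
    have key : ∀ (q : B ⟶ B) (hq : q = 𝟙 B) (h' : p ⁻¹ᵁ χ.U₀ ≤ q ⁻¹ᵁ V),
        B.presheaf.germ (p ⁻¹ᵁ χ.U₀) b k (q.appLE V _ h' a) = B.presheaf.germ V b hb a := by
      rintro _ rfl h'
      exact congr($(B.presheaf.germ_res (homOfLE h') b k) a)
    exact key _ hp _
  have hev : (IsLocalRing.residue _).comp (ev p₁ k₁) = (IsLocalRing.residue _).comp (ev p₂ k₂) := by
    have h : ((IsLocalRing.residue _).comp (ev p₁ k₁)).comp χ.poly₀.toRingHom =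
        ((IsLocalRing.residue _).comp (ev p₂ k₂)).comp χ.poly₀.toRingHom := by
      refine Polynomial.ringHom_ext (fun a ↦ ?_) ?_
      · simp only [RingHom.comp_apply, RingEquiv.toRingHom_eq_coe, RingHom.coe_coe, χ.poly₀_C,
          ev_base p₁ h₁, ev_base p₂ h₂]
      · simp only [RingHom.comp_apply, RingEquiv.toRingHom_eq_coe, RingHom.coe_coe, χ.poly₀_X]
        rw [eq_comm, ← sub_eq_zero, ← map_sub, IsLocalRing.residue_eq_zero_iff]
        exact H
    ext f
    obtain ⟨q, rfl⟩ := χ.poly₀.surjective f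
    exact congr($h q)
  have hmem : ∀ (p : B ⟶ P) (k : p b ∈ χ.U₀) (f : Γ(P, χ.U₀)),
      p b ∈ P.basicOpen f ↔ IsLocalRing.residue _ (ev p k f) ≠ 0 := fun p k f ↦ by
    rw [IsLocalRing.residue_ne_zero_iff_isUnit]
    change b ∈ p ⁻¹ᵁ P.basicOpen f ↔ _
    rw [Scheme.preimage_basicOpen, B.mem_basicOpen _ b k]
    rfl
  have hiff : ∀ f : Γ(P, χ.U₀), p₁ b ∈ P.basicOpen f ↔ p₂ b ∈ P.basicOpen f := fun f ↦ by
    rw [hmem p₁ k₁, hmem p₂ k₂]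
    exact not_congr (by rw [show IsLocalRing.residue _ (ev p₁ k₁ f) = _ from congr($hev f)]; rfl)
  refine hne (Inseparable.eq (inseparable_iff_forall_isOpen.2 fun U hU ↦ ?_))
  constructor
  · intro h
    obtain ⟨f, hf, hx⟩ := exists_basicOpen χ.affine₀ (inf_le_left : χ.U₀ ⊓ ⟨U, hU⟩ ≤ χ.U₀) ⟨k₁, h⟩
    exact (hf ((hiff f).1 hx)).2
  · intro h
    obtain ⟨f, hf, hx⟩ := exists_basicOpen χ.affine₀ (inf_le_left : χ.U₀ ⊓ ⟨U, hU⟩ ≤ χ.U₀) ⟨k₂, h⟩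
    exact (hf ((hiff f).2 hx)).2

lemma exists_separates_of_mem₀ (h₁ : p₁ ≫ c = 𝟙 B) (h₂ : p₂ ≫ c = 𝟙 B) (b : B) (hb : b ∈ V)
    (k₁ : p₁ b ∈ χ.U₀) (k₂ : p₂ b ∈ χ.U₀)
    (hne : p₁ b ≠ p₂ b) : ∃ f : Γ(B, V), b ∈ B.basicOpen f ∧ (χ.shrink f).Separates h₁ h₂ := by
  set W := p₁ ⁻¹ᵁ χ.U₀ ⊓ p₂ ⁻¹ᵁ χ.U₀
  set d : Γ(B, W) := ores B inf_le_right (p₂.app χ.U₀ χ.z) - ores B inf_le_left (p₁.app χ.U₀ χ.z)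
  have hbW : b ∈ W := ⟨k₁, k₂⟩
  have hbd : b ∈ B.basicOpen d := by
    rw [B.mem_basicOpen _ b hbW, map_sub]
    have := χ.isUnit_germ_sub h₁ h₂ b hb k₁ k₂ hne
    rw [← congr($(B.presheaf.germ_res (homOfLE (inf_le_right : W ≤ _)) b hbW) (p₂.app χ.U₀ χ.z)),
      ← congr($(B.presheaf.germ_res (homOfLE (inf_le_left : W ≤ _)) b hbW) (p₁.app χ.U₀ χ.z))] at this
    exact this
  obtain ⟨f, hf, hbf⟩ := exists_basicOpen χ.affine (inf_le_left : V ⊓ B.basicOpen d ≤ V) ⟨hb, hbd⟩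
  have hfd : B.basicOpen f ≤ B.basicOpen d := hf.trans inf_le_right
  have hfW : B.basicOpen f ≤ W := hfd.trans (B.basicOpen_le d)
  have hu := isUnit_ores_of_le hfW hfd
  rw [map_sub, ores_ores, ores_ores] at hu
  refine ⟨f, hbf, separates_of_le₀ _ h₁ h₂ (le_preimage_inf h₁ (hfW.trans inf_le_left) le_rfl)
    (le_preimage_inf h₂ (hfW.trans inf_le_right) le_rfl) ?_⟩
  have e₁ := ores_app_ores p₁ (inf_le_left : χ.U₀ ⊓ c ⁻¹ᵁ B.basicOpen f ≤ χ.U₀)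
    (le_preimage_inf h₁ (hfW.trans inf_le_left) le_rfl) χ.z
  have e₂ := ores_app_ores p₂ (inf_le_left : χ.U₀ ⊓ c ⁻¹ᵁ B.basicOpen f ≤ χ.U₀)
    (le_preimage_inf h₂ (hfW.trans inf_le_right) le_rfl) χ.z
  rw [← e₁, ← e₂] at hu
  exact hu

lemma exists_separates_of_mem₁ (h₁ : p₁ ≫ c = 𝟙 B) (h₂ : p₂ ≫ c = 𝟙 B) (b : B) (hb : b ∈ V)
    (k₁ : p₁ b ∈ χ.U₀) (k₂ : p₂ b ∈ χ.U₁)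
    (hne : p₁ b ∉ χ.U₁ ∨ p₂ b ∉ χ.U₀) :
    ∃ f : Γ(B, V), b ∈ B.basicOpen f ∧ (χ.shrink f).Separates h₁ h₂ := by
  set W := p₁ ⁻¹ᵁ χ.U₀ ⊓ p₂ ⁻¹ᵁ χ.U₁
  set x : Γ(B, W) := ores B inf_le_right (p₂.app χ.U₁ χ.w)
  set y : Γ(B, W) := ores B inf_le_left (p₁.app χ.U₀ χ.z)
  have hbW : b ∈ W := ⟨k₁, k₂⟩
  have hbd : b ∈ B.basicOpen (1 - x * y) := by
    rw [B.mem_basicOpen _ b hbW, map_sub, map_one]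
    refine IsLocalRing.isUnit_one_sub_self_of_mem_nonunits _ fun h ↦ ?_
    rw [← B.mem_basicOpen _ b hbW, Scheme.basicOpen_mul] at h
    obtain ⟨hx, hy⟩ := h
    rw [basicOpen_ores, ← Scheme.preimage_basicOpen] at hx hy
    obtain h | h := hne
    · have : p₁ b ∈ P.basicOpen χ.z := hy.2
      rw [χ.basicOpen_z] at this
      exact h this.2
    · have : p₂ b ∈ P.basicOpen χ.w := hx.2
      rw [χ.basicOpen_w] at this
      exact h this.1
  obtain ⟨f, hf, hbf⟩ := exists_basicOpen χ.affine (inf_le_left : V ⊓ B.basicOpen _ ≤ V) ⟨hb, hbd⟩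
  have hfd := hf.trans inf_le_right
  have hfW : B.basicOpen f ≤ W := hfd.trans (B.basicOpen_le _)
  have hu := isUnit_ores_of_le hfW hfd
  rw [map_sub, map_mul, map_one, ores_ores, ores_ores] at hu
  refine ⟨f, hbf, separates_of_le₁ _ h₁ h₂ (le_preimage_inf h₁ (hfW.trans inf_le_left) le_rfl)
    (le_preimage_inf h₂ (hfW.trans inf_le_right) le_rfl) ?_⟩
  have e₁ := ores_app_ores p₁ (inf_le_left : χ.U₀ ⊓ c ⁻¹ᵁ B.basicOpen f ≤ χ.U₀)
    (le_preimage_inf h₁ (hfW.trans inf_le_left) le_rfl) χ.z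
  have e₂ := ores_app_ores p₂ (inf_le_left : χ.U₁ ⊓ c ⁻¹ᵁ B.basicOpen f ≤ χ.U₁)
    (le_preimage_inf h₂ (hfW.trans inf_le_right) le_rfl) χ.w
  rw [← e₁, ← e₂] at hu
  exact hu

end SpinChart

/-- If two sections of a family of projective lines are disjoint, then the sections of a spinor
bundle are determined by their values at the two sections. -/
lemma exists_separates {P B : Scheme.{0}} {c : P ⟶ B} {S : P.Modules}
    (σ : S ≅ sheafHom S (derivationSheaf (𝟙 P) c))
    (hc : IsProjectiveLineBundle c) (hS : IsInvertible S) {p₁ p₂ : B ⟶ P} (h₁ : p₁ ≫ c = 𝟙 B)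
    (h₂ : p₂ ≫ c = 𝟙 B) (b : B) (hne : p₁ b ≠ p₂ b) (V : B.Opens) (hb : b ∈ V) :
    ∃ (V' : B.Opens) (_ : V' ≤ V), b ∈ V' ∧ ∃ χ : SpinChart c S V', χ.Separates h₁ h₂ := by
  obtain ⟨V', hV', hb', ⟨χ⟩⟩ := exists_spinChart σ hc hS b V hb
  have mem {p : B ⟶ P} (hp : p ≫ c = 𝟙 B) : p b ∈ χ.U₀ ∨ p b ∈ χ.U₁ := by
    have : p b ∈ χ.U₀ ⊔ χ.U₁ := by
      rw [χ.sup_eq]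
      exact le_section hp V' hb'
    exact this
  have shrink {χ : SpinChart c S V'} (h : ∃ f : Γ(B, V'), b ∈ B.basicOpen f ∧
      (χ.shrink f).Separates h₁ h₂) :
      ∃ (V' : B.Opens) (_ : V' ≤ V), b ∈ V' ∧ ∃ χ : SpinChart c S V', χ.Separates h₁ h₂ := by
    obtain ⟨f, hf, h⟩ := h
    exact ⟨_, (B.basicOpen_le f).trans hV', hf, _, h⟩
  by_cases k₁ : p₁ b ∈ χ.U₀ <;> by_cases k₂ : p₂ b ∈ χ.U₀
  · exact shrink (χ.exists_separates_of_mem₀ h₁ h₂ b hb' k₁ k₂ hne)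
  · exact shrink (χ.exists_separates_of_mem₁ h₁ h₂ b hb' k₁ ((mem h₂).resolve_left k₂) (.inr k₂))
  · exact shrink (χ.swap.exists_separates_of_mem₁ h₁ h₂ b hb' ((mem h₁).resolve_left k₁) k₂
      (.inl k₁))
  · exact shrink (χ.swap.exists_separates_of_mem₀ h₁ h₂ b hb' ((mem h₁).resolve_left k₁)
      ((mem h₂).resolve_left k₂) hne)

section Restriction

variable {P B : Scheme.{0}} {c : P ⟶ B} {S : P.Modules} {p₁ p₂ : B ⟶ P}

lemma eq_zero_of_pullSection_eq_zero (σ : S ≅ sheafHom S (derivationSheaf (𝟙 P) c))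
    (hc : IsProjectiveLineBundle c) (hS : IsInvertible S) (h₁ : p₁ ≫ c = 𝟙 B) (h₂ : p₂ ≫ c = 𝟙 B)
    (hne : ∀ b, p₁ b ≠ p₂ b)
    {V : B.Opens} {s : Γ(S, c ⁻¹ᵁ V)}
    (hs₁ : mres _ (le_section h₁ V) (pullSection p₁ S s) = 0)
    (hs₂ : mres _ (le_section h₂ V) (pullSection p₂ S s) = 0) : s = 0 := by
  refine mres_ext fun p hp ↦ ?_
  obtain ⟨V', hV', hb, χ, x₁, y₁, x₂, y₂, γ₁, γ₂, hγ₁, hγ₂, hu, h⟩ :=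
    exists_separates σ hc hS h₁ h₂ (c p) (hne _) V hp
  refine ⟨c ⁻¹ᵁ V', c.preimage_mono hV', hb, ?_⟩
  obtain ⟨α, β, hαβ⟩ := χ.exists_isSection (mres S (c.preimage_mono hV') s)
  obtain ⟨e₁, e₂⟩ := h _ α β hαβ
  have e₁' := congrArg (mres _ hV') hs₁
  have e₂' := congrArg (mres _ hV') hs₂
  rw [mres_mres, map_zero] at e₁' e₂'
  rw [pullSection_mres, mres_mres, e₁', ← mres_self le_rfl γ₁] at e₁
  rw [pullSection_mres, mres_mres, e₂', ← mres_self le_rfl γ₂] at e₂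
  replace e₁ := hγ₁.eq_zero le_rfl e₁.symm
  replace e₂ := hγ₂.eq_zero le_rfl e₂.symm
  obtain rfl : α = 0 := hu.mul_left_eq_zero.1 (by linear_combination y₂ * e₁ - y₁ * e₂)
  obtain rfl : β = 0 := hu.mul_left_eq_zero.1 (by linear_combination x₁ * e₂ - x₂ * e₁)
  refine χ.ext ?_ ?_
  · rw [hαβ.1]
    simp
  · rw [hαβ.2]
    simp

/-- Locally on the base there is a section of a spinor bundle with a prescribed value at `p₁` and
with value zero at `p₂`. -/
lemma exists_pullSection_eq (σ : S ≅ sheafHom S (derivationSheaf (𝟙 P) c))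
    (hc : IsProjectiveLineBundle c) (hS : IsInvertible S) (h₁ : p₁ ≫ c = 𝟙 B) (h₂ : p₂ ≫ c = 𝟙 B)
    (hne : ∀ b, p₁ b ≠ p₂ b)
    {V : B.Opens} (ξ : Γ((Scheme.Modules.pullback p₁).obj S, V)) (b : B)
    (hb : b ∈ V) : ∃ (V' : B.Opens) (h : V' ≤ V) (s : Γ(S, c ⁻¹ᵁ V')), b ∈ V' ∧
      mres _ (le_section h₁ V') (pullSection p₁ S s) = mres _ h ξ ∧
      mres _ (le_section h₂ V') (pullSection p₂ S s) = 0 := by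
  obtain ⟨V', hV', hb, χ, x₁, y₁, x₂, y₂, γ₁, γ₂, hγ₁, hγ₂, hu, h⟩ :=
    exists_separates σ hc hS h₁ h₂ b (hne _) V hb
  obtain ⟨r, hr⟩ := hγ₁.exists_smul le_rfl (mres _ hV' ξ)
  rw [mres_self] at hr
  obtain ⟨d, hd⟩ := hu.exists_left_inv
  obtain ⟨s, hs⟩ := χ.exists_section (r * d * y₂) (- (r * d * x₂))
  obtain ⟨e₁, e₂⟩ := h _ _ _ hs
  refine ⟨V', hV', s, hb, ?_, ?_⟩
  · rw [e₁, ← hr]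
    congr 1
    linear_combination r * hd
  · rw [e₂]
    convert zero_smul Γ(B, V') γ₂ using 2
    ring

/-- A section of a spinor bundle on a family of projective lines is determined by its values at
two disjoint sections of the family. -/
lemma eq_zero_of_comp_restrictToSection (σ : S ≅ sheafHom S (derivationSheaf (𝟙 P) c))
    (hc : IsProjectiveLineBundle c) (hS : IsInvertible S) (h₁ : p₁ ≫ c = 𝟙 B) (h₂ : p₂ ≫ c = 𝟙 B)
    (hne : ∀ b, p₁ b ≠ p₂ b)
    {Z : B.Modules} {y : Z ⟶ (Scheme.Modules.pushforward c).obj S}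
    (hy₁ : y ≫ restrictToSection c p₁ h₁ S = 0) (hy₂ : y ≫ restrictToSection c p₂ h₂ S = 0) :
    y = 0 := by
  refine mod_hom_ext fun V z ↦ ?_
  exact eq_zero_of_pullSection_eq_zero σ hc hS h₁ h₂ hne (s := y.app V z)
    congr(($hy₁).app V z) congr(($hy₂).app V z)

/-- The values of a section of a spinor bundle at two disjoint sections of a family of projective
lines can be prescribed. -/
lemma eq_zero_of_restrictToSection_comp (σ : S ≅ sheafHom S (derivationSheaf (𝟙 P) c))
    (hc : IsProjectiveLineBundle c) (hS : IsInvertible S) (h₁ : p₁ ≫ c = 𝟙 B) (h₂ : p₂ ≫ c = 𝟙 B)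
    (hne : ∀ b, p₁ b ≠ p₂ b)
    {Z : B.Modules} {g₁ : (Scheme.Modules.pullback p₁).obj S ⟶ Z}
    {g₂ : (Scheme.Modules.pullback p₂).obj S ⟶ Z}
    (h : restrictToSection c p₁ h₁ S ≫ g₁ + restrictToSection c p₂ h₂ S ≫ g₂ = 0) : g₁ = 0 := by
  refine mod_hom_ext fun V ξ ↦ mres_ext fun b hb ↦ ?_
  obtain ⟨V', hV', s, hb', e₁, e₂⟩ := exists_pullSection_eq σ hc hS h₁ h₂ hne ξ b hb
  refine ⟨V', hV', hb', ?_⟩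
  have h3 : g₁.app V' (mres _ (le_section h₁ V') (pullSection p₁ S s)) +
    g₂.app V' (mres _ (le_section h₂ V') (pullSection p₂ S s)) = 0 := congr(($h).app V' s)
  rw [e₁, e₂, map_zero, add_zero, app_mres] at h3
  rw [h3]
  exact (map_zero _).symm

end Restriction

section Constant

variable {P B X Y : Scheme.{0}} {c : P ⟶ B} {S : P.Modules}

/-- If `φ` is constant on the fibers of a family of projective lines, then `S^∨ ⊗ φ^* T_X` has no
sections, because `S^∨` has degree `-1` on the fibers. -/
lemma localHom_eq_zero (σ : S ≅ sheafHom S (derivationSheaf (𝟙 P) c))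
    (hc : IsProjectiveLineBundle c) (hS : IsInvertible S) (q : B ⟶ X) {φ : P ⟶ X} (x : X ⟶ Y)
    (hφ : φ = c ≫ q) {V : B.Opens} (h : LocalHom S (derivationSheaf φ x) (c ⁻¹ᵁ V)) : h = 0 := by
  let ev (W : P.Opens) (hW : W ≤ c ⁻¹ᵁ V) (s : Γ(S, W)) (A : X.Opens) (hA : W ≤ φ ⁻¹ᵁ A)
    (a : Γ(X, A)) : Γ(P, W) := DerivationAlong.toFun (h.toFun W hW s) A W le_rfl hA a
  have ev_res (W W' : P.Opens) (hW : W ≤ c ⁻¹ᵁ V) (k : W' ≤ W) (s : Γ(S, W)) (A : X.Opens)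
      (hA : W ≤ φ ⁻¹ᵁ A) (a : Γ(X, A)) :
      ev W' (k.trans hW) (mres S k s) A (k.trans hA) a = ores P k (ev W hW s A hA a) := by
    have h1 : h.toFun W' (k.trans hW) (mres S k s) = DerivationAlong.res k (h.toFun W hW s) :=
      h.map_res k hW s
    simp only [ev, h1]
    have := DerivationAlong.map_res (h.toFun W hW s) le_rfl k le_rfl hA (k.trans hA) a
    rw [map_rfl_apply] at this
    exact this
  have ev_smul (W : P.Opens) (hW : W ≤ c ⁻¹ᵁ V) (r : Γ(P, W)) (s : Γ(S, W)) (A : X.Opens)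
      (hA : W ≤ φ ⁻¹ᵁ A) (a : Γ(X, A)) :
      ev W hW (r • s) A hA a = r * ev W hW s A hA a := by
    have h1 : h.toFun W hW (r • s) = r • h.toFun W hW s := h.map_smul _ _ _ _
    simp only [ev, h1]
    exact congrArg (· * _) (map_rfl_apply P r)
  have key (W : P.Opens) (hW : W ≤ c ⁻¹ᵁ V) (s : Γ(S, W)) (A : X.Opens) (hA : W ≤ φ ⁻¹ᵁ A)
      (a : Γ(X, A)) : ev W hW s A hA a = 0 := by
    refine ores_ext fun p hp ↦ ?_
    have hA' := hA
    rw [hφ, Scheme.Hom.comp_preimage] at hA'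
    obtain ⟨V', hV', hb, ⟨χ⟩⟩ := exists_spinChart σ hc hS (c p) (V ⊓ q ⁻¹ᵁ A) ⟨hW hp, hA' hp⟩
    have hV : c ⁻¹ᵁ V' ≤ c ⁻¹ᵁ V := c.preimage_mono (hV'.trans inf_le_left)
    have hA : c ⁻¹ᵁ V' ≤ φ ⁻¹ᵁ A := by
      rw [hφ, Scheme.Hom.comp_preimage]
      exact c.preimage_mono (hV'.trans inf_le_right)
    obtain ⟨z₀, z₁⟩ := χ.eq_zero_of_mul_eq (f := ev χ.U₀ (χ.le₀.trans hV) χ.e₀ A (χ.le₀.trans hA) a)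
      (g := ev χ.U₁ (χ.le₁.trans hV) χ.e₁ A (χ.le₁.trans hA) a) (by
        rw [map_mul, ← ev_res, ← ev_res, χ.transition _ inf_le_left inf_le_right, ev_smul])
    have : p ∈ χ.U₀ ⊔ χ.U₁ := by
      rw [χ.sup_eq]
      exact hb
    obtain h | h := this
    · refine ⟨W ⊓ χ.U₀, inf_le_left, ⟨hp, h⟩, ?_⟩
      obtain ⟨r, hr⟩ := χ.generator₀.exists_smul inf_le_right (mres S (inf_le_left : W ⊓ χ.U₀ ≤ W) s)
      rw [← ev_res, ← hr, ev_smul, ev_res _ _ (χ.le₀.trans hV) inf_le_right χ.e₀ A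
        (χ.le₀.trans hA), z₀, map_zero, mul_zero, map_zero]
    · refine ⟨W ⊓ χ.U₁, inf_le_left, ⟨hp, h⟩, ?_⟩
      obtain ⟨r, hr⟩ := χ.generator₁.exists_smul inf_le_right (mres S (inf_le_left : W ⊓ χ.U₁ ≤ W) s)
      rw [← ev_res, ← hr, ev_smul, ev_res _ _ (χ.le₁.trans hV) inf_le_right χ.e₁ A
        (χ.le₁.trans hA), z₁, map_zero, mul_zero, map_zero]
  refine LocalHom.ext ?_
  funext W hW s
  refine DerivationAlong.ext ?_
  funext A W' hU hA a
  have h1 : h.toFun W' (hU.trans hW) (mres S hU s) = DerivationAlong.res hU (h.toFun W hW s) :=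
    h.map_res hU hW s
  have h2 := key W' (hU.trans hW) (mres S hU s) A hA a
  simp only [ev, h1] at h2
  exact h2

/-- If `φ` factors through the base, then the direct image of `S^∨ ⊗ φ^* T_X` vanishes. -/
lemma isZero_pushforward_sheafHom (σ : S ≅ sheafHom S (derivationSheaf (𝟙 P) c))
    (hc : IsProjectiveLineBundle c) (hS : IsInvertible S) (q : B ⟶ X) {φ : P ⟶ X} (x : X ⟶ Y)
    (hφ : φ = c ≫ q) :
    IsZero ((Scheme.Modules.pushforward c).obj (sheafHom S (derivationSheaf φ x))) := by
  rw [IsZero.iff_id_eq_zero]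
  exact mod_hom_ext fun V h ↦ localHom_eq_zero σ hc hS q x hφ (V := V) h

end Constant

/-! ### Constancy on geometric fibers -/

section Polynomials

open Polynomial

/-- In characteristic zero, a fraction of polynomials with derivative zero is constant. -/
lemma exists_eq_C_mul_of_wronskian_eq_zero {K : Type*} [Field K] [CharZero K] {G n : K[X]}
    (hG : G ≠ 0)
    (h : wronskian G n = 0) : ∃ r : K, n = C r * G := by
  classical
  let _ := EuclideanDomain.gcdMonoid K[X]
  obtain ⟨G', n', h1, h2, h3⟩ := extract_gcd G n
  rw [gcd_isUnit_iff] at h3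
  set d := GCDMonoid.gcd G n
  have hd : d ≠ 0 := fun hd ↦ hG (by rw [h1, hd, zero_mul])
  have h4 : d * d * wronskian G' n' = 0 := by
    rw [← h, h1, h2]
    simp only [wronskian, derivative_mul]
    ring
  obtain ⟨h5, h6⟩ := h3.wronskian_eq_zero_iff.1
    ((mul_eq_zero.1 h4).resolve_left (mul_ne_zero hd hd))
  obtain ⟨a, ha⟩ : ∃ a, G' = C a := ⟨_, eq_C_of_derivative_eq_zero h5⟩
  obtain ⟨b, hb⟩ : ∃ b, n' = C b := ⟨_, eq_C_of_derivative_eq_zero h6⟩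
  have ha0 : a ≠ 0 := fun h ↦ hG (by rw [h1, ha, h, C_0, mul_zero])
  refine ⟨b * a⁻¹, ?_⟩
  rw [h2, h1, ha, hb, C_mul]
  have : C a⁻¹ * C a = (1 : K[X]) := by rw [← C_mul, inv_mul_cancel₀ ha0, C_1]
  linear_combination (-d * C b) * this

/-- Over a local ring, a polynomial with a unit among its coefficients is not a zero divisor. -/
lemma eq_zero_of_mul_eq_zero_of_map_residue_ne_zero {R : Type*} [CommRing R] [IsLocalRing R]
    {F H : R[X]} (h : F * H = 0) (hH : H.map (IsLocalRing.residue R) ≠ 0) : F = 0 := by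
  have hH' : H ∈ nonZeroDivisors R[X] := by
    rw [Polynomial.mem_nonZeroDivisors_iff]
    intro a ha
    by_contra hne
    refine hH ?_
    ext n
    rw [coeff_map, coeff_zero, IsLocalRing.residue_eq_zero_iff]
    intro hu
    have := congrArg (coeff · n) ha
    simp only [coeff_smul, coeff_zero, smul_eq_mul] at this
    exact hne (hu.mul_left_eq_zero.1 this)
  exact (mem_nonZeroDivisors_iff.1 hH').2 F h

end Polynomials

namespace Chart

open Polynomial

variable {P B : Scheme.{0}} {c : P ⟶ B} {V : B.Opens} (χ : Chart c V) {K : Type} [Field K]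
  (κ : Γ(B, V) →+* K)

/-- The homomorphism on functions which corresponds to the map from the affine line over a field `K`
to the first affine line of a chart, for a ring homomorphism `κ` from the functions on the base to
`K`. -/
def fiberRingHom : Γ(P, χ.U₀) →+* K[X] := (mapRingHom κ).comp χ.poly₀.symm.toRingHom

lemma fiberRingHom_poly₀ (p : Polynomial Γ(B, V)) : χ.fiberRingHom κ (χ.poly₀ p) = p.map κ := by
  simp [fiberRingHom]

lemma fiberRingHom_z : χ.fiberRingHom κ χ.z = X := by
  rw [← χ.poly₀_X, fiberRingHom_poly₀, map_X]

lemma fiberRingHom_appLE (r : Γ(B, V)) :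
    χ.fiberRingHom κ (c.appLE V χ.U₀ χ.le₀ r) = C (κ r) := by
  rw [← χ.poly₀_C, fiberRingHom_poly₀, map_C]

lemma ringHom_ext₀ {L : Type*} [CommRing L] {e e' : Γ(P, χ.U₀) →+* L}
    (h : ∀ r, e (c.appLE V χ.U₀ χ.le₀ r) = e' (c.appLE V χ.U₀ χ.le₀ r)) (hz : e χ.z = e' χ.z) :
    e = e' := by
  have : e.comp χ.poly₀.toRingHom = e'.comp χ.poly₀.toRingHom := by
    refine Polynomial.ringHom_ext (fun a ↦ ?_) ?_
    · simpa using h a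
    · simpa using hz
  ext f
  obtain ⟨q, rfl⟩ := χ.poly₀.surjective f
  exact congr($this q)

/-- The first affine line of the geometric fiber. -/
def fiberMap : Spec (.of K[X]) ⟶ P :=
  Spec.map (CommRingCat.ofHom (χ.fiberRingHom κ)) ≫ χ.affine₀.fromSpec

/-- The geometric point of the base given by a homomorphism to a field. -/
def basePoint : Spec (.of K) ⟶ B := Spec.map (CommRingCat.ofHom κ) ≫ χ.affine.fromSpec

lemma basePoint_mem (p : Spec (.of K)) : χ.basePoint κ p ∈ V := by
  rw [← SetLike.mem_coe, ← χ.affine.range_fromSpec]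
  exact ⟨_, (Scheme.Hom.comp_apply _ _ _).symm⟩

lemma isPullback_fiberRingHom :
    IsPullback (Spec.map (CommRingCat.ofHom (C : K →+* K[X])))
      (Spec.map (CommRingCat.ofHom (χ.fiberRingHom κ))) (χ.basePoint κ)
      (χ.affine₀.fromSpec ≫ c) := by
  let _ := κ.toAlgebra
  let _ : Algebra Γ(B, V)[X] K[X] := Polynomial.algebra _ _
  have h1 := CommRingCat.isPushout_of_isPushout Γ(B, V) K Γ(B, V)[X] K[X]
  have h2 : IsPushout (CommRingCat.ofHom κ) (c.appLE V χ.U₀ χ.le₀)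
      (CommRingCat.ofHom (C : K →+* K[X])) (CommRingCat.ofHom (χ.fiberRingHom κ)) := by
    refine h1.of_iso (Iso.refl _) (Iso.refl _) χ.poly₀.toCommRingCatIso (Iso.refl _) ?_ ?_ ?_ ?_
    · rfl
    · ext r
      exact χ.poly₀_C r
    · rfl
    · exact CommRingCat.hom_ext (RingHom.ext fun r ↦ (χ.fiberRingHom_poly₀ κ r).symm)
  have h3 := isPullback_SpecMap_of_isPushout _ _ _ _ h2
  have h4 : IsPullback (Spec.map (CommRingCat.ofHom (C : K →+* K[X])))
      (Spec.map (CommRingCat.ofHom (χ.fiberRingHom κ)))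
      (Spec.map (CommRingCat.ofHom κ) ≫ χ.affine.fromSpec)
      (Spec.map (c.appLE V χ.U₀ χ.le₀) ≫ χ.affine.fromSpec) :=
    ⟨⟨by rw [← Category.assoc, h3.w, Category.assoc]⟩,
      ⟨PullbackCone.isLimitOfCompMono _ _ χ.affine.fromSpec h3.cone h3.isLimit⟩⟩
  rwa [χ.affine.SpecMap_appLE_fromSpec c χ.affine₀ χ.le₀] at h4

lemma fiberMap_comp : χ.fiberMap κ ≫ c = Spec.map (CommRingCat.ofHom C) ≫ χ.basePoint κ := by
  rw [(χ.isPullback_fiberRingHom κ).w, fiberMap, Category.assoc]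

/-- The affine line given by `fiberMap` is the open subset of the geometric fiber that lies over
`U₀`. -/
lemma exists_lift_fiberMap : ∃ j : Spec (.of K[X]) ⟶ pullback c (χ.basePoint κ),
    IsOpenImmersion j ∧ j ≫ pullback.fst _ _ = χ.fiberMap κ ∧
    j ≫ pullback.snd _ _ = Spec.map (CommRingCat.ofHom C) ∧
    ∀ p, pullback.fst c (χ.basePoint κ) p ∈ χ.U₀ → p ∈ Set.range j := by
  let j := pullback.lift (χ.fiberMap κ) (Spec.map (CommRingCat.ofHom C)) (χ.fiberMap_comp κ)
  have hf : j ≫ pullback.fst _ _ = χ.fiberMap κ := pullback.lift_fst _ _ _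
  have hs : j ≫ pullback.snd _ _ = Spec.map (CommRingCat.ofHom C) := pullback.lift_snd _ _ _
  have h1 := χ.isPullback_fiberRingHom κ
  rw [← hs] at h1
  have h2 := IsPullback.of_right h1 hf (IsPullback.of_hasPullback c (χ.basePoint κ)).flip
  refine ⟨j, MorphismProperty.of_isPullback (P := @IsOpenImmersion) h2.flip inferInstance, hf, hs,
    fun p hp ↦ ?_⟩
  rw [← SetLike.mem_coe, ← χ.affine₀.range_fromSpec] at hp
  obtain ⟨q, hq⟩ := hp
  obtain ⟨r, hr, -⟩ := Scheme.Pullback.exists_preimage_pullback p q hq.symm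
  refine ⟨h2.isoPullback.inv r, ?_⟩
  rw [← hr, ← Scheme.Hom.comp_apply, h2.isoPullback_inv_fst]

lemma mem_fiberMap_preimage (p : Spec (.of K[X])) (g : Γ(P, χ.U₀)) :
    χ.fiberMap κ p ∈ P.basicOpen g ↔ χ.fiberRingHom κ g ∉ p.asIdeal := by
  change p ∈ χ.fiberMap κ ⁻¹ᵁ P.basicOpen g ↔ _
  rw [fiberMap, Scheme.Hom.comp_preimage, χ.affine₀.fromSpec_preimage_basicOpen]
  rfl

lemma fiberMap_mem (p : Spec (.of K[X])) : χ.fiberMap κ p ∈ χ.U₀ := by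
  rw [← SetLike.mem_coe, ← χ.affine₀.range_fromSpec]
  exact ⟨_, (Scheme.Hom.comp_apply _ _ _).symm⟩

end Chart

lemma exists_lift_basicOpen {P : Scheme.{0}} {U : P.Opens} (hU : IsAffineOpen U) {L : Type}
    [CommRing L] (e : Γ(P, U) →+* L) (g : Γ(P, U)) (hg : IsUnit (e g)) :
    ∃ e' : Γ(P, P.basicOpen g) →+* L, (∀ f, e' (ores P (P.basicOpen_le g) f) = e f) ∧
      Spec.map (CommRingCat.ofHom e) ≫ hU.fromSpec =
        Spec.map (CommRingCat.ofHom e') ≫ (hU.basicOpen g).fromSpec := by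
  have := hU.isLocalization_basicOpen g
  let e' : Γ(P, P.basicOpen g) →+* L := IsLocalization.Away.lift g hg
  have he (f) : e' (ores P (P.basicOpen_le g) f) = e f := IsLocalization.Away.lift_eq g hg f
  refine ⟨e', he, ?_⟩
  rw [← hU.map_fromSpec (hU.basicOpen g) (homOfLE (P.basicOpen_le g)).op, ← Category.assoc,
    ← Spec.map_comp]
  congr 2
  exact CommRingCat.hom_ext (RingHom.ext fun f ↦ (he f).symm)

/-- Two points with values in a field of an affine open set have the same image in `X` if they
agree on the functions coming from `X`. -/
lemma comp_eq_of_ringHom {P X : Scheme.{0}} {U : P.Opens} (hU : IsAffineOpen U) (φ : P ⟶ X)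
    {L : Type} [Field L] (e₁ e₂ : Γ(P, U) →+* L) (g : Γ(P, U)) (h₁ : e₁ g ≠ 0) (h₂ : e₂ g ≠ 0) {A : X.Opens}
    (hA : IsAffineOpen A) (hgA : P.basicOpen g ≤ φ ⁻¹ᵁ A)
    (h : ∀ (a : Γ(X, A)) (k : ℕ) (n : Γ(P, U)), ores P (P.basicOpen_le g) (g ^ k) *
      φ.appLE A _ hgA a = ores P (P.basicOpen_le g) n → e₁ n * e₂ (g ^ k) = e₂ n * e₁ (g ^ k)) :
    Spec.map (CommRingCat.ofHom e₁) ≫ hU.fromSpec ≫ φ =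
      Spec.map (CommRingCat.ofHom e₂) ≫ hU.fromSpec ≫ φ := by
  obtain ⟨e₁', he₁, E₁⟩ := exists_lift_basicOpen hU e₁ g h₁.isUnit
  obtain ⟨e₂', he₂, E₂⟩ := exists_lift_basicOpen hU e₂ g h₂.isUnit
  rw [reassoc_of% E₁, reassoc_of% E₂, ← hA.SpecMap_appLE_fromSpec φ (hU.basicOpen g) hgA,
    ← Category.assoc, ← Category.assoc, ← Spec.map_comp, ← Spec.map_comp]
  congr 2
  refine CommRingCat.hom_ext (RingHom.ext fun a ↦ ?_)
  change e₁' (φ.appLE A _ hgA a) = e₂' (φ.appLE A _ hgA a)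
  obtain ⟨k, n, hn⟩ := exists_ores_eq_of_basicOpen hU g (φ.appLE A _ hgA a)
  have h3 := h a k n hn
  have h4 := congrArg e₁' hn
  have h5 := congrArg e₂' hn
  rw [map_mul, he₁, he₁] at h4
  rw [map_mul, he₂, he₂] at h5
  have h6 : e₁ (g ^ k) ≠ 0 := by rw [map_pow]; exact pow_ne_zero _ h₁
  have h7 : e₂ (g ^ k) ≠ 0 := by rw [map_pow]; exact pow_ne_zero _ h₂
  apply mul_left_cancel₀ h6
  apply mul_left_cancel₀ h7
  linear_combination e₂ (g ^ k) * h4 + h3 - e₁ (g ^ k) * h5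

namespace Chart

open Polynomial

variable {P B : Scheme.{0}} {c : P ⟶ B} {V : B.Opens} (χ : Chart c V) {K : Type} [Field K]
  (κ : Γ(B, V) →+* K)

/-- If all functions coming from `X` are constant on an affine line over a field, then the map to
`X` is constant on it. -/
lemma exists_fiberMap_comp_eq [CharZero K] {X Y : Scheme.{0}} (φ : P ⟶ X) (x : X ⟶ Y)
    [IsSeparated x]
    (b : B ⟶ Y) (w : φ ≫ x = c ≫ b)
    (h : ∀ (g : Γ(P, χ.U₀)), χ.fiberRingHom κ g ≠ 0 → ∀ (A : X.Opens)
      (hA : P.basicOpen g ≤ φ ⁻¹ᵁ A) (a : Γ(X, A)) (G n : Γ(B, V)[X]),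
      ores P (P.basicOpen_le g) (χ.poly₀ G) * φ.appLE A _ hA a =
        ores P (P.basicOpen_le g) (χ.poly₀ n) → wronskian (G.map κ) (n.map κ) = 0) :
    ∃ q : Spec (.of K) ⟶ X, χ.fiberMap κ ≫ φ = Spec.map (CommRingCat.ofHom C) ≫ q := by
  -- `A` is an affine open neighborhood of the image of the generic point `η`, the set where `g` does
  -- not vanish is mapped to `A`, and `t` is a point of the line at which `g` does not vanish
  let η : Spec (.of K[X]) := (⟨⊥, Ideal.isPrime_bot⟩ : PrimeSpectrum K[X])
  obtain ⟨A, hA, hηA, -⟩ := exists_isAffineOpen_mem_and_subset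
    (show φ (χ.fiberMap κ η) ∈ (⊤ : X.Opens) from trivial)
  obtain ⟨g, hg, hηg⟩ := exists_basicOpen χ.affine₀ (inf_le_left : χ.U₀ ⊓ φ ⁻¹ᵁ A ≤ χ.U₀)
    ⟨χ.fiberMap_mem κ η, hηA⟩
  have hgA : P.basicOpen g ≤ φ ⁻¹ᵁ A := hg.trans inf_le_right
  have hg0 : χ.fiberRingHom κ g ≠ 0 := (χ.mem_fiberMap_preimage κ η g).1 hηg
  obtain ⟨t, ht⟩ : ∃ t, (χ.fiberRingHom κ g).eval t ≠ 0 := by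
    by_contra! H
    exact hg0 (Polynomial.funext fun t ↦ by rw [H t, eval_zero])
  let L := FractionRing K[X]
  let e : K[X] →+* K := evalRingHom t
  let i : CommRingCat.of K[X] ⟶ CommRingCat.of L := CommRingCat.ofHom (algebraMap K[X] L)
  have hi : Function.Injective (algebraMap K[X] L) := IsFractionRing.injective _ _
  have key := comp_eq_of_ringHom χ.affine₀ φ ((algebraMap K[X] L).comp (χ.fiberRingHom κ))
    ((algebraMap K[X] L).comp (C.comp (e.comp (χ.fiberRingHom κ)))) g
    (fun h ↦ hg0 (hi (by simpa using h)))
    (fun h ↦ ht (C_injective (hi (by simpa [e] using h)))) hA hgA (fun a k n hn ↦ by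
      obtain ⟨G, hG⟩ := χ.poly₀.surjective (g ^ k)
      obtain ⟨N, rfl⟩ := χ.poly₀.surjective n
      rw [← hG] at hn ⊢
      have hG0 : G.map κ ≠ 0 := by
        rw [← fiberRingHom_poly₀ χ, hG, map_pow]
        exact pow_ne_zero _ hg0
      obtain ⟨r, hr⟩ := exists_eq_C_mul_of_wronskian_eq_zero hG0 (h g hg0 A hgA a G N hn)
      simp only [RingHom.comp_apply, fiberRingHom_poly₀, hr, map_mul, e, coe_evalRingHom, eval_C]
      ring)
  refine ⟨Spec.map (CommRingCat.ofHom e) ≫ χ.fiberMap κ ≫ φ, ?_⟩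
  -- `φ` agrees at the generic point with the constant map to its value at `t`, and `X` is separated
  have dom : IsDominant (Spec.map i) := ⟨by
    refine (PrimeSpectrum.denseRange_comap_iff_ker_le_nilRadical _).2 ?_
    change RingHom.ker (algebraMap K[X] L) ≤ _
    rw [(RingHom.injective_iff_ker_eq_bot _).1 hi]
    exact bot_le⟩
  refine ext_of_isDominant_of_isSeparated x ?_ (Spec.map i) ?_
  · have he : CommRingCat.ofHom C ≫ CommRingCat.ofHom e = 𝟙 (CommRingCat.of K) :=
      CommRingCat.hom_ext (RingHom.ext fun r ↦ eval_C)
    simp only [Category.assoc, w, reassoc_of% χ.fiberMap_comp κ]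
    rw [← Spec.map_comp_assoc, ← Spec.map_comp_assoc, reassoc_of% he]
  · rw [fiberMap, Category.assoc, ← Spec.map_comp_assoc, ← Spec.map_comp_assoc,
      ← Spec.map_comp_assoc, ← Spec.map_comp_assoc]
    exact key

/-- The two affine lines of a geometric fiber have the point `z = w = 1` in common. -/
lemma fiberMap_one : Spec.map (CommRingCat.ofHom (evalRingHom (1 : K))) ≫ χ.fiberMap κ =
    Spec.map (CommRingCat.ofHom (evalRingHom (1 : K))) ≫ χ.swap.fiberMap κ := by
  let e := (evalRingHom (1 : K)).comp (χ.fiberRingHom κ)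
  have hz : e χ.z = 1 := by simp [e, fiberRingHom_z]
  obtain ⟨e', he', E⟩ := exists_lift_basicOpen χ.affine₀ e χ.z (by rw [hz]; exact isUnit_one)
  have hW : P.basicOpen χ.z ≤ χ.U₁ := by rw [χ.basicOpen_z]; exact inf_le_right
  have h1 : (evalRingHom (1 : K)).comp (χ.swap.fiberRingHom κ) = e'.comp (ores P hW) := by
    refine χ.swap.ringHom_ext₀ (fun r ↦ ?_) ?_
    · rw [RingHom.comp_apply, fiberRingHom_appLE]
      have h2 : ores P hW (c.appLE V χ.U₁ χ.le₁ r) =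
          ores P (P.basicOpen_le χ.z) (c.appLE V χ.U₀ χ.le₀ r) :=
        (congr($(c.appLE_map χ.le₁ (homOfLE hW).op) r)).trans
          (congr($(c.appLE_map χ.le₀ (homOfLE (P.basicOpen_le χ.z)).op) r)).symm
      refine Eq.trans ?_ (congrArg e' h2).symm
      rw [he', RingHom.comp_apply, fiberRingHom_appLE]
    · rw [RingHom.comp_apply, fiberRingHom_z]
      have h2 := congrArg e' (χ.mul_eq_one _ (P.basicOpen_le χ.z) hW)
      rw [map_mul, he', hz, one_mul, map_one] at h2
      exact (by simp : evalRingHom (1 : K) X = 1).trans h2.symm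
  have h2 : Spec.map (CommRingCat.ofHom ((evalRingHom (1 : K)).comp (χ.swap.fiberRingHom κ))) ≫
      χ.affine₁.fromSpec = Spec.map (CommRingCat.ofHom e) ≫ χ.affine₀.fromSpec := by
    rw [h1, E, ← χ.affine₁.map_fromSpec (χ.affine₀.basicOpen χ.z) (homOfLE hW).op,
      ← Spec.map_comp_assoc]
    rfl
  rw [fiberMap, ← Spec.map_comp_assoc, fiberMap, ← Spec.map_comp_assoc]
  exact h2.symm

/-- A morphism which is constant on both affine lines of a geometric fiber is constant on the
fiber. -/
lemma isConstantAt_basePoint {X : Scheme.{0}} (φ : P ⟶ X) {q q' : Spec (.of K) ⟶ X}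
    (h : χ.fiberMap κ ≫ φ = Spec.map (CommRingCat.ofHom C) ≫ q)
    (h' : χ.swap.fiberMap κ ≫ φ = Spec.map (CommRingCat.ofHom C) ≫ q') :
    IsConstantAt c φ (χ.basePoint κ) := by
  have he : CommRingCat.ofHom C ≫ CommRingCat.ofHom (evalRingHom (1 : K)) = 𝟙 (CommRingCat.of K) :=
    CommRingCat.hom_ext (RingHom.ext fun r ↦ eval_C)
  obtain rfl : q = q' := by
    have h1 := congrArg (Spec.map (CommRingCat.ofHom (evalRingHom (1 : K))) ≫ ·) h
    have h2 := congrArg (Spec.map (CommRingCat.ofHom (evalRingHom (1 : K))) ≫ ·) h'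
    simp only [← Spec.map_comp_assoc, he, Spec.map_id, Category.id_comp] at h1 h2
    rw [← h1, ← h2, reassoc_of% χ.fiberMap_one κ]
  refine ⟨q, ?_⟩
  obtain ⟨j, hj, hf, hs, hr⟩ := χ.exists_lift_fiberMap κ
  obtain ⟨j', hj', hf', hs', hr'⟩ : ∃ j : Spec (.of K[X]) ⟶ pullback c (χ.basePoint κ),
    IsOpenImmersion j ∧ j ≫ pullback.fst _ _ = χ.swap.fiberMap κ ∧
    j ≫ pullback.snd _ _ = Spec.map (CommRingCat.ofHom C) ∧
    ∀ p, pullback.fst c (χ.basePoint κ) p ∈ χ.U₁ → p ∈ Set.range j := χ.swap.exists_lift_fiberMap κ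
  have key (j : Spec (.of K[X]) ⟶ pullback c (χ.basePoint κ)) (hj : IsOpenImmersion j)
      (e : j ≫ pullback.fst _ _ ≫ φ = j ≫ pullback.snd _ _ ≫ q) :
      j.opensRange.ι ≫ pullback.fst _ _ ≫ φ = j.opensRange.ι ≫ pullback.snd _ _ ≫ q := by
    rw [← cancel_epi j.isoOpensRange.hom, Scheme.Hom.isoOpensRange_hom_ι_assoc,
      Scheme.Hom.isoOpensRange_hom_ι_assoc, e]
  refine Scheme.hom_ext_of_forall _ _ fun p ↦ ?_
  have hp : pullback.fst c (χ.basePoint κ) p ∈ χ.U₀ ⊔ χ.U₁ := by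
    rw [χ.sup_eq]
    change c (pullback.fst c (χ.basePoint κ) p) ∈ V
    rw [← Scheme.Hom.comp_apply, pullback.condition, Scheme.Hom.comp_apply]
    exact χ.basePoint_mem κ _
  obtain hp | hp := hp
  · exact ⟨j.opensRange, hr p hp, key j hj (by rw [reassoc_of% hf, reassoc_of% hs, h])⟩
  · exact ⟨j'.opensRange, hr' p hp, key j' hj' (by rw [reassoc_of% hf', reassoc_of% hs', h'])⟩

end Chart

/-! ### Injectivity of the contraction with the differential -/

section Contraction

open Polynomial

variable {P B X Y : Scheme.{0}} {c : P ⟶ B} {S : P.Modules} {φ : P ⟶ X} {b : B ⟶ Y} {x : X ⟶ Y}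
  (w : φ ≫ x = c ≫ b) (σ : S ≅ sheafHom S (derivationSheaf (𝟙 P) c))

/-- The contraction of sections of `S` with the differential of `φ`. -/
def contract : S ⟶ sheafHom S (derivationSheaf φ x) :=
  σ.hom ≫ sheafHomMap S (differential c b φ x w)

lemma apply_eq_zero_of_contract_eq_zero {U W W' : P.Opens} {s : Γ(S, U)}
    (hs : (contract w σ).app U s = 0) (hW : W ≤ U) (u : Γ(S, W)) (hW' : W' ≤ W) {A : X.Opens}
    (hA : W' ≤ φ ⁻¹ᵁ A) (a : Γ(X, A)) :
    (spinField σ (mres S hW s) u).apply hW' (φ.appLE A W' hA a) = 0 := by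
  have h1 : σ.hom.app W (mres S hW s) = LocalHom.res hW (σ.hom.app U s) := app_mres σ.hom hW s
  rw [spinField, h1]
  have h2 : DerivationAlong.toFun (LocalHom.toFun ((contract w σ).app U s) W hW u) A W' hW' hA a =
      0 := by
    rw [hs]
    rfl
  exact h2

/-- If the contraction of `α e₀ + β e₁` with `dφ` vanishes, then `α + β z` annihilates the
derivatives of the functions coming from `X`. -/
lemma SpinChart.exists_pow_mul_wronskian_eq_zero {V : B.Opens} (χ : SpinChart c S V)
    {s : Γ(S, c ⁻¹ᵁ V)} {α β : Γ(B, V)} (hαβ : χ.IsSection s α β)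
    (hs : (contract w σ).app _ s = 0) (g G n : Γ(B, V)[X]) {A : X.Opens}
    (hA : P.basicOpen (χ.poly₀ g) ≤ φ ⁻¹ᵁ A) (a : Γ(X, A))
    (h : ores P (P.basicOpen_le _) (χ.poly₀ G) * φ.appLE A _ hA a =
      ores P (P.basicOpen_le _) (χ.poly₀ n)) :
    ∃ m : ℕ, (C α + C β * Polynomial.X) * (g ^ m * wronskian G n) = 0 := by
  set D := spinField σ χ.e₀ χ.e₀
  set δ := D.apply le_rfl χ.z
  set F := c.appLE V χ.U₀ χ.le₀ α + c.appLE V χ.U₀ χ.le₀ β * χ.z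
  have hF : χ.poly₀ (C α + C β * Polynomial.X) = F := by simp [F]
  have hδ : IsUnit δ := by
    have := isUnit_spinDer χ.le₀ σ χ.affine χ.affine₀ χ.z χ.bijective₀ le_rfl χ.generator₀
    rwa [ores_self] at this
  have hD (p : Γ(B, V)[X]) : D.apply le_rfl (χ.poly₀ p) = χ.poly₀ (derivative p) * δ :=
    apply_eval₂ χ.le₀ D χ.z p
  set W := P.basicOpen (χ.poly₀ g)
  have hW : W ≤ χ.U₀ := P.basicOpen_le _
  set f := φ.appLE A W hA a
  have h1 : ores P hW F * D.apply hW f = 0 := by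
    have := apply_eq_zero_of_contract_eq_zero w σ hs χ.le₀ χ.e₀ hW hA a
    rwa [hαβ.1, spinField_smul_left, smul_apply] at this
  have h2 := congrArg (D.apply hW) h
  rw [D.apply_mul, D.apply_ores le_rfl hW, D.apply_ores le_rfl hW, hD, hD] at h2
  have h3 : ores P hW (χ.poly₀ ((C α + C β * Polynomial.X) * wronskian G n) * δ) = 0 := by
    rw [map_mul χ.poly₀, hF, wronskian, map_sub, map_mul, map_mul]
    simp only [map_mul, map_sub] at h2 ⊢
    linear_combination (ores P hW (χ.poly₀ G))^2 * h1 - ores P hW F * ores P hW (χ.poly₀ G) * h2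
      + ores P hW F * ores P hW (χ.poly₀ (derivative G)) * ores P hW δ * h
  obtain ⟨m, hm⟩ := exists_pow_mul_eq_zero χ.affine₀ (χ.poly₀ g) h3
  refine ⟨m, χ.poly₀.injective ?_⟩
  rw [map_zero]
  refine hδ.mul_left_eq_zero.1 ?_
  rw [← hm]
  simp only [map_mul, map_pow]
  ring

/-- If a section that is contracted to zero with `dφ` does not vanish near `p`, then `φ` is constant
on an affine line in the geometric fiber over `p`. -/
lemma SpinChart.exists_fiberMap_comp_eq [IsSeparated x] {V : B.Opens} (χ : SpinChart c S V)
    {s : Γ(S, c ⁻¹ᵁ V)} {α β : Γ(B, V)} (hαβ : χ.IsSection s α β)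
    (hs : (contract w σ).app _ s = 0) (p : B) (hp : p ∈ V)
    (hne : B.presheaf.germ V p hp α ≠ 0 ∨ B.presheaf.germ V p hp β ≠ 0) {K : Type} [Field K]
    [CharZero K] (ι : IsLocalRing.ResidueField (B.presheaf.stalk p) →+* K) (κ : Γ(B, V) →+* K)
    (hκ : κ = ι.comp ((IsLocalRing.residue _).comp (B.presheaf.germ V p hp).hom)) :
    ∃ q : Spec (.of K) ⟶ X, χ.fiberMap κ ≫ φ = Spec.map (CommRingCat.ofHom C) ≫ q := by
  refine χ.toChart.exists_fiberMap_comp_eq κ φ x b w fun g hg A hA a G n h ↦ ?_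
  obtain ⟨g, rfl⟩ := χ.poly₀.surjective g
  rw [χ.fiberRingHom_poly₀] at hg
  obtain ⟨m, hm⟩ := χ.exists_pow_mul_wronskian_eq_zero w σ hαβ hs g G n hA a h
  set H := g ^ m * wronskian G n
  have hH : H.map κ = (g.map κ) ^ m * wronskian (G.map κ) (n.map κ) := by
    simp only [H, wronskian, Polynomial.map_mul, Polynomial.map_sub, Polynomial.map_pow,
      derivative_map]
  suffices h0 : H.map κ = 0 by
    rw [hH] at h0
    exact (mul_eq_zero.1 h0).resolve_left (pow_ne_zero _ hg)
  set γ : Γ(B, V) →+* B.presheaf.stalk p := (B.presheaf.germ V p hp).hom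
  have h1 : (C α + C β * Polynomial.X).map γ * H.map γ = 0 := by
    rw [← Polynomial.map_mul, hm, Polynomial.map_zero]
  by_contra hH0
  have h2 := eq_zero_of_mul_eq_zero_of_map_residue_ne_zero h1 (fun h3 ↦ hH0 (by
    rw [hκ, ← Polynomial.map_map, ← Polynomial.map_map, h3, Polynomial.map_zero]))
  simp only [Polynomial.map_add, Polynomial.map_mul, map_C, map_X] at h2
  obtain hne | hne := hne
  · exact hne (by simpa using congrArg (coeff · 0) h2)
  · exact hne (by simpa using congrArg (coeff · 1) h2)

end Contraction

section Contraction

variable {P B X : Scheme.{0}} {c : P ⟶ B} {S : P.Modules} {φ : P ⟶ X} {b : B ⟶ Spec (.of ℂ)}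
  {x : X ⟶ Spec (.of ℂ)} (w : φ ≫ x = c ≫ b) (σ : S ≅ sheafHom S (derivationSheaf (𝟙 P) c))

lemma ores_eq_zero_of_germ {C : Scheme.{0}} {U : C.Opens} {f : Γ(C, U)}
    (h : ∀ (p : C) (hp : p ∈ U), C.presheaf.germ U p hp f = 0) : f = 0 :=
  TopCat.Presheaf.section_ext C.sheaf U f 0 fun p hp ↦ (h p hp).trans (map_zero _).symm

/-- If `φ` is not constant on any geometric fiber, then the contraction with `dφ` is injective on
sections over preimages of open sets of the base. -/
lemma eq_zero_of_contract_eq_zero [IsSeparated x] (hc : IsProjectiveLineBundle c)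
    (hS : IsInvertible S) (hφ : ∀ (K : Type) [Field K] [IsAlgClosed K] (y : Spec (.of K) ⟶ B),
      ¬ IsConstantAt c φ y) {V : B.Opens} {s : Γ(S, c ⁻¹ᵁ V)} (hs : (contract w σ).app _ s = 0) :
    s = 0 := by
  refine mres_ext fun p hp ↦ ?_
  obtain ⟨V', hV', hb, ⟨χ⟩⟩ := exists_spinChart σ hc hS (c p) V hp
  refine ⟨c ⁻¹ᵁ V', c.preimage_mono hV', hb, ?_⟩
  have hs' : (contract w σ).app _ (mres S (c.preimage_mono hV') s) = 0 := by
    rw [app_mres, hs]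
    exact map_zero _
  obtain ⟨α, β, hαβ⟩ := χ.exists_isSection (mres S (c.preimage_mono hV') s)
  have key : ∀ (p : B) (hp : p ∈ V'), ¬ (B.presheaf.germ V' p hp α ≠ 0 ∨
      B.presheaf.germ V' p hp β ≠ 0) := by
    intro p hp hne
    let k := IsLocalRing.ResidueField (B.presheaf.stalk p)
    let K := AlgebraicClosure k
    let κ : Γ(B, V') →+* K :=
      (algebraMap k K).comp ((IsLocalRing.residue _).comp (B.presheaf.germ V' p hp).hom)
    -- the base is a scheme over `ℂ`
    have : CharZero K :=
      charZero_of_injective_ringHom (Spec.preimage (χ.basePoint κ ≫ b)).hom.injective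
    obtain ⟨q, hq⟩ := χ.exists_fiberMap_comp_eq w σ hαβ hs' p hp hne (algebraMap k K) κ rfl
    obtain ⟨q', hq'⟩ := χ.swap.exists_fiberMap_comp_eq w σ hαβ.swap hs' p hp hne.symm
      (algebraMap k K) κ rfl
    exact hφ K _ (χ.isConstantAt_basePoint κ φ hq hq')
  push Not at key
  obtain rfl : α = 0 := ores_eq_zero_of_germ fun p hp ↦ (key p hp).1
  obtain rfl : β = 0 := ores_eq_zero_of_germ fun p hp ↦ (key p hp).2
  refine χ.ext ?_ ?_
  · rw [hαβ.1]
    simp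
  · rw [hαβ.2]
    simp

/-- If `φ` is not constant on any geometric fiber, then the contraction with `dφ` is injective on
the sections of the spinor bundle. -/
lemma eq_zero_of_comp_contract [IsSeparated x] (hc : IsProjectiveLineBundle c)
    (hS : IsInvertible S) (hφ : ∀ (K : Type) [Field K] [IsAlgClosed K] (y : Spec (.of K) ⟶ B),
      ¬ IsConstantAt c φ y) {Z : B.Modules} {y : Z ⟶ (Scheme.Modules.pushforward c).obj S}
    (hy : y ≫ (Scheme.Modules.pushforward c).map (contract w σ) = 0) : y = 0 := by
  refine mod_hom_ext fun V z ↦ ?_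
  exact eq_zero_of_contract_eq_zero w σ hc hS hφ (s := y.app V z) congr(($hy).app V z)

end Contraction

/-! ### Decomposition according to components and flags -/

namespace Decomposition

variable {A : Type*} [Category* A] [Preadditive A] {K : Type*} {Q : A} {L : K → A}

/-- A biproduct is the direct sum of its summands. -/
def biproduct [HasFiniteBiproducts A] [Finite K] (L : K → A) : Decomposition (⨁ L) L where
  π := biproduct.π L
  ι := biproduct.ι L
  ι_π_self := biproduct.ι_π_self L
  ι_π_ne _ _ h := biproduct.ι_π_ne L h
  ext h := biproduct.hom_ext' _ _ h

/-- Additive functors preserve finite direct sums. -/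
def map [Finite K] (d : Decomposition Q L) {A' : Type*} [Category* A'] [Preadditive A'] (G : A ⥤ A')
    [G.Additive] : Decomposition (G.obj Q) fun k ↦ G.obj (L k) where
  π k := G.map (d.π k)
  ι k := G.map (d.ι k)
  ι_π_self k := by rw [← G.map_comp, d.ι_π_self, G.map_id]
  ι_π_ne k l h := by rw [← G.map_comp, d.ι_π_ne k l h, G.map_zero]
  ext {Z f g} h := by
    let := Fintype.ofFinite K
    have e : 𝟙 (G.obj Q) = ∑ k, G.map (d.π k) ≫ G.map (d.ι k) := by
      rw [← G.map_id, ← d.desc_ι, desc, G.map_sum]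
      simp only [G.map_comp]
    rw [← Category.id_comp f, ← Category.id_comp g, e]
    simp only [Preadditive.sum_comp, Category.assoc, h]

/-- Replacement of the summands by isomorphic objects. -/
def congr (d : Decomposition Q L) {L' : K → A} (e : ∀ k, L k ≅ L' k) : Decomposition Q L' where
  π k := d.π k ≫ (e k).hom
  ι k := (e k).inv ≫ d.ι k
  ι_π_self k := by
    rw [Category.assoc, reassoc_of% d.ι_π_self k, Iso.inv_hom_id]
  ι_π_ne k l h := by
    rw [Category.assoc, reassoc_of% d.ι_π_ne k l h, zero_comp, comp_zero]
  ext h := d.ext fun k ↦ by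
    have := h k
    rwa [Category.assoc, Category.assoc, cancel_epi] at this

/-- A direct sum of direct sums. -/
def sigma (d : Decomposition Q L) {K' : K → Type*} {L' : ∀ k, K' k → A}
    (d' : ∀ k, Decomposition (L k) (L' k)) :
    Decomposition Q fun k : Σ k, K' k ↦ L' k.1 k.2 where
  π k := d.π k.1 ≫ (d' k.1).π k.2
  ι k := (d' k.1).ι k.2 ≫ d.ι k.1
  ι_π_self k := by rw [Category.assoc, reassoc_of% d.ι_π_self k.1, (d' k.1).ι_π_self]
  ι_π_ne k l h := by
    obtain ⟨k, k'⟩ := k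
    obtain ⟨l, l'⟩ := l
    by_cases hkl : k = l
    · subst hkl
      rw [Category.assoc, reassoc_of% d.ι_π_self k, (d' k).ι_π_ne _ _ fun h' ↦ h (congrArg _ h')]
    · rw [Category.assoc, reassoc_of% d.ι_π_ne _ _ hkl, zero_comp, comp_zero]
  ext h := d.ext fun k ↦ (d' k).ext fun k' ↦ by simpa only [Category.assoc] using h ⟨k, k'⟩

/-- Summands which are zero may be omitted. -/
def restrict (d : Decomposition Q L) {K' : Type*} (e : K' → K) (he : Function.Injective e)
    (h0 : ∀ k, (∀ k', e k' ≠ k) → IsZero (L k)) : Decomposition Q fun k ↦ L (e k) where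
  π k := d.π (e k)
  ι k := d.ι (e k)
  ι_π_self k := d.ι_π_self _
  ι_π_ne k l h := d.ι_π_ne _ _ fun h' ↦ h (he h')
  ext {Z f g} h := d.ext fun k ↦ by
    by_cases hk : ∃ k', e k' = k
    · obtain ⟨k', rfl⟩ := hk
      exact h k'
    · exact (h0 k fun k' h' ↦ hk ⟨k', h'⟩).eq_of_src _ _

lemma isIso_ι (d : Decomposition Q L) (k : K) (h : ∀ l, l ≠ k → IsZero (L l)) : IsIso (d.ι k) :=
  ⟨d.π k, d.ι_π_self k, d.ext fun l ↦ by
    by_cases hl : l = k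
    · subst hl
      rw [reassoc_of% d.ι_π_self l, Category.comp_id]
    · exact (h l hl).eq_of_src _ _⟩

/-- The direct sum of two direct sums. -/
def sum [HasBinaryBiproducts A] (d : Decomposition Q L) {K' : Type*} {Q' : A} {L' : K' → A}
    (d' : Decomposition Q' L') : Decomposition (Q ⊞ Q') (Sum.elim L L') where
  π k := match k with
    | .inl k => biprod.fst ≫ d.π k
    | .inr k => biprod.snd ≫ d'.π k
  ι k := match k with
    | .inl k => d.ι k ≫ biprod.inl
    | .inr k => d'.ι k ≫ biprod.inr
  ι_π_self k := match k with
    | .inl k => by simpa using d.ι_π_self k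
    | .inr k => by simpa using d'.ι_π_self k
  ι_π_ne k l h := match k, l with
    | .inl k, .inl l => by
      change (d.ι k ≫ biprod.inl) ≫ biprod.fst ≫ d.π l = (0 : L k ⟶ L l)
      rw [Category.assoc, biprod.inl_fst_assoc]
      exact d.ι_π_ne k l fun h' ↦ h (congrArg _ h')
    | .inl k, .inr l => by
      change (d.ι k ≫ biprod.inl) ≫ biprod.snd ≫ d'.π l = (0 : L k ⟶ L' l)
      rw [Category.assoc, biprod.inl_snd_assoc, zero_comp, comp_zero]
    | .inr k, .inl l => by
      change (d'.ι k ≫ biprod.inr) ≫ biprod.fst ≫ d.π l = (0 : L' k ⟶ L l)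
      rw [Category.assoc, biprod.inr_fst_assoc, zero_comp, comp_zero]
    | .inr k, .inr l => by
      change (d'.ι k ≫ biprod.inr) ≫ biprod.snd ≫ d'.π l = (0 : L' k ⟶ L' l)
      rw [Category.assoc, biprod.inr_snd_assoc]
      exact d'.ι_π_ne k l fun h' ↦ h (congrArg _ h')
  ext h := biprod.hom_ext' _ _ (d.ext fun k ↦ by simpa using h (.inl k))
    (d'.ext fun k ↦ by simpa using h (.inr k))

end Decomposition

lemma isZero_modules_of_isEmpty {B : Scheme.{0}} [IsEmpty B] (M : B.Modules) : IsZero M := by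
  rw [IsZero.iff_id_eq_zero]
  exact mod_hom_ext fun U a ↦ mres_ext fun p ↦ isEmptyElim p

lemma pullback_map_pullSection {B P : Scheme.{0}} (p : B ⟶ P) {M N : P.Modules} (f : M ⟶ N)
    {V : P.Opens} (u : Γ(M, V)) :
    ((Scheme.Modules.pullback p).map f).app (p ⁻¹ᵁ V) (pullSection p M u) =
      pullSection p N (f.app V u) :=
  (congr($((Scheme.Modules.pullbackPushforwardAdjunction p).unit.naturality f).app V u)).symm

namespace SpinCurve

variable {B : Scheme.{0}} {J : Type} {τ : MarkedTree J} (F : SpinCurve B τ)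

/-- The projection of the component `C_v` to the base. -/
abbrev proj (v : τ.V) : F.comp v ⟶ B := F.i v ≫ F.c

/-- The sections of `S_v` along the fibers of `C_v`. -/
abbrev sections (v : τ.V) : B.Modules := (Scheme.Modules.pushforward (F.proj v)).obj (F.S v)

/-- The restriction of `S_v` to a flag at `v`. -/
abbrev flagFiber (f : τ.Flag) : B.Modules :=
  (Scheme.Modules.pullback (F.flag f)).obj (F.S (τ.vertex f))

/-- The value of a section of `S_v` at a flag at `v`. -/
def flagValue (f : τ.Flag) (v : τ.V) (h : τ.vertex f = v) : F.sections v ⟶ F.flagFiber f :=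
  match v, h with
  | _, rfl => restrictToSection (F.proj _) (F.flag f) (F.flag_section f) (F.S _)

/-- A flag at `v`, regarded as a section of `C_v`. -/
lemma exists_flag_section (f : τ.Flag) (v : τ.V) (h : τ.vertex f = v) :
    ∃ (p : B ⟶ F.comp v) (hp : p ≫ F.proj v = 𝟙 B)
      (e : (Scheme.Modules.pullback p).obj (F.S v) ≅ F.flagFiber f),
      p ≫ F.i v = F.flag f ≫ F.i _ ∧
      restrictToSection (F.proj v) p hp (F.S v) ≫ e.hom = F.flagValue f v h := by
  subst h
  exact ⟨F.flag f, F.flag_section f, Iso.refl _, rfl, Category.comp_id _⟩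

/-- A section of `S_v` is determined by its values at two flags at `v`. -/
lemma eq_zero_of_flagValue {Z : B.Modules} {v : τ.V} {y : Z ⟶ F.sections v} {f f' : τ.Flag}
    (hf : τ.vertex f = v) (hf' : τ.vertex f' = v) (hne : f ≠ f') (h : y ≫ F.flagValue f v hf = 0)
    (h' : y ≫ F.flagValue f' v hf' = 0) : y = 0 := by
  obtain ⟨p, hp, e, hpi, hpe⟩ := F.exists_flag_section f v hf
  obtain ⟨p', hp', e', hpi', hpe'⟩ := F.exists_flag_section f' v hf'
  refine eq_zero_of_comp_restrictToSection (F.spin v) (F.bundle v) (F.invertible v) hp hp'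
    (fun b hb ↦ F.flag_disjoint f f' hne (hf.trans hf'.symm) b ?_) ?_ ?_
  · rw [← hpi, ← hpi', Scheme.Hom.comp_apply, Scheme.Hom.comp_apply, hb]
  · rw [← cancel_mono e.hom, Category.assoc, zero_comp]
    exact (congrArg (y ≫ ·) hpe).trans h
  · rw [← cancel_mono e'.hom, Category.assoc, zero_comp]
    exact (congrArg (y ≫ ·) hpe').trans h'

/-- The values of sections of `S_v` at two flags at `v` are independent. -/
lemma eq_zero_of_flagValue_comp {Z : B.Modules} {v : τ.V} {f f' : τ.Flag}
    (hf : τ.vertex f = v) (hf' : τ.vertex f' = v) (hne : f ≠ f') {g : F.flagFiber f ⟶ Z}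
    {g' : F.flagFiber f' ⟶ Z} (h : F.flagValue f v hf ≫ g + F.flagValue f' v hf' ≫ g' = 0) :
    g = 0 := by
  obtain ⟨p, hp, e, hpi, hpe⟩ := F.exists_flag_section f v hf
  obtain ⟨p', hp', e', hpi', hpe'⟩ := F.exists_flag_section f' v hf'
  rw [← cancel_epi e.hom, comp_zero]
  refine eq_zero_of_restrictToSection_comp (F.spin v) (F.bundle v) (F.invertible v) hp hp'
    (fun b hb ↦ F.flag_disjoint f f' hne (hf.trans hf'.symm) b ?_) (g₂ := e'.hom ≫ g') ?_
  · rw [← hpi, ← hpi', Scheme.Hom.comp_apply, Scheme.Hom.comp_apply, hb]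
  · rw [← Category.assoc, ← Category.assoc, hpe, hpe']
    exact h

/-- The direct image of the spinor bundle is the direct sum of the direct images of its
components. -/
def sectionsDecomposition :
    Decomposition ((Scheme.Modules.pushforward F.c).obj F.spinorBundle) F.sections :=
  ((Decomposition.biproduct _).map (Scheme.Modules.pushforward F.c)).congr
    fun v ↦ (Scheme.Modules.pushforwardComp (F.i v) F.c).app (F.S v)

/-- The marked point or node to which a flag belongs. -/
def _root_.SusyNormal.MarkedTree.pointOf (τ : MarkedTree J) : τ.Flag → J ⊕ τ.E
  | .inl j => .inl j
  | .inr (e, _) => .inr e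

lemma flag_comp_i (f : τ.Flag) : F.flag f ≫ F.i _ = F.point (τ.pointOf f) := by
  obtain j | ⟨e, _ | _⟩ := f
  · rfl
  · rfl
  · exact (F.flag_glue e).symm

lemma exists_flag_of_pointOf (x : J ⊕ τ.E) : ∃ f, τ.pointOf f = x := by
  obtain j | e := x
  · exact ⟨.inl j, rfl⟩
  · exact ⟨.inr (e, false), rfl⟩

/-- The marked points and nodes on `C_v` are those with a flag at `v`. -/
lemma point_ne (x : J ⊕ τ.E) (v : τ.V) (h : ∀ f, τ.pointOf f = x → τ.vertex f ≠ v) (b : B)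
    (z : F.comp v) : F.point x b ≠ F.i v z := by
  intro hz
  obtain ⟨f, rfl⟩ := exists_flag_of_pointOf (τ := τ) x
  have hf : F.point (τ.pointOf f) b = F.i (τ.vertex f) (F.flag f b) := by
    rw [← F.flag_comp_i, Scheme.Hom.comp_apply]
  obtain ⟨e, s, b', hv, hw, hp⟩ := F.inter v (τ.vertex f) (h f rfl).symm (F.point (τ.pointOf f) b)
    ⟨⟨z, hz.symm⟩, ⟨_, hf.symm⟩⟩
  have hc : b' = b := by
    have h1 (f : τ.Flag) (b : B) : F.c (F.point (τ.pointOf f) b) = b := by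
      rw [← Scheme.Hom.comp_apply, F.point_section]
      rfl
    rw [← h1 f b, ← hp, F.flag_comp_i, h1]
  subst hc
  by_cases hfe : f = .inr (e, !s)
  · exact h (.inr (e, s)) (by rw [hfe]; rfl) hv
  · refine F.flag_disjoint f (.inr (e, !s)) hfe hw.symm b' ?_
    rw [F.flag_comp_i, F.flag_comp_i, ← hp, F.flag_comp_i]
    rfl

/-- A flag is determined by its marked point or node and by its vertex: the two half-edges of a loop
would give one point of `C`, while the sections of distinct flags at a vertex are disjoint. -/
lemma flag_injective (F : SpinCurve B τ) [Nonempty B] :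
    Function.Injective fun f : τ.Flag ↦ (⟨τ.pointOf f, τ.vertex f⟩ : Σ _ : J ⊕ τ.E, τ.V) := by
  intro f f' h
  by_contra hne
  obtain ⟨h1, h2⟩ : τ.pointOf f = τ.pointOf f' ∧ τ.vertex f = τ.vertex f' := by
    simpa using h
  refine F.flag_disjoint f f' hne h2 (Classical.arbitrary B) ?_
  rw [F.flag_comp_i, F.flag_comp_i, h1]

instance (v : τ.V) : IsClosedImmersion (F.i v) := F.closedImmersion v

/-- The fiber of the `v`-th summand of the spinor bundle at a flag at `v`. -/
def flagIso (f : τ.Flag) :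
    (Scheme.Modules.pullback (F.point (τ.pointOf f))).obj
      ((Scheme.Modules.pushforward (F.i (τ.vertex f))).obj (F.S (τ.vertex f))) ≅ F.flagFiber f :=
  (exists_pullback_pushforward_iso (F.flag f) (F.i _) (F.flag_comp_i f) (F.S _)).choose

lemma flagIso_app (f : τ.Flag) (V : F.C.Opens) (u : Γ(F.S (τ.vertex f), F.i (τ.vertex f) ⁻¹ᵁ V)) :
    (F.flagIso f).hom.app (F.point (τ.pointOf f) ⁻¹ᵁ V) (pullSection _ _ u) =
      mres (F.flagFiber f) (by rw [← F.flag_comp_i]; exact le_rfl) (pullSection (F.flag f) _ u) :=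
  (exists_pullback_pushforward_iso (F.flag f) (F.i _) (F.flag_comp_i f) (F.S _)).choose_spec V u

variable [Finite J]

/-- The fiber of the spinor bundle at a marked point or node, decomposed according to
components. -/
def fiberAtDecomposition (x : J ⊕ τ.E) : Decomposition (F.fiberAt x) fun v ↦
    (Scheme.Modules.pullback (F.point x)).obj ((Scheme.Modules.pushforward (F.i v)).obj (F.S v)) :=
  (Decomposition.biproduct fun v ↦ (Scheme.Modules.pushforward (F.i v)).obj (F.S v)).map
    (Scheme.Modules.pullback (F.point x))

/-- The direct sum of the fibers of the spinor bundle at the marked points and nodes, decomposed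
according to flags. -/
def fiberDecomposition [Nonempty B] : Decomposition (⨁ F.fiberAt) F.flagFiber :=
  (((Decomposition.biproduct F.fiberAt).sigma F.fiberAtDecomposition).restrict _ F.flag_injective
    fun k hk ↦ isZero_pullback_pushforward _ _ (F.point_ne k.1 k.2 fun f hf hf' ↦
      hk f (Sigma.ext hf (heq_of_eq hf'))) _).congr F.flagIso

/-- The component at a flag of the map defining the normal bundle of a curve. -/
lemma restriction_π [Nonempty B] (f : τ.Flag) (v : τ.V) (h : τ.vertex f = v) :
    F.restriction ≫ F.fiberDecomposition.π f = F.sectionsDecomposition.π v ≫ F.flagValue f v h := by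
  subst h
  have h1 : F.restriction ≫ F.fiberDecomposition.π f =
      restrictToSection F.c (F.point (τ.pointOf f)) (F.point_section _) F.spinorBundle ≫
        (Scheme.Modules.pullback (F.point (τ.pointOf f))).map (biproduct.π _ (τ.vertex f)) ≫
        (F.flagIso f).hom := by
    have e : F.restriction ≫ biproduct.π F.fiberAt (τ.pointOf f) =
        restrictToSection F.c (F.point (τ.pointOf f)) (F.point_section _) F.spinorBundle :=
      biproduct.lift_π _ _
    exact congrArg (· ≫ (Scheme.Modules.pullback (F.point (τ.pointOf f))).map
      (biproduct.π _ (τ.vertex f)) ≫ (F.flagIso f).hom) e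
  rw [h1]
  have h2 (V : F.C.Opens) (V' : B.Opens) (hV : V' ≤ F.point (τ.pointOf f) ⁻¹ᵁ V)
      (hV' : V' ≤ F.flag f ⁻¹ᵁ (F.i (τ.vertex f) ⁻¹ᵁ V)) (s : Γ(F.spinorBundle, V)) :
      (F.flagIso f).hom.app V' (((Scheme.Modules.pullback (F.point (τ.pointOf f))).map
        (biproduct.π _ (τ.vertex f))).app V' (mres _ hV
          (pullSection (F.point (τ.pointOf f)) F.spinorBundle s))) =
      mres (F.flagFiber f) hV' (pullSection (F.flag f) (F.S _)
        ((biproduct.π _ (τ.vertex f) : F.spinorBundle ⟶ _).app V s)) := by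
    refine (congrArg ((F.flagIso f).hom.app V') ((app_mres _ hV _).trans
      (congrArg _ (pullback_map_pullSection _ _ s)))).trans ?_
    refine (app_mres _ hV _).trans ((congrArg _ (F.flagIso_app f V _)).trans ?_)
    exact mres_mres _ _ _
  refine mod_hom_ext fun V s ↦ ?_
  exact h2 (F.c ⁻¹ᵁ V) V (le_section (F.point_section _) V) (le_section (F.flag_section f) V) s

/-- The fiber of the spinor bundle at a marked point is its fiber at the corresponding tail. -/
lemma exists_tailIso [Nonempty B] (t : J) : ∃ e : F.flagFiber (.inl t) ≅ F.fiberAt (.inl t),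
    F.fiberDecomposition.ι (.inl t) = e.hom ≫ biproduct.ι F.fiberAt (.inl t) := by
  have : IsIso ((F.fiberAtDecomposition (.inl t)).ι (τ.tail t)) :=
    (F.fiberAtDecomposition (.inl t)).isIso_ι _ fun v hv ↦
      isZero_pullback_pushforward _ _ (F.point_ne _ _ fun f hf hf' ↦ hv (by
        obtain j | ⟨e, s⟩ := f
        · obtain rfl : j = t := by simpa [MarkedTree.pointOf] using hf
          exact hf'.symm
        · simp [MarkedTree.pointOf] at hf)) _
  refine ⟨(F.flagIso (.inl t)).symm ≪≫ @asIso _ _ _ _ _ this, ?_⟩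
  rw [Iso.trans_hom, Category.assoc]
  rfl

end SpinCurve

/-! ### The pieces of the normal bundle of a map -/

namespace StableSpinMap

variable {B X : Scheme.{0}} {b : B ⟶ Spec (.of ℂ)} {x : X ⟶ Spec (.of ℂ)}
  {J : Type} {τ : MarkedTree J} (F : StableSpinMap b x τ)

/-- The sections of `S_v^∨ ⊗ φ^* T_X` along the fibers of `C_v`. -/
abbrev tangents (v : τ.V) : B.Modules :=
  (Scheme.Modules.pushforward (F.proj v)).obj (sheafHom (F.S v) (F.tangentOn v))

lemma comp_over (v : τ.V) : (F.i v ≫ F.φ) ≫ x = F.proj v ≫ b := by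
  rw [Category.assoc, F.φ_over, Category.assoc]

/-- The contraction with the differential of `φ` on the component `C_v`. -/
def contractOn (v : τ.V) : F.sections v ⟶ F.tangents v :=
  (Scheme.Modules.pushforward (F.proj v)).map (contract (F.comp_over v) (F.spin v))

/-- The direct image of `S_C^∨ ⊗ φ^* T_X` is the direct sum of the direct images of its
components. -/
def tangentsDecomposition :
    Decomposition ((Scheme.Modules.pushforward F.c).obj F.dualSpinorTangent) F.tangents :=
  ((Decomposition.biproduct _).map (Scheme.Modules.pushforward F.c)).congr
    fun v ↦ (Scheme.Modules.pushforwardComp (F.i v) F.c).app (sheafHom (F.S v) (F.tangentOn v))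

lemma contraction_π (v : τ.V) :
    (Scheme.Modules.pushforward F.c).map F.contraction ≫ F.tangentsDecomposition.π v =
      F.sectionsDecomposition.π v ≫ F.contractOn v := by
  have h1 : F.contraction ≫ biproduct.π _ v = biproduct.π _ v ≫
      (Scheme.Modules.pushforward (F.i v)).map
        ((F.spin v).hom ≫ sheafHomMap (F.S v) (F.differentialOn v)) :=
    biproduct.map_π (fun v ↦ (Scheme.Modules.pushforward (F.i v)).map
      ((F.spin v).hom ≫ sheafHomMap (F.S v) (F.differentialOn v))) v
  refine mod_hom_ext fun V s ↦ ?_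
  exact congr($(h1).app (F.c ⁻¹ᵁ V) s)

/-- The pieces of the target of the map defining the normal bundle: the values at a flag, and the
sections of `S_v^∨ ⊗ φ^* T_X`. -/
abbrev piece : τ.Flag ⊕ τ.V → B.Modules := Sum.elim F.flagFiber F.tangents

/-- The pieces of the map defining the normal bundle: the value at a flag at `v`, and minus the
contraction with the differential of `φ`. -/
def pieceValue (k : τ.Flag ⊕ τ.V) (v : τ.V) (h : Sum.elim τ.vertex id k = v) :
    F.sections v ⟶ F.piece k :=
  match k, v, h with
  | .inl f, v, h => F.flagValue f v h
  | .inr _, _, rfl => -F.contractOn _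

variable [Finite J]

/-- The target of the map defining the normal bundle, decomposed into pieces. -/
def pieceDecomposition [Nonempty B] : Decomposition
    ((⨁ F.fiberAt) ⊞ (Scheme.Modules.pushforward F.c).obj F.dualSpinorTangent) F.piece :=
  F.fiberDecomposition.sum F.tangentsDecomposition

/-- The pieces of the map defining the normal bundle of a map. -/
lemma mapRestriction_π [Nonempty B] (k : τ.Flag ⊕ τ.V) (v : τ.V)
    (h : Sum.elim τ.vertex id k = v) : F.mapRestriction ≫ F.pieceDecomposition.π k =
      F.sectionsDecomposition.π v ≫ F.pieceValue k v h := by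
  subst h
  obtain f | v := k
  · refine Eq.trans ?_ (F.restriction_π f _ rfl)
    exact biprod.lift_fst_assoc _ _ _
  · have h1 := F.contraction_π v
    have h2 : F.mapRestriction ≫ F.pieceDecomposition.π (.inr v) =
        (-(Scheme.Modules.pushforward F.c).map F.contraction) ≫ F.tangentsDecomposition.π v :=
      biprod.lift_snd_assoc _ _ _
    rw [h2]
    change _ = F.sectionsDecomposition.π v ≫ (-F.contractOn v)
    rw [Preadditive.neg_comp, Preadditive.comp_neg, h1]

end StableSpinMap

/-! ### Transport along isomorphisms of components -/

section Transport

variable {P₁ P₂ X Y : Scheme.{0}}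

lemma appLE_ores (f : P₁ ⟶ P₂) {V V' : P₂.Opens} {W : P₁.Opens} (h : V' ≤ V) (k : W ≤ f ⁻¹ᵁ V')
    (a : Γ(P₂, V)) :
    f.appLE V' W k (ores P₂ h a) = f.appLE V W (k.trans (f.preimage_mono h)) a :=
  congr($(Scheme.Hom.map_appLE f k (homOfLE h).op) a)

lemma ores_appLE (f : P₁ ⟶ P₂) {V : P₂.Opens} {W W' : P₁.Opens} (h : W' ≤ W) (k : W ≤ f ⁻¹ᵁ V)
    (a : Γ(P₂, V)) : ores P₁ h (f.appLE V W k a) = f.appLE V W' (h.trans k) a :=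
  congr($(Scheme.Hom.appLE_map f k (homOfLE h).op) a)

lemma appLE_appLE (f : P₁ ⟶ P₂) (g : P₂ ⟶ X) {U : X.Opens} {V : P₂.Opens} {W : P₁.Opens}
    (h : V ≤ g ⁻¹ᵁ U) (k : W ≤ f ⁻¹ᵁ V) (a : Γ(X, U)) :
    f.appLE V W k (g.appLE U V h a) = (f ≫ g).appLE U W (k.trans (f.preimage_mono h)) a :=
  congr($(Scheme.Hom.appLE_comp_appLE f g U V W h k) a)

lemma appLE_eq {f g : P₁ ⟶ P₂} (hfg : f = g) {V : P₂.Opens} {W : P₁.Opens} (h : W ≤ f ⁻¹ᵁ V)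
    (k : W ≤ g ⁻¹ᵁ V) (a : Γ(P₂, V)) : f.appLE V W h a = g.appLE V W k a := by
  subst hfg; rfl

variable (e : P₂ ≅ P₁)

lemma le_hom_inv (W : P₂.Opens) : W ≤ e.hom ⁻¹ᵁ e.inv ⁻¹ᵁ W := by
  rw [← Scheme.Hom.comp_preimage, e.hom_inv_id]; exact le_rfl

lemma hom_inv_le (W : P₂.Opens) : e.hom ⁻¹ᵁ e.inv ⁻¹ᵁ W ≤ W := by
  rw [← Scheme.Hom.comp_preimage, e.hom_inv_id]; exact le_rfl

lemma le_inv_hom (W : P₁.Opens) : W ≤ e.inv ⁻¹ᵁ e.hom ⁻¹ᵁ W := le_hom_inv e.symm W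

lemma inv_hom_le (W : P₁.Opens) : e.inv ⁻¹ᵁ e.hom ⁻¹ᵁ W ≤ W := hom_inv_le e.symm W

lemma inv_preimage_le {W : P₂.Opens} {U : P₁.Opens} (h : W ≤ e.hom ⁻¹ᵁ U) : e.inv ⁻¹ᵁ W ≤ U :=
  (e.inv.preimage_mono h).trans (inv_hom_le e U)

lemma hom_appLE_inv_appLE {W W' : P₂.Opens} (h : W' ≤ e.hom ⁻¹ᵁ e.inv ⁻¹ᵁ W) (a : Γ(P₂, W)) :
    e.hom.appLE (e.inv ⁻¹ᵁ W) W' h (e.inv.appLE W (e.inv ⁻¹ᵁ W) le_rfl a) =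
      ores P₂ (h.trans (hom_inv_le e W)) a := by
  rw [appLE_appLE, appLE_eq e.hom_inv_id _ (h.trans (hom_inv_le e W))]
  rfl

variable {φ₁ : P₁ ⟶ X} {φ₂ : P₂ ⟶ X} (hφ : φ₂ = e.hom ≫ φ₁) {x : X ⟶ Y}

lemma inv_preimage_le_of_eq (hφ : φ₂ = e.hom ≫ φ₁) {W : P₂.Opens} {A : X.Opens} (h : W ≤ φ₂ ⁻¹ᵁ A) :
    e.inv ⁻¹ᵁ W ≤ φ₁ ⁻¹ᵁ A := by
  subst hφ
  exact inv_preimage_le e h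

/-- Transport of a derivation along an isomorphism. -/
def DerivationAlong.transport {W : P₂.Opens} (D : DerivationAlong φ₁ x (e.inv ⁻¹ᵁ W)) :
    DerivationAlong φ₂ x W where
  toFun A W' hW hA a := e.hom.appLE (e.inv ⁻¹ᵁ W') W' (le_hom_inv e W')
    (D.toFun A (e.inv ⁻¹ᵁ W') (e.inv.preimage_mono hW) (inv_preimage_le_of_eq e hφ hA) a)
  map_add A W' hW hA a b := by rw [D.map_add, _root_.map_add]
  leibniz A W' hW hA a b := by
    rw [D.leibniz, _root_.map_add, _root_.map_mul, _root_.map_mul, appLE_appLE, appLE_appLE]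
    subst hφ
    rfl
  map_base O A W' hW hA hO y := by rw [D.map_base, _root_.map_zero]
  map_res {A A' W' W''} hA hW hU hf hf' a := by
    rw [D.map_res hA (e.inv.preimage_mono hW) (e.inv.preimage_mono hU)
      (inv_preimage_le_of_eq e hφ hf)]
    exact (appLE_ores _ _ _ _).trans (ores_appLE _ _ _ _).symm

variable {S₁ : P₁.Modules} {S₂ : P₂.Modules}
  (t : S₂ ⟶ (Scheme.Modules.pushforward e.inv).obj S₁)

lemma DerivationAlong.transport_add {W : P₂.Opens}
    (D D' : DerivationAlong φ₁ x (e.inv ⁻¹ᵁ W)) :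
    transport e hφ (D + D') = transport e hφ D + transport e hφ D' :=
  DerivationAlong.ext (by
    funext A W' h hA a
    exact _root_.map_add (e.hom.appLE (e.inv ⁻¹ᵁ W') W' (le_hom_inv e W')).hom _ _)

lemma DerivationAlong.transport_smul {W : P₂.Opens} (r : Γ(P₁, e.inv ⁻¹ᵁ W))
    (D : DerivationAlong φ₁ x (e.inv ⁻¹ᵁ W)) :
    transport e hφ (r • D) = e.hom.appLE (e.inv ⁻¹ᵁ W) W (le_hom_inv e W) r • transport e hφ D :=
  DerivationAlong.ext (by
    funext A W' h hA a
    refine (_root_.map_mul (e.hom.appLE (e.inv ⁻¹ᵁ W') W' (le_hom_inv e W')).hom _ _).trans ?_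
    exact congrArg (· * (transport e hφ D).toFun A W' h hA a)
      ((appLE_ores _ _ _ _).trans (ores_appLE e.hom h (le_hom_inv e W) r).symm))

lemma hom_appLE_inv_app {W : P₂.Opens} (a : Γ(P₂, W)) :
    e.hom.appLE (e.inv ⁻¹ᵁ W) W (le_hom_inv e W) (e.inv.app W a) = a := by
  have h := hom_appLE_inv_appLE e (le_hom_inv e W) a
  rw [ores_self] at h
  rwa [Scheme.Hom.app_eq_appLE]

/-- Transport of a local homomorphism into the sheaf of derivations along an isomorphism. -/
def LocalHom.transport {U : P₁.Opens} (D : LocalHom S₁ (derivationSheaf φ₁ x) U) :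
    LocalHom S₂ (derivationSheaf φ₂ x) (e.hom ⁻¹ᵁ U) where
  toFun W hW u := DerivationAlong.transport e hφ (W := W)
    (D.toFun (e.inv ⁻¹ᵁ W) (inv_preimage_le e hW) (t.app W u))
  map_add W hW u v := by
    rw [_root_.map_add]
    exact (congrArg _ (D.map_add _ _ _ _)).trans (DerivationAlong.transport_add e hφ _ _)
  map_smul W hW r u := by
    refine (congrArg (fun v : Γ(S₁, e.inv ⁻¹ᵁ W) ↦ DerivationAlong.transport e hφ (W := W)
      (D.toFun (e.inv ⁻¹ᵁ W) (inv_preimage_le e hW) v))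
      (app_smul t r u : _ = e.inv.app W r • (show Γ(S₁, e.inv ⁻¹ᵁ W) from t.app W u))).trans ?_
    refine (congrArg _ (D.map_smul _ _ _ _)).trans
      ((DerivationAlong.transport_smul e hφ _ _).trans ?_)
    exact congrArg (· • DerivationAlong.transport e hφ (W := W)
      (D.toFun (e.inv ⁻¹ᵁ W) (inv_preimage_le e hW) (t.app W u))) (hom_appLE_inv_app e r)
  map_res {W W'} h hU u :=
    (congrArg (fun v : Γ(S₁, e.inv ⁻¹ᵁ W') ↦ DerivationAlong.transport e hφ (W := W')
      (D.toFun (e.inv ⁻¹ᵁ W') (inv_preimage_le e (h.trans hU)) v)) (app_mres t h u)).trans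
      (congrArg (DerivationAlong.transport e hφ (W := W')) (D.map_res (e.inv.preimage_mono h)
        (inv_preimage_le e hU) (t.app W u)))

/-- Transport of homomorphisms into sheaves of derivations along an isomorphism. -/
def transportHom : sheafHom S₁ (derivationSheaf φ₁ x) ⟶
    (Scheme.Modules.pushforward e.hom).obj (sheafHom S₂ (derivationSheaf φ₂ x)) :=
  ModuleData.hom (fun U ↦
      { toFun := fun (D : LocalHom S₁ (derivationSheaf φ₁ x) U) ↦ D.transport e hφ t
        map_add' D D' := LocalHom.ext (by
          funext W hW u
          exact DerivationAlong.transport_add e hφ _ _)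
        map_smul' r D := LocalHom.ext (by
          funext W hW u
          refine (DerivationAlong.transport_smul e hφ (ores P₁ (inv_preimage_le e hW) r) _).trans ?_
          refine congrArg (· • DerivationAlong.transport e hφ (W := W)
            (D.toFun (e.inv ⁻¹ᵁ W) (inv_preimage_le e hW) (t.app W u))) ?_
          rw [appLE_ores, ← ores_appLE e.hom hW le_rfl, ← Scheme.Hom.app_eq_appLE]
          rfl) })
    (fun _ _ ↦ rfl)

/-- Transport along an isomorphism and then along its inverse is the identity. -/
lemma transport_transport {φ₁ : P₁ ⟶ X} {φ₂ : P₂ ⟶ X} (hφ : φ₂ = e.hom ≫ φ₁)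
    (hφ' : φ₁ = e.inv ≫ φ₂) {x : X ⟶ Y} {S₁ : P₁.Modules} {S₂ : P₂.Modules}
    (t : S₂ ⟶ (Scheme.Modules.pushforward e.inv).obj S₁)
    (t' : S₁ ⟶ (Scheme.Modules.pushforward e.hom).obj S₂)
    (h : ∀ (W : P₁.Opens) (u : Γ(S₁, W)), t.app (e.hom ⁻¹ᵁ W) (t'.app W u) =
      mres S₁ (inv_hom_le e W) u) {U : P₁.Opens} (D : LocalHom S₁ (derivationSheaf φ₁ x) U) :
    (D.transport e hφ t).transport e.symm hφ' t' = LocalHom.res (inv_hom_le e U) D := by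
  refine LocalHom.ext ?_
  funext W hW u
  refine DerivationAlong.ext ?_
  funext A W' hW' hA a
  have h1 : D.toFun (e.inv ⁻¹ᵁ e.hom ⁻¹ᵁ W) ((inv_hom_le e W).trans (hW.trans (inv_hom_le e U)))
      (t.app (e.hom ⁻¹ᵁ W) (t'.app W u)) =
      DerivationAlong.res (inv_hom_le e W) (D.toFun W (hW.trans (inv_hom_le e U)) u) := by
    rw [h]
    exact D.map_res _ _ _
  have h2 : DerivationAlong.toFun (D.toFun (e.inv ⁻¹ᵁ e.hom ⁻¹ᵁ W)
      ((inv_hom_le e W).trans (hW.trans (inv_hom_le e U))) (t.app (e.hom ⁻¹ᵁ W) (t'.app W u))) A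
      (e.inv ⁻¹ᵁ e.hom ⁻¹ᵁ W') (e.inv.preimage_mono (e.hom.preimage_mono hW'))
      ((inv_hom_le e W').trans hA) a = ores P₁ (inv_hom_le e W') (DerivationAlong.toFun
        (D.toFun W (hW.trans (inv_hom_le e U)) u) A W' hW' hA a) := by
    rw [h1]
    exact (DerivationAlong.map_toFun (show DerivationAlong φ₁ x W from
      D.toFun W (hW.trans (inv_hom_le e U)) u) (inv_hom_le e W') hW' hA a).symm
  refine (congrArg (fun y ↦ e.inv.appLE (e.hom ⁻¹ᵁ W') W' (le_inv_hom e W')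
    (e.hom.appLE (e.inv ⁻¹ᵁ e.hom ⁻¹ᵁ W') (e.hom ⁻¹ᵁ W') (le_hom_inv e _) y)) h2).trans ?_
  refine (congrArg _ (appLE_ores _ _ _ _)).trans ?_
  exact (hom_appLE_inv_appLE e.symm (le_inv_hom e W') _).trans (ores_self _ _)

/-- The identity, from a sheaf to its direct image under two inverse isomorphisms. -/
def toPushforward (M : P₁.Modules) : M ≅
    (Scheme.Modules.pushforward e.hom).obj ((Scheme.Modules.pushforward e.inv).obj M) :=
  ((Scheme.Modules.pushforwardId P₁).app M).symm ≪≫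
    (Scheme.Modules.pushforwardCongr e.inv_hom_id).symm.app M ≪≫
    (Scheme.Modules.pushforwardComp e.inv e.hom).symm.app M

/-- Transport of homomorphisms into sheaves of derivations along an isomorphism, as an
isomorphism. -/
lemma exists_transportIso (hφ' : φ₁ = e.inv ≫ φ₂)
    (θ : S₂ ≅ (Scheme.Modules.pushforward e.inv).obj S₁) :
    ∃ Θ : sheafHom S₁ (derivationSheaf φ₁ x) ≅
      (Scheme.Modules.pushforward e.hom).obj (sheafHom S₂ (derivationSheaf φ₂ x)),
      Θ.hom = transportHom e hφ θ.hom := by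
  let t' : S₁ ⟶ (Scheme.Modules.pushforward e.hom).obj S₂ :=
    (toPushforward e S₁).hom ≫ (Scheme.Modules.pushforward e.hom).map θ.inv
  have ht (W : P₁.Opens) (u : Γ(S₁, W)) : θ.hom.app (e.hom ⁻¹ᵁ W) (t'.app W u) =
      mres S₁ (inv_hom_le e W) u :=
    congr($(θ.inv_hom_id).app (e.hom ⁻¹ᵁ W) (mres S₁ (inv_hom_le e W) u))
  have ht' (W : P₂.Opens) (u : Γ(S₂, W)) : t'.app (e.inv ⁻¹ᵁ W) (θ.hom.app W u) =
      mres S₂ (hom_inv_le e W) u := by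
    have h1 : mres ((Scheme.Modules.pushforward e.inv).obj S₁) (hom_inv_le e W) (θ.hom.app W u) =
      θ.hom.app _ (mres S₂ (hom_inv_le e W) u) := (app_mres θ.hom _ _).symm
    exact (congrArg (θ.inv.app _) h1).trans
      congr($(θ.hom_inv_id).app _ (mres S₂ (hom_inv_le e W) u))
  refine ⟨⟨transportHom e hφ θ.hom, (Scheme.Modules.pushforward e.hom).map
    (transportHom e.symm hφ' t') ≫ (toPushforward e _).inv, ?_, ?_⟩, rfl⟩
  · rw [← Category.assoc, Iso.comp_inv_eq, Category.id_comp]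
    refine mod_hom_ext fun U D ↦ ?_
    exact transport_transport e hφ hφ' θ.hom t' ht D
  · refine mod_hom_ext fun U D ↦ ?_
    exact congrArg (LocalHom.res (e.hom.preimage_mono (le_inv_hom e U)))
      (transport_transport e.symm hφ' hφ t' θ.hom ht' (U := e.hom ⁻¹ᵁ U) D)

/-- The direct image of an isomorphism `S₂ ≅ e.inv_* S₁`. -/
lemma exists_pushforward_iso {B : Scheme.{0}} {c₁ : P₁ ⟶ B} {c₂ : P₂ ⟶ B} (hc : c₁ = e.inv ≫ c₂)
    (θ : S₂ ≅ (Scheme.Modules.pushforward e.inv).obj S₁) :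
    ∃ E : (Scheme.Modules.pushforward c₂).obj S₂ ≅ (Scheme.Modules.pushforward c₁).obj S₁,
      ∀ (V : B.Opens) (s : Γ(S₂, c₂ ⁻¹ᵁ V)), E.hom.app V s =
        mres S₁ (by subst hc; exact le_rfl) (θ.hom.app (c₂ ⁻¹ᵁ V) s) := by
  subst hc
  exact ⟨(Scheme.Modules.pushforward c₂).mapIso θ ≪≫
    (Scheme.Modules.pushforwardComp e.inv c₂).app S₁, fun V s ↦
      (mres_self (M := S₁) (U := e.inv ⁻¹ᵁ c₂ ⁻¹ᵁ V) le_rfl (θ.hom.app (c₂ ⁻¹ᵁ V) s)).symm⟩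

/-- Compatibility of the values along a section with an isomorphism `S₂ ≅ e.inv_* S₁`. -/
lemma exists_pullback_iso {B : Scheme.{0}} {c₁ : P₁ ⟶ B} {c₂ : P₂ ⟶ B} (hc : c₁ = e.inv ≫ c₂)
    (θ : S₂ ≅ (Scheme.Modules.pushforward e.inv).obj S₁) {p₁ : B ⟶ P₁} {p₂ : B ⟶ P₂}
    (hp₁ : p₁ ≫ c₁ = 𝟙 B) (hp₂ : p₂ ≫ c₂ = 𝟙 B) (hp : p₁ ≫ e.inv = p₂)
    (E : (Scheme.Modules.pushforward c₂).obj S₂ ≅ (Scheme.Modules.pushforward c₁).obj S₁)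
    (hE : ∀ (V : B.Opens) (s : Γ(S₂, c₂ ⁻¹ᵁ V)), E.hom.app V s =
        mres S₁ (by subst hc; exact le_rfl) (θ.hom.app (c₂ ⁻¹ᵁ V) s)) :
    ∃ e' : (Scheme.Modules.pullback p₂).obj S₂ ≅ (Scheme.Modules.pullback p₁).obj S₁,
      restrictToSection c₂ p₂ hp₂ S₂ ≫ e'.hom = E.hom ≫ restrictToSection c₁ p₁ hp₁ S₁ := by
  obtain ⟨e', he'⟩ := exists_pullback_pushforward_iso p₁ e.inv hp S₁
  refine ⟨(Scheme.Modules.pullback p₂).mapIso θ ≪≫ e', mod_hom_ext fun V s ↦ ?_⟩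
  have h2 (V : P₂.Opens) (V' : B.Opens) (hV : V' ≤ p₂ ⁻¹ᵁ V)
      (hV' : V' ≤ p₁ ⁻¹ᵁ (e.inv ⁻¹ᵁ V)) (s : Γ(S₂, V)) :
      e'.hom.app V' (((Scheme.Modules.pullback p₂).map θ.hom).app V' (mres _ hV
          (pullSection p₂ S₂ s))) = mres _ hV' (pullSection p₁ S₁ (θ.hom.app V s)) := by
    refine (congrArg (e'.hom.app V') ((app_mres _ hV _).trans
      (congrArg _ (pullback_map_pullSection _ _ s)))).trans ?_
    refine (app_mres _ hV _).trans ((congrArg _ (he' V _)).trans ?_)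
    exact mres_mres _ _ _
  have h3 : E.hom.app V s = mres S₁ (by subst hc; exact le_rfl) (θ.hom.app (c₂ ⁻¹ᵁ V) s) := hE V s
  have h4 := pullSection_mres p₁ (by subst hc; exact le_rfl : c₁ ⁻¹ᵁ V ≤ e.inv ⁻¹ᵁ (c₂ ⁻¹ᵁ V))
    (M := S₁) (θ.hom.app (c₂ ⁻¹ᵁ V) s)
  refine (h2 (c₂ ⁻¹ᵁ V) V (le_section hp₂ V) (by subst hp; exact le_section hp₂ V) s).trans ?_
  refine Eq.trans ?_ (congrArg (fun u ↦ mres _ (le_section hp₁ V) (pullSection p₁ S₁ u)) h3).symm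
  exact ((congrArg (mres _ (le_section hp₁ V)) h4).trans (mres_mres _ _ _)).symm

lemma contract_apply {P B X Y : Scheme.{0}} {c : P ⟶ B} {S : P.Modules} {φ : P ⟶ X} {b : B ⟶ Y}
    {x : X ⟶ Y} (w : φ ≫ x = c ≫ b) (σ : S ≅ sheafHom S (derivationSheaf (𝟙 P) c))
    {U W W' : P.Opens} (s : Γ(S, U)) (hW : W ≤ U) (u : Γ(S, W)) {A : X.Opens} (hW' : W' ≤ W)
    (hA : W' ≤ φ ⁻¹ᵁ A) (a : Γ(X, A)) :
    DerivationAlong.toFun (LocalHom.toFun ((contract w σ).app U s) W hW u) A W' hW' hA a =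
      spinDer σ (mres S (hW'.trans hW) s) (mres S hW' u) (φ.appLE A W' hA a) := by
  have h1 : σ.hom.app W (mres S hW s) = LocalHom.res hW (σ.hom.app U s) := app_mres σ.hom hW s
  rw [spinDer, ← mres_mres hW hW', spinField_mres, spinField, h1]
  rfl

/-- Compatibility of the contraction with the differential with an isomorphism
`S₂ ≅ e.inv_* S₁`. -/
lemma exists_tangent_iso {B : Scheme.{0}} {b : B ⟶ Y} {c₁ : P₁ ⟶ B} {c₂ : P₂ ⟶ B}
    (hc : c₁ = e.inv ≫ c₂) (hφ : φ₂ = e.hom ≫ φ₁) (w₁ : φ₁ ≫ x = c₁ ≫ b) (w₂ : φ₂ ≫ x = c₂ ≫ b)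
    (σ₁ : S₁ ≅ sheafHom S₁ (derivationSheaf (𝟙 P₁) c₁))
    (σ₂ : S₂ ≅ sheafHom S₂ (derivationSheaf (𝟙 P₂) c₂))
    (θ : S₂ ≅ (Scheme.Modules.pushforward e.inv).obj S₁)
    (hσ : ∀ (W : P₂.Opens) (s u : Γ(S₂, W)) (h : Γ(P₂, W)), e.inv.app W (spinDer σ₂ s u h) =
      spinDer σ₁ (W := e.inv ⁻¹ᵁ W) (θ.hom.app W s) (θ.hom.app W u) (e.inv.app W h))
    (E : (Scheme.Modules.pushforward c₂).obj S₂ ≅ (Scheme.Modules.pushforward c₁).obj S₁)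
    (hE : ∀ (V : B.Opens) (s : Γ(S₂, c₂ ⁻¹ᵁ V)), E.hom.app V s =
        mres S₁ (by subst hc; exact le_rfl) (θ.hom.app (c₂ ⁻¹ᵁ V) s)) :
    ∃ e' : (Scheme.Modules.pushforward c₁).obj (sheafHom S₁ (derivationSheaf φ₁ x)) ≅
        (Scheme.Modules.pushforward c₂).obj (sheafHom S₂ (derivationSheaf φ₂ x)),
      E.hom ≫ (Scheme.Modules.pushforward c₁).map (contract w₁ σ₁) ≫ e'.hom =
        (Scheme.Modules.pushforward c₂).map (contract w₂ σ₂) := by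
  have hφ' : φ₁ = e.inv ≫ φ₂ := by rw [hφ, Iso.inv_hom_id_assoc]
  have hc' : c₂ = e.hom ≫ c₁ := by rw [hc, Iso.hom_inv_id_assoc]
  obtain ⟨Θ, hΘ⟩ := exists_transportIso e hφ (x := x) hφ' θ
  obtain ⟨e', he'⟩ := exists_pushforward_iso e.symm hc' Θ
  refine ⟨e', mod_hom_ext fun V s ↦ ?_⟩
  have hle : c₁ ⁻¹ᵁ V ≤ e.inv ⁻¹ᵁ c₂ ⁻¹ᵁ V := by rw [hc]; exact le_rfl
  have hle' : c₂ ⁻¹ᵁ V ≤ e.hom ⁻¹ᵁ c₁ ⁻¹ᵁ V := by rw [hc']; exact le_rfl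
  have h1 : E.hom.app V s = mres S₁ hle (θ.hom.app (c₂ ⁻¹ᵁ V) s) := hE V s
  have h2 (D : LocalHom S₁ (derivationSheaf φ₁ x) (c₁ ⁻¹ᵁ V)) : e'.hom.app V D =
      LocalHom.res hle' (D.transport e hφ θ.hom) := by
    refine (he' V D).trans ?_
    rw [hΘ]
    rfl
  refine (h2 ((contract w₁ σ₁).app (c₁ ⁻¹ᵁ V) (E.hom.app V s))).trans ?_
  refine LocalHom.ext ?_
  funext W hW u
  refine DerivationAlong.ext ?_
  funext A W' hW' hA a
  refine Eq.trans ?_ (contract_apply w₂ σ₂ (U := c₂ ⁻¹ᵁ V) s hW u hW' hA a).symm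
  have hA' := inv_preimage_le_of_eq e hφ hA
  have h3 := contract_apply w₁ σ₁ (U := c₁ ⁻¹ᵁ V) (E.hom.app V s)
    (inv_preimage_le e (hW.trans hle')) (show Γ(S₁, e.inv ⁻¹ᵁ W) from θ.hom.app W u)
    (e.inv.preimage_mono hW') hA' a
  refine (congrArg (e.hom.appLE (e.inv ⁻¹ᵁ W') W' (le_hom_inv e W')) h3).trans ?_
  rw [← hom_appLE_inv_app e (spinDer σ₂ _ _ _), hσ]
  have h4 : mres S₁ ((e.inv.preimage_mono hW').trans (inv_preimage_le e (hW.trans hle')))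
      (E.hom.app V s) = θ.hom.app W' (mres S₂ (hW'.trans hW) s) :=
    (congrArg _ h1).trans ((mres_mres _ _ _).trans (app_mres θ.hom (hW'.trans hW) s).symm)
  have h5 : mres S₁ (e.inv.preimage_mono hW') (show Γ(S₁, e.inv ⁻¹ᵁ W) from θ.hom.app W u) =
      θ.hom.app W' (mres S₂ hW' u) := (app_mres θ.hom hW' u).symm
  have h6 : φ₁.appLE A (e.inv ⁻¹ᵁ W') hA' a = e.inv.app W' (φ₂.appLE A W' hA a) := by
    subst hφ'
    rw [Scheme.Hom.app_eq_appLE, appLE_appLE]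
  refine congrArg (e.hom.appLE (e.inv ⁻¹ᵁ W') W' (le_hom_inv e W')) ?_
  exact congr (congr (congrArg (fun s u h ↦ spinDer σ₁ (W := e.inv ⁻¹ᵁ W') s u h) h4) h5) h6

end Transport

/-! ### Flags at a vertex, comparison under stabilization -/

namespace MarkedTree

variable {J : Type} (τ : MarkedTree J) [Finite J]

lemma exists_flags {v : τ.V} (h : 3 ≤ τ.valence v) (f₀ : τ.Flag) :
    ∃ f f', τ.vertex f = v ∧ τ.vertex f' = v ∧ f ≠ f' ∧ f ≠ f₀ ∧ f' ≠ f₀ := by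
  classical
  have := Fintype.ofFinite τ.Flag
  let s : Finset τ.Flag := {f | τ.vertex f = v}
  have hs : 1 < (s.erase f₀).card := by
    have h1 : s.card = τ.valence v := by
      rw [valence, Nat.card_eq_fintype_card, Fintype.card_subtype]
    have h2 := s.pred_card_le_card_erase (a := f₀)
    omega
  obtain ⟨f, hf, f', hf', hne⟩ := Finset.one_lt_card.1 hs
  simp only [s, Finset.mem_erase, Finset.mem_filter, Finset.mem_univ, true_and] at hf hf'
  exact ⟨f, f', hf.2, hf'.2, hne, hf.1, hf'.1⟩

/-- At a vertex with three flags, `f₀` and `f` leave exactly one further flag. -/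
lemma exists_third_flag {v : τ.V} (h : τ.valence v = 3) {f₀ f : τ.Flag} (hf₀ : τ.vertex f₀ = v)
    (hf : τ.vertex f = v) (hne : f ≠ f₀) :
    ∃ f', τ.vertex f' = v ∧ f ≠ f' ∧ ∀ l, τ.vertex l = v → l ≠ f → l ≠ f' → l = f₀ := by
  classical
  have := Fintype.ofFinite τ.Flag
  let s : Finset τ.Flag := {f | τ.vertex f = v}
  have hs (f : τ.Flag) : f ∈ s ↔ τ.vertex f = v := by simp [s]
  have h1 : s.card = 3 := by
    rw [← h, valence, Nat.card_eq_fintype_card, Fintype.card_subtype]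
  have h2 : ((s.erase f₀).erase f).card = 1 := by
    rw [Finset.card_erase_of_mem (Finset.mem_erase.2 ⟨hne, (hs f).2 hf⟩),
      Finset.card_erase_of_mem ((hs f₀).2 hf₀), h1]
  obtain ⟨f', hf'⟩ := Finset.card_eq_one.1 h2
  have h3 (l : τ.Flag) : l = f' ↔ l ≠ f ∧ l ≠ f₀ ∧ τ.vertex l = v := by
    rw [← Finset.mem_singleton, ← hf', Finset.mem_erase, Finset.mem_erase, hs]
  have h4 := (h3 f').1 rfl
  refine ⟨f', h4.2.2, h4.1.symm, fun l hl hlf hlf' ↦ ?_⟩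
  by_contra hl₀
  exact hlf' ((h3 l).2 ⟨hlf, hl₀, hl⟩)

end MarkedTree

lemma Decomposition.comp_eq_add {A : Type*} [Category* A] [Preadditive A] {K : Type*} [Finite K]
    {Q : A} {L : K → A} (d : Decomposition Q L) {Z Z' : A} (f : Z' ⟶ Q) (h : Q ⟶ Z) {k k' : K}
    (hne : k ≠ k') (H : ∀ l, l ≠ k → l ≠ k' → (f ≫ d.π l) ≫ d.ι l ≫ h = 0) :
    f ≫ h = (f ≫ d.π k) ≫ d.ι k ≫ h + (f ≫ d.π k') ≫ d.ι k' ≫ h := by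
  classical
  let := Fintype.ofFinite K
  have h1 : f ≫ h = ∑ l, (f ≫ d.π l) ≫ d.ι l ≫ h := by
    conv_lhs => rw [← Category.id_comp h, ← d.desc_ι, desc]
    simp only [Preadditive.sum_comp, Preadditive.comp_sum, Category.assoc]
  rw [h1, ← Finset.sum_subset (Finset.subset_univ {k, k'}), Finset.sum_pair hne]
  intro l _ hl
  simp only [Finset.mem_insert, Finset.mem_singleton, not_or] at hl
  exact H l hl.1 hl.2

/-- If only two of the pieces of `r` at `v` contribute to `h`, then their contributions cancel
when `r ≫ h = 0`. -/
lemma add_eq_zero_of_comp_eq_zero {A : Type*} [Category* A] [Preadditive A] {V K : Type*}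
    [Finite K] {vtx : K → V} {P Q : A} {L : K → A} {Pv : V → A} (dP : Decomposition P Pv)
    (dQ : Decomposition Q L) {ρ : ∀ k v, vtx k = v → (Pv v ⟶ L k)} {r : P ⟶ Q}
    (hr : ∀ k v (h : vtx k = v), r ≫ dQ.π k = dP.π v ≫ ρ k v h) {Z : A} {h : Q ⟶ Z}
    (hrh : r ≫ h = 0) {v : V} {k k' : K} (hne : k ≠ k') (hk : vtx k = v) (hk' : vtx k' = v)
    (H : ∀ l, vtx l = v → l ≠ k → l ≠ k' → dQ.ι l ≫ h = 0) :
    ρ k v hk ≫ dQ.ι k ≫ h + ρ k' v hk' ≫ dQ.ι k' ≫ h = 0 := by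
  have h1 := dQ.comp_eq_add (dP.ι v ≫ r) h hne fun l hl hl' ↦ ?_
  · rw [(Category.assoc _ _ _).trans (ι_comp_π dP dQ hr hk),
      (Category.assoc _ _ _).trans (ι_comp_π dP dQ hr hk'), Category.assoc, hrh, comp_zero] at h1
    exact h1.symm
  · by_cases hlv : vtx l = v
    · rw [H l hlv hl hl', comp_zero]
    · rw [(Category.assoc _ _ _).trans (ι_comp_π_ne dP dQ hr hlv), zero_comp]

section ShortExact

variable {A : Type*} [Category* A] [Abelian A]

lemma exists_shortExact_of_iso {M M' N N₁ : A} (e : M' ≅ M) {f : M ⟶ N} {f' : M' ⟶ N}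
    (hf : f' = e.hom ≫ f) (h : ∃ (g : N ⟶ N₁) (w : f' ≫ g = 0), (ShortComplex.mk f' g w).ShortExact) :
    ∃ (g : N ⟶ N₁) (w : f ≫ g = 0), (ShortComplex.mk f g w).ShortExact := by
  obtain ⟨g, w, hg⟩ := h
  have w' : f ≫ g = 0 := by
    rw [← cancel_epi e.hom, comp_zero, ← w, hf, Category.assoc]
  refine ⟨g, w', ShortComplex.shortExact_of_iso (S₁ := .mk f' g w)
    (ShortComplex.isoMk e (Iso.refl _) (Iso.refl _)
    ?_ ?_) hg⟩
  · simpa using hf.symm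
  · simp

lemma exists_shortExact_of_isZero (h : ∀ M : A, IsZero M) {M N N₁ : A} (f : M ⟶ N) :
    ∃ (g : N ⟶ N₁) (w : f ≫ g = 0), (ShortComplex.mk f g w).ShortExact := by
  refine ⟨0, comp_zero, ?_⟩
  refine ShortComplex.ShortExact.mk' (ShortComplex.exact_of_isZero_X₂ _ (h N))
    ⟨fun _ _ _ ↦ (h M).eq_of_tgt _ _⟩ ⟨fun _ _ _ ↦ (h N₁).eq_of_src _ _⟩

end ShortExact

namespace Stabilization

variable {B : Scheme.{0}} {J : Type} {τ : MarkedTree J} {F : SpinCurve B τ}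
  {t₀ : J} {contr : τ.V → Prop} {τ₁ : MarkedTree {j : J // j ≠ t₀}} {F₁ : SpinCurve B τ₁}
  (σ : Stabilization F t₀ contr F₁)

lemma proj_eq (w : τ₁.V) : F.proj (σ.vert w).1 = (σ.compIso w).symm.inv ≫ F₁.proj w := by
  rw [SpinCurve.proj, SpinCurve.proj, Iso.symm_inv, ← Category.assoc, ← σ.compIso_st,
    Category.assoc, σ.st_over]

/-- The spinor bundles on corresponding components have the same sections. -/
def sectionsIso (w : τ₁.V) : F₁.sections w ≅ F.sections (σ.vert w).1 :=
  (exists_pushforward_iso (σ.compIso w).symm (σ.proj_eq w) (σ.spinIso w)).choose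

lemma sectionsIso_app (w : τ₁.V) (V : B.Opens) (s : Γ(F₁.S w, F₁.proj w ⁻¹ᵁ V)) :
    (σ.sectionsIso w).hom.app V s = mres (F.S (σ.vert w).1) (by rw [σ.proj_eq]; exact le_rfl)
      ((σ.spinIso w).hom.app (F₁.proj w ⁻¹ᵁ V) s) :=
  (exists_pushforward_iso (σ.compIso w).symm (σ.proj_eq w) (σ.spinIso w)).choose_spec V s

lemma exists_flagFiber_iso (f : τ₁.Flag) : ∃ e : F₁.flagFiber f ≅ F.flagFiber (σ.flagMap f).1,
    ∀ w (h : τ₁.vertex f = w) (h' : τ.vertex (σ.flagMap f).1 = (σ.vert w).1),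
      F₁.flagValue f w h ≫ e.hom =
        (σ.sectionsIso w).hom ≫ F.flagValue (σ.flagMap f).1 (σ.vert w).1 h' := by
  obtain ⟨p, hp, e, hpi, hpe⟩ := F.exists_flag_section _ _ (σ.vertex_flagMap f)
  have hpc : p ≫ (σ.compIso (τ₁.vertex f)).symm.inv = F₁.flag f := by
    rw [← cancel_mono (F₁.i _), Iso.symm_inv, Category.assoc, ← σ.compIso_st, ← Category.assoc,
      hpi, σ.flag_st]
  obtain ⟨e', he'⟩ := exists_pullback_iso (σ.compIso (τ₁.vertex f)).symm (σ.proj_eq _)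
    (σ.spinIso _) hp (F₁.flag_section f) hpc (σ.sectionsIso _) (σ.sectionsIso_app _)
  refine ⟨e' ≪≫ e, ?_⟩
  rintro _ rfl h'
  rw [← hpe, Iso.trans_hom, ← Category.assoc, ← Category.assoc]
  exact congrArg (· ≫ e.hom) he'

/-- The values at corresponding flags. -/
def flagFiberIso (f : τ₁.Flag) : F₁.flagFiber f ≅ F.flagFiber (σ.flagMap f).1 :=
  (σ.exists_flagFiber_iso f).choose

lemma flagValue_flagFiberIso (f : τ₁.Flag) (w : τ₁.V) (h : τ₁.vertex f = w)
    (h' : τ.vertex (σ.flagMap f).1 = (σ.vert w).1) :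
    F₁.flagValue f w h ≫ (σ.flagFiberIso f).hom =
      (σ.sectionsIso w).hom ≫ F.flagValue (σ.flagMap f).1 (σ.vert w).1 h' :=
  (σ.exists_flagFiber_iso f).choose_spec w h h'

end Stabilization

/-! ### The short exact sequences -/

section Curve

variable {B : Scheme.{0}} {J : Type} [Finite J] {τ : MarkedTree J} (F : SpinCurve B τ)
  {t₀ : J} {τ₁ : MarkedTree {j : J // j ≠ t₀}} {F₁ : SpinCurve B τ₁}

/-- A section of the spinor bundle of a component with at least three flags which vanishes at
all of them but one is zero. -/
lemma SpinCurve.eq_zero_of_valence {v : τ.V} (hv : 3 ≤ τ.valence v) (f₀ : τ.Flag) {Z : B.Modules}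
    {y : Z ⟶ F.sections v} (hy : ∀ f (h : τ.vertex f = v), f ≠ f₀ → y ≫ F.flagValue f v h = 0) :
    y = 0 := by
  obtain ⟨f, f', hf, hf', hne, h, h'⟩ := τ.exists_flags hv f₀
  exact F.eq_zero_of_flagValue hf hf' hne (hy f hf h) (hy f' hf' h')

/-- The sequence for a stable spin curve over a non-empty base. -/
lemma exists_shortExact_susyNormal [Nonempty B] (hτ : τ.IsStable)
    (σ : Stabilization F t₀ (fun v ↦ v = τ.tail t₀ ∧ τ.valence v = 3) F₁) :
    ∃ (g : F.susyNormal ⟶ F₁.susyNormal) (w : F.tailMap t₀ ≫ g = 0),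
      (ShortComplex.mk (F.tailMap t₀) g w).ShortExact := by
  obtain ⟨e, he⟩ := F.exists_tailIso t₀
  refine exists_shortExact_of_iso e (f' := F.fiberDecomposition.ι (.inl t₀) ≫
    cokernel.π F.restriction)
    ((congrArg (· ≫ cokernel.π F.restriction) he).trans (Category.assoc _ _ _)) ?_
  refine exists_shortExact_cokernel (vtx := τ.vertex) (vtx₁ := τ₁.vertex) F.sectionsDecomposition
    F.fiberDecomposition F₁.sectionsDecomposition F₁.fiberDecomposition (ρ := F.flagValue)
    (ρ₁ := F₁.flagValue) F.restriction_π F₁.restriction_π (.inl t₀)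
    (contr := fun v ↦ v = τ.tail t₀ ∧ τ.valence v = 3) (vert := fun w ↦ (σ.vert w).1)
    (km := fun f ↦ (σ.flagMap f).1) (Subtype.val_injective.comp σ.vert.injective)
    (fun w ↦ (σ.vert w).2) (Subtype.val_injective.comp σ.flagMap.injective)
    (fun k ↦ ⟨fun h ↦ ⟨σ.flagMap.symm ⟨k, h⟩, by simp⟩, ?_⟩)
    (fun k w h ↦ by rw [σ.vertex_flagMap, h])
    (fun w ↦ (σ.sectionsIso w).symm) (fun f ↦ (σ.flagFiberIso f).symm) ?_ ?_ ?_
  · rintro ⟨f, rfl⟩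
    exact (σ.flagMap f).2
  · intro f w h
    have := σ.flagValue_flagFiberIso f w h (by rw [σ.vertex_flagMap, h])
    exact (Iso.comp_inv_eq _).2 (by rw [Iso.symm_hom, Category.assoc, this, Iso.inv_hom_id_assoc])
  · intro Z y hy
    rw [F.eq_zero_of_valence (hτ _) (.inl t₀) hy, zero_comp]
  · rintro Z h hr h₀ f ⟨hf, hv⟩
    by_cases hft : f = .inl t₀
    · rw [hft, h₀]
    obtain ⟨f', hf', hne, hl⟩ := τ.exists_third_flag (hf ▸ hv : τ.valence (τ.tail t₀) = 3)
      (f₀ := .inl t₀) rfl hf hft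
    exact F.eq_zero_of_flagValue_comp hf hf' hne (add_eq_zero_of_comp_eq_zero
      F.sectionsDecomposition F.fiberDecomposition F.restriction_π hr hne hf hf'
      fun l hlv hlf hlf' ↦ by rw [hl l hlv hlf hlf', h₀])

end Curve

section Map

variable {B X : Scheme.{0}} {b : B ⟶ Spec (.of ℂ)} {x : X ⟶ Spec (.of ℂ)} {J : Type}
  {τ : MarkedTree J} (F : StableSpinMap b x τ) {t₀ : J} {τ₁ : MarkedTree {j : J // j ≠ t₀}}
  {F₁ : StableSpinMap b x τ₁}

lemma exists_tangentsIso {contr : τ.V → Prop}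
    (σ : Stabilization F.toSpinCurve t₀ contr F₁.toSpinCurve) (hφ : σ.st ≫ F₁.φ = F.φ) (w : τ₁.V) :
    ∃ e : F.tangents (σ.vert w).1 ≅ F₁.tangents w,
      (σ.sectionsIso w).hom ≫ F.contractOn (σ.vert w).1 ≫ e.hom = F₁.contractOn w :=
  exists_tangent_iso (σ.compIso w).symm (σ.proj_eq w)
    (by rw [Iso.symm_hom, Iso.eq_inv_comp, ← hφ, ← Category.assoc, ← Category.assoc, σ.compIso_st])
    (F.comp_over _) (F₁.comp_over w) (F.spin _) (F₁.spin w) (σ.spinIso w) (σ.spinIso_spin w)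
    (σ.sectionsIso w) (σ.sectionsIso_app w)

/-- A component whose class is zero has at least three flags. -/
lemma StableSpinMap.valence_of_isConstantOn [Nonempty B] {v : τ.V} (hv : F.IsConstantOn v) :
    3 ≤ τ.valence v := by
  obtain ⟨p⟩ := ‹Nonempty B›
  let K := AlgebraicClosure (B.residueField p)
  exact F.stable v K (Spec.map (CommRingCat.ofHom (algebraMap (B.residueField p) K)) ≫
    B.fromSpecResidueField p) (hv K _)

variable [Finite J]

/-- The sequence for a stable spin map over a non-empty base. -/
lemma exists_shortExact_mapSusyNormal [IsSeparated x] [Nonempty B]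
    (σ : Stabilization F.toSpinCurve t₀
      (fun v ↦ v = τ.tail t₀ ∧ τ.valence v = 3 ∧ F.IsConstantOn v) F₁.toSpinCurve)
    (hφ : σ.st ≫ F₁.φ = F.φ) :
    ∃ (g : F.mapSusyNormal ⟶ F₁.mapSusyNormal) (w : F.mapTailMap t₀ ≫ g = 0),
      (ShortComplex.mk (F.mapTailMap t₀) g w).ShortExact := by
  obtain ⟨e, he⟩ := F.exists_tailIso t₀
  choose eT heT using exists_tangentsIso F σ hφ
  refine exists_shortExact_of_iso e (f' := F.pieceDecomposition.ι (.inl (.inl t₀)) ≫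
    cokernel.π F.mapRestriction)
    ((congrArg (fun y ↦ (y ≫ biprod.inl) ≫ cokernel.π F.mapRestriction) he).trans
      (by rw [Category.assoc, Category.assoc]; rfl)) ?_
  let eL : ∀ k : τ₁.Flag ⊕ τ₁.V, F.piece (Sum.map (fun f ↦ (σ.flagMap f).1)
      (fun w ↦ (σ.vert w).1) k) ≅ F₁.piece k := fun k ↦ match k with
    | .inl f => (σ.flagFiberIso f).symm
    | .inr w => eT w
  refine exists_shortExact_cokernel (vtx := Sum.elim τ.vertex id)
    (vtx₁ := Sum.elim τ₁.vertex id) F.sectionsDecomposition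
    F.pieceDecomposition F₁.sectionsDecomposition F₁.pieceDecomposition (ρ := F.pieceValue)
    (ρ₁ := F₁.pieceValue) F.mapRestriction_π F₁.mapRestriction_π (.inl (.inl t₀))
    (contr := fun v ↦ v = τ.tail t₀ ∧ τ.valence v = 3 ∧ F.IsConstantOn v)
    (vert := fun w ↦ (σ.vert w).1)
    (km := Sum.map (fun f ↦ (σ.flagMap f).1) (fun w ↦ (σ.vert w).1))
    (Subtype.val_injective.comp σ.vert.injective)
    (fun w ↦ (σ.vert w).2) ((Subtype.val_injective.comp σ.flagMap.injective).sumMap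
      (Subtype.val_injective.comp σ.vert.injective))
    (fun k ↦ ⟨fun ⟨h, h'⟩ ↦ ?_, ?_⟩) ?_ (fun w ↦ (σ.sectionsIso w).symm) eL ?_ ?_ ?_
  · obtain f | v := k
    · exact ⟨.inl (σ.flagMap.symm ⟨f, fun hf ↦ h (congrArg _ hf), h'⟩), by simp⟩
    · exact ⟨.inr (σ.vert.symm ⟨v, h'⟩), by simp⟩
  · rintro ⟨f | w, rfl⟩
    · exact ⟨fun h ↦ (σ.flagMap f).2.1 (Sum.inl_injective h), (σ.flagMap f).2.2⟩
    · exact ⟨Sum.inr_ne_inl, (σ.vert w).2⟩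
  · rintro (f | w') w h
    · exact (σ.vertex_flagMap f).trans (congrArg (fun w ↦ (σ.vert w).1) h)
    · exact congrArg (fun w ↦ (σ.vert w).1) h
  · rintro (f | w') w h
    · have h' : τ.vertex (σ.flagMap f).1 = (σ.vert w).1 :=
        (σ.vertex_flagMap f).trans (congrArg (fun w ↦ (σ.vert w).1) h)
      have h1 := σ.flagValue_flagFiberIso f w h h'
      have h2 : F.flagValue (σ.flagMap f).1 (σ.vert w).1 h' ≫ (σ.flagFiberIso f).inv =
          (σ.sectionsIso w).inv ≫ F₁.flagValue f w h :=
        (Iso.comp_inv_eq _).2 (by rw [Category.assoc, h1, Iso.inv_hom_id_assoc])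
      exact h2
    · obtain rfl : w' = w := h
      have h2 : (-F.contractOn (σ.vert w').1) ≫ (eT w').hom =
          (σ.sectionsIso w').inv ≫ (-F₁.contractOn w') := by
        rw [← heT w', Preadditive.neg_comp, Preadditive.comp_neg, Iso.inv_hom_id_assoc]
      exact h2
  · intro Z y hy
    suffices h : y = 0 by rw [h, zero_comp]
    obtain hc | hc := F.constantType (τ.tail t₀)
    · exact F.eq_zero_of_valence (F.valence_of_isConstantOn hc) (.inl t₀) fun f h hf ↦
        hy (.inl f) h fun h' ↦ hf (Sum.inl_injective h')
    · have h1 : (show Z ⟶ F.sections (τ.tail t₀) from y) ≫ F.contractOn (τ.tail t₀) = 0 :=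
        neg_eq_zero.1 ((Preadditive.comp_neg _ _).symm.trans (hy (.inr _) rfl Sum.inr_ne_inl))
      exact eq_zero_of_comp_contract _ _ (F.bundle _) (F.invertible _) hc h1
  · intro Z h hr h₀ k hk
    have hz {v : τ.V} (hv : v = τ.tail t₀ ∧ τ.valence v = 3 ∧ F.IsConstantOn v) :
        IsZero (F.piece (.inr v)) := by
      obtain ⟨q, hq⟩ := σ.contracted_st v hv
      exact isZero_pushforward_sheafHom (F.spin v) (F.bundle v) (F.invertible v) (q ≫ F₁.φ) x
        (by rw [← hφ, ← Category.assoc, hq, Category.assoc])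
    obtain f | v := k
    · obtain ⟨hf, hv⟩ : τ.vertex f = τ.tail t₀ ∧ _ := hk
      by_cases hft : f = .inl t₀
      · rw [hft, h₀]
      obtain ⟨f', hf', hne, hl⟩ := τ.exists_third_flag (hf ▸ hv.1 : τ.valence (τ.tail t₀) = 3)
        (f₀ := .inl t₀) rfl hf hft
      have h1 := add_eq_zero_of_comp_eq_zero
        F.sectionsDecomposition F.pieceDecomposition F.mapRestriction_π hr
        (k := .inl f) (k' := .inl f') (fun h ↦ hne (Sum.inl_injective h)) hf hf'
        fun l hlv hlf hlf' ↦ ?_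
      · exact F.eq_zero_of_flagValue_comp hf hf' hne h1
      · obtain l | v := l
        · rw [hl l hlv (fun h ↦ hlf (congrArg _ h)) (fun h ↦ hlf' (congrArg _ h)), h₀]
        · refine (hz ?_).eq_of_src _ _
          obtain rfl : v = τ.tail t₀ := hlv
          exact ⟨rfl, hf ▸ hv⟩
    · exact (hz hk).eq_of_src _ _

end Map

end SusyNormal

end

open SusyNormal in
theorem mainTheorem11 {B : Scheme.{0}} (b : B ⟶ Spec (.of ℂ)) {J : Type} [Finite J]
    (τ : MarkedTree J) (t₀ : J) (τ₁ : MarkedTree {j : J // j ≠ t₀}) :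
    (∀ (F : SpinCurve B τ) (F₁ : SpinCurve B τ₁), τ.IsStable → τ₁.IsStable →
      Stabilization F t₀ (fun v ↦ v = τ.tail t₀ ∧ τ.valence v = 3) F₁ →
      ∃ (g : F.susyNormal ⟶ F₁.susyNormal) (w : F.tailMap t₀ ≫ g = 0),
        (ShortComplex.mk (F.tailMap t₀) g w).ShortExact) ∧
    (∀ {X : Scheme.{0}} (x : X ⟶ Spec (.of ℂ)) [Smooth x] [IsSeparated x]
      (F : StableSpinMap b x τ) (F₁ : StableSpinMap b x τ₁)
      (σ : Stabilization F.toSpinCurve t₀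
        (fun v ↦ v = τ.tail t₀ ∧ τ.valence v = 3 ∧ F.IsConstantOn v) F₁.toSpinCurve),
      σ.st ≫ F₁.φ = F.φ →
      ∃ (g : F.mapSusyNormal ⟶ F₁.mapSusyNormal) (w : F.mapTailMap t₀ ≫ g = 0),
        (ShortComplex.mk (F.mapTailMap t₀) g w).ShortExact) := by
  by_cases hB : Nonempty B
  · exact ⟨fun F F₁ hτ _ σ ↦ exists_shortExact_susyNormal F hτ σ,
      fun x _ _ F F₁ σ hφ ↦ exists_shortExact_mapSusyNormal F σ hφ⟩
  · have : IsEmpty B := not_nonempty_iff.1 hB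
    exact ⟨fun F F₁ _ _ _ ↦ exists_shortExact_of_isZero isZero_modules_of_isEmpty _,
      fun x _ _ F F₁ _ _ ↦ exists_shortExact_of_isZero isZero_modules_of_isEmpty _⟩
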